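/- **Setting.** Let $0<R_{\rm f}'<R_{\rm f}''$, let $V\in C^2([0,R_{\rm f}''];\mathbb R)$ with $V(R_{\rm f}'')>0$ and $p\in C^2((0,+\infty);\mathbb R)$ satisfy: $V'\le 0$, $V+\rho V'>0$, $2V'+\rho V''\le 0$ on $[0,R_{\rm f}'']$; $p'>0$, $2p'+\rho p''>0$ on $(0,+\infty)$; $V'+p'>0$, $V<\rho p'$ on $[R_{\rm f}',R_{\rm f}'']$. Put $V_{\max}=V(0)$, $V_{\min}=V(R_{\rm f}'')$, $W_{\max}=p(R_{\rm f}'')+V_{\min}$, $W_{\rm c}=p(R_{\rm f}')+V(R_{\rm f}')$, $R_{\max}=p^{-1}(W_{\max})$, and fix $V_{\rm c}\in(0,V_{\min}]$ and $Q_0\in(0,R_{\rm f}''V_{\min})$. States are $u=(\rho,v)\in\Omega=\Omega_{\rm f}\cup\Omega_{\rm c}$, where $$\Omega_{\rm f}=\{u\in[0,R_{\rm f}'']\times[V_{\min},V_{\max}]: v=V(\rho)\},\quad \Omega_{\rm c}=\{u\in[R_{\rm f}',R_{\max}]\times[0,V_{\rm c}]: W_{\rm c}\le v+p(\rho)\le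 W_{\max}\}.$$ A state in $\Omega_{\rm f}\cap\Omega_{\rm c}$ (non-empty only if $V_{\rm c}=V_{\min}$) is counted as free; so "congested" means $u\in\Omega_{\rm c}\setminus\Omega_{\rm f}$. Let $Q(u)=\rho v$; $W(u)=W_{\rm c}$ if $\rho<R_{\rm f}'$ and $W(u)=v+p(\rho)$ if $\rho\ge R_{\rm f}'$; $\sigma(u,u')=(Q(u')-Q(u))/(\rho'-\rho)$; $u_{\rm c}(w)=(p^{-1}(w-V_{\rm c}),V_{\rm c})$; and $u_{\rm f}(w)=(r,V(r))$, where $r\in[R_{\rm f}',R_{\rm f}'']$ solves $V(r)+p(r)=w$. Write $q_*=Q(u_*)$, $w_*=W(u_*)$, $\hat q=Q(\hat u)$, $\hat w=W(\hat u)$, etc. **Weak solutions.** For $J\subseteq\mathbb R$, a measurable $u:(0,\infty)\times\mathbb R\to\Omega$ (defined a.e.) is a *weak solution with exceptional set $J$* of the two-phase Riemann problem with datum $(u_\ell,u_r)$ if * $u(t,\cdot)\to u_\ell\mathbf 1_{x<0}+u_r\mathbf 1_{x>0}$ in $L^1_{\rm loc}(\mathbb R)$ as $t\to0^+$; * $\rho_t+Q(u)_x=0$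 in the sense of distributions on $\{t>0\}$ (also across phase transitions); * $(\rho W(u))_t+(Q(u)W(u))_x=0$ in the sense of distributions on every open set $G\subseteq\{t>0,\ x\notin J\}$ on which $u$ is a.e. congested. A function $f$ of one real variable stands for the self-similar function $(t,x)\mapsto f(x/t)$. Values at jump points are immaterial. **Unconstrained solvers.** $\mathcal R_{\rm LWR}$ is the Lax solution for $\rho_t+(\rho V(\rho))_x=0$. $\mathcal R_{\rm ARZ}[u_\ell,u_r]$ is a 1-wave (a shock, or a rarefaction along $v=w_\ell-p(\rho)$) from $u_\ell$ to $u_m=(p^{-1}(w_\ell-v_r),v_r)$, followed by a contact discontinuity of speed $v_r$ from $u_m$ to $u_r$. $\mathcal R_1[u_\ell,u_r]$ is $\mathcal R_{\rm LWR}[u_\ell,u_r]$ if both states are free and $\mathcal R_{\rm ARZ}[u_\ell,u_r]$ if both are congested. If $u_\ell$ is free and $u_r$ congested, it is $u_\ell$ for $x<\sigma(u_\ell,u_m)$ and $\mathcal R_{\rm ARZ}[u_m,u_r](x)$ for $x>\sigma(u_\ell,u_m)$. If $u_\ell$ is congested and $u_r$ free, it is $\mathcal R_{\rm ARZ}[u_\ell,u_{\rm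 c}(w_\ell)](x)$ for $x<\sigma(u_{\rm c}(w_\ell),u_{\rm f}(w_\ell))$ and $\mathcal R_{\rm LWR}[u_{\rm f}(w_\ell),u_r](x)$ for larger $x$. $\mathcal R_2[u_\ell,u_r]$ is the single jump from $u_\ell$ to $u_r$ at $x=\sigma(u_\ell,u_r)$ if $u_\ell$ is free, $u_r$ is congested, $\rho_\ell\ne0$ and $w_\ell<w_r$; otherwise $\mathcal R_2=\mathcal R_1$. Let $\mathcal C_i$ be the set of $(u_\ell,u_r)\in\Omega^2$ with $Q(\mathcal R_i[u_\ell,u_r](0^\pm))\le Q_0$, and $\mathcal N_i=\Omega^2\setminus\mathcal C_i$. **Constrained solvers.** $\mathcal R_i^{\rm c}=\mathcal R_i$ on $\mathcal C_i$. For $(u_\ell,u_r)\in\mathcal N_1$, $$\mathcal R_1^{\rm c}[u_\ell,u_r](x)=\mathcal R_1[u_\ell,\hat u](x)\ (x<0),\qquad \mathcal R_1[\check u,u_r](x)\ (x>0),\tag{A}$$ where $(\hat u,\check u)\in\Omega_{\rm c}\times\Omega$ satisfies $$\mathcal R_1[u_\ell,\hat u](0^-)=\hat u,\quad \mathcal R_1[\check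 u,u_r](0^+)=\check u,\quad \hat q=\check q\le Q_0,\quad \hat w=w_\ell,\tag{B}$$ and $\hat q'<\hat q$ for every other pair $(\hat u',\check u')\in\Omega^2$ satisfying (B). For $(u_\ell,u_r)\in\mathcal N_2$ let $(\hat u,\check u)\in\Omega_{\rm c}\times\Omega$ satisfy $$\mathcal R_2[\check u,u_r](0^+)=\check u,\quad \hat q=\check q=\min\{Q_0,Q(u_{\rm c}(W_{\max}))\},\quad \hat w\ge w_\ell,$$ and be such that every other pair $(\hat u',\check u')\in\Omega_{\rm c}\times\Omega$ satisfying this has $\hat w'>\hat w$, or $\check w'<\check w$, or $\check w'=\check w$ with $\check u\in\Omega_{\rm c}$, $\check u'\notin\Omega_{\rm c}$. Then $\mathcal R_2^{\rm c}[u_\ell,u_r]$ equals $\mathcal R_2[\check u,u_r]$ for $x>0$. For $x<0$ it equals $\mathcal R_2[u_\ell,\hat u]$, except that if $u_\ell$ is congested, $u_r$ is free and $Q_0>Q(u_{\rm c}(w_\ell))$, it equals $\mathcal R_2[u_\ell,u_{\rm f}(w_\ell)](x)$ for $x<\sigma(u_{\rm f}(w_\ell),\hat u)$ and $\hat u$ for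 $\sigma(u_{\rm f}(w_\ell),\hat u)<x<0$. **Proposition.** Let $(u_\ell,u_r)\in\Omega^2$. 1. For $i=1,2$, $u(t,x)=\mathcal R_i^{\rm c}[u_\ell,u_r](x/t)$ is a weak solution, with exceptional set $J=\emptyset$ if $(u_\ell,u_r)\in\mathcal C_i$ and $J=\{0\}$ if $(u_\ell,u_r)\in\mathcal N_i$. The traces $u(t,0^\pm)$ exist and $Q(u(t,0^\pm))\le Q_0$ for every $t>0$. 2. Let $(u_\ell,u_r)\in\mathcal N_1$. Then $u(t,x)=\mathcal R_1^{\rm c}[u_\ell,u_r](x/t)$ is of the form (A) with a pair in $\Omega_{\rm c}\times\Omega$ satisfying (B), and $Q(u(t,0^-))=Q(u(t,0^+))$ is independent of $t$. For every weak solution $u'$ (with exceptional set $\{0\}$) that is self-similar of the form (A) with a pair $(\hat u,\check u)\in\Omega^2$ satisfying (B), one has $Q(u'(t,0^-))=Q(u'(t,0^+))\le Q(u(t,0^\pm))$, also independent of $t$, with equality if and only if $u'=u$ almost everywhere. -/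

import Mathlib

open Set Filter Topology MeasureTheory
open scoped ContDiff

namespace TwoPhase

/-- The parameters of the two-phase traffic model with a point constraint at `x = 0`:
the densities `0 < Rf1 < Rf2`, the free-flow speed `V` on `[0, Rf2]`, the pressure `p` on
`(0, ∞)`, the maximal congested speed `Vc` and the maximal flow `Q0` allowed through `x = 0`. -/
structure Model where
  Rf1 : ℝ
  Rf2 : ℝ
  V : ℝ → ℝ
  p : ℝ → ℝ
  Vc : ℝ
  Q0 : ℝ
  Rf1_pos : 0 < Rf1
  Rf1_lt_Rf2 : Rf1 < Rf2
  V_contDiffOn : ContDiffOn ℝ 2 V (Icc 0 Rf2)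
  V_Rf2_pos : 0 < V Rf2
  p_contDiffOn : ContDiffOn ℝ 2 p (Ioi 0)
  H1 : ∀ r ∈ Icc 0 Rf2,
    derivWithin V (Icc 0 Rf2) r ≤ 0 ∧
    0 < V r + r * derivWithin V (Icc 0 Rf2) r ∧
    2 * derivWithin V (Icc 0 Rf2) r + r * iteratedDerivWithin 2 V (Icc 0 Rf2) r ≤ 0
  H2 : ∀ r ∈ Ioi (0 : ℝ), 0 < deriv p r ∧ 0 < 2 * deriv p r + r * iteratedDeriv 2 p r
  H3 : ∀ r ∈ Icc Rf1 Rf2,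
    0 < derivWithin V (Icc 0 Rf2) r + deriv p r ∧ V r < r * deriv p r
  Vc_pos : 0 < Vc
  Vc_le : Vc ≤ V Rf2
  Q0_pos : 0 < Q0
  Q0_lt : Q0 < Rf2 * V Rf2

/-- A state `u = (ρ, v)`: density and speed. -/
abbrev State := ℝ × ℝ

/-- The flow. -/
def Q (u : State) : ℝ := u.1 * u.2

/-- Speed of a discontinuity. -/
noncomputable def σ (ul ur : State) : ℝ := (Q ur - Q ul) / (ur.1 - ul.1)

/-- `f` has one-sided traces at `0`, and the flow of both is `q`. -/
def HasFlowAtZero (f : ℝ → State) (q : ℝ) : Prop :=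
  ∃ a b : State, Tendsto f (𝓝[<] 0) (𝓝 a) ∧ Tendsto f (𝓝[>] 0) (𝓝 b) ∧
    Q a = q ∧ Q b = q

namespace Model

variable (M : Model)

def Vmax : ℝ := M.V 0
def Vmin : ℝ := M.V M.Rf2
def Wmax : ℝ := M.p M.Rf2 + M.Vmin
def Wc : ℝ := M.p M.Rf1 + M.V M.Rf1

/-- The inverse of the increasing map `p : (0, ∞) → ℝ`. -/
noncomputable def pInv (y : ℝ) : ℝ := Function.invFunOn M.p (Ioi 0) y

noncomputable def Rmax : ℝ := M.pInv M.Wmax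

/-- Free phase. -/
def Ωf : Set State :=
  {u | u.1 ∈ Icc 0 M.Rf2 ∧ u.2 ∈ Icc M.Vmin M.Vmax ∧ u.2 = M.V u.1}

/-- Congested phase. -/
def Ωc : Set State :=
  {u | u.1 ∈ Icc M.Rf1 M.Rmax ∧ u.2 ∈ Icc 0 M.Vc ∧ M.p u.1 + u.2 ∈ Icc M.Wc M.Wmax}

def Ω : Set State := M.Ωf ∪ M.Ωc

open scoped Classical in
/-- The Lagrangian marker: `Wc` on free states with `ρ < Rf1`, and `v + p(ρ)` on all the other
states of `Ω` (congested states have `ρ ≥ Rf1`). -/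
noncomputable def W (u : State) : ℝ := if u.1 < M.Rf1 then M.Wc else u.2 + M.p u.1

/-- The congested state with marker `w` and speed `Vc`. -/
noncomputable def uc (w : ℝ) : State := (M.pInv (w - M.Vc), M.Vc)

/-- The density `ρ ∈ [Rf1, Rf2]` with `V(ρ) + p(ρ) = w`. -/
noncomputable def rhof (w : ℝ) : ℝ :=
  Function.invFunOn (fun r => M.V r + M.p r) (Icc M.Rf1 M.Rf2) w

/-- The free state with marker `w`. -/
noncomputable def uf (w : ℝ) : State := (M.rhof w, M.V (M.rhof w))

/-- Characteristic speed of the free phase. -/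
noncomputable def lamf (r : ℝ) : ℝ := M.V r + r * derivWithin M.V (Icc 0 M.Rf2) r

/-- First characteristic speed of the congested phase, along the Lax curve
`v = w - p(ρ)` with marker `w`. -/
noncomputable def lam1 (w r : ℝ) : ℝ := w - M.p r - r * deriv M.p r

/-! The Riemann solvers are defined pointwise; their values at the finitely many points of
discontinuity are immaterial. -/

open scoped Classical in
/-- Lax solution of the Riemann problem for the scalar law `ρ_t + (ρ V(ρ))_x = 0` with concave
flux: a jump if `ρ_ℓ ≤ ρ_r`, a rarefaction `lamf(ρ) = x` if `ρ_ℓ > ρ_r`. -/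
noncomputable def RLWR (ul ur : State) (x : ℝ) : State :=
  if ul.1 ≤ ur.1 then
    if x < σ ul ur then ul else ur
  else
    if x < M.lamf ul.1 then ul
    else if x ≤ M.lamf ur.1 then
      (Function.invFunOn M.lamf (Icc ur.1 ul.1) x,
        M.V (Function.invFunOn M.lamf (Icc ur.1 ul.1) x))
    else ur

/-- The state with the marker of `ul` and the speed of `ur`. -/
noncomputable def um (ul ur : State) : State := (M.pInv (M.W ul - ur.2), ur.2)

open scoped Classical in
/-- Lax solution of the Riemann problem for the ARZ system in the congested phase: a 1-wave
(a shock if the speed does not increase, a rarefaction otherwise) from `ul` to `um ul ur`,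
followed by a 2-contact discontinuity of speed `v_r` from `um ul ur` to `ur`. -/
noncomputable def RARZ (ul ur : State) (x : ℝ) : State :=
  if x < ur.2 then
    if ur.2 ≤ ul.2 then
      if x < σ ul (M.um ul ur) then ul else M.um ul ur
    else
      if x < M.lam1 (M.W ul) ul.1 then ul
      else if x ≤ M.lam1 (M.W ul) (M.um ul ur).1 then
        (Function.invFunOn (M.lam1 (M.W ul)) (Icc (M.um ul ur).1 ul.1) x,
          M.W ul - M.p (Function.invFunOn (M.lam1 (M.W ul)) (Icc (M.um ul ur).1 ul.1) x))
      else M.um ul ur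
  else ur

open scoped Classical in
/-- The first unconstrained Riemann solver on `Ω × Ω`. The two phases can intersect only when
`Vc = Vmin`; a common state is then counted as free, so that the four cases exclude
each other. -/
noncomputable def R1 (ul ur : State) (x : ℝ) : State :=
  if ul ∈ M.Ωf then
    if ur ∈ M.Ωf then M.RLWR ul ur x
    else if x < σ ul (M.um ul ur) then ul else M.RARZ (M.um ul ur) ur x
  else
    if ur ∈ M.Ωf then
      if x < σ (M.uc (M.W ul)) (M.uf (M.W ul)) then M.RARZ ul (M.uc (M.W ul)) x
      else M.RLWR (M.uf (M.W ul)) ur x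
    else M.RARZ ul ur x

open scoped Classical in
/-- The second unconstrained Riemann solver on `Ω × Ω`. -/
noncomputable def R2 (ul ur : State) (x : ℝ) : State :=
  if ul ∈ M.Ωf ∧ ur ∉ M.Ωf ∧ ul.1 ≠ 0 ∧ M.W ul < M.W ur then
    if x < σ ul ur then ul else ur
  else M.R1 ul ur x

/-- `f` has one-sided traces at `0`, and the flow of both is at most `Q0`. -/
def FluxConstraint (f : ℝ → State) : Prop :=
  ∃ a b : State, Tendsto f (𝓝[<] 0) (𝓝 a) ∧ Tendsto f (𝓝[>] 0) (𝓝 b) ∧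
    Q a ≤ M.Q0 ∧ Q b ≤ M.Q0

/-- Riemann data whose unconstrained solution satisfies the constraint. -/
def C1 : Set (State × State) := {d | d.1 ∈ M.Ω ∧ d.2 ∈ M.Ω ∧ M.FluxConstraint (M.R1 d.1 d.2)}
def C2 : Set (State × State) := {d | d.1 ∈ M.Ω ∧ d.2 ∈ M.Ω ∧ M.FluxConstraint (M.R2 d.1 d.2)}

/-- Riemann data whose unconstrained solution violates the constraint. -/
def N1 : Set (State × State) := (M.Ω ×ˢ M.Ω) \ M.C1
def N2 : Set (State × State) := (M.Ω ×ˢ M.Ω) \ M.C2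

end Model

open scoped Classical in
/-- Juxtaposition at `x = 0`. -/
noncomputable def glue (f g : ℝ → State) (x : ℝ) : State := if x < 0 then f x else g x

namespace Model

variable (M : Model)

/-- Admissible pairs of traces `(uh, uk)` at `x = 0` for the first constrained solver. -/
def R1Cond (ul ur uh uk : State) : Prop :=
  Tendsto (M.R1 ul uh) (𝓝[<] 0) (𝓝 uh) ∧ Tendsto (M.R1 uk ur) (𝓝[>] 0) (𝓝 uk) ∧
    Q uh = Q uk ∧ Q uk ≤ M.Q0 ∧ M.W uh = M.W ul

/-- The admissible pair in `Ωc × Ω` whose flow is strictly larger than that of any other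
admissible pair in `Ω × Ω`. -/
def IsR1Pair (ul ur : State) (d : State × State) : Prop :=
  d.1 ∈ M.Ωc ∧ d.2 ∈ M.Ω ∧ M.R1Cond ul ur d.1 d.2 ∧
    ∀ e : State × State, e.1 ∈ M.Ω → e.2 ∈ M.Ω → e ≠ d → M.R1Cond ul ur e.1 e.2 →
      Q e.1 < Q d.1

noncomputable def pair1 (ul ur : State) : State × State := Classical.epsilon (M.IsR1Pair ul ur)

open scoped Classical in
/-- The first constrained Riemann solver. -/
noncomputable def R1c (ul ur : State) : ℝ → State :=
  if (ul, ur) ∈ M.C1 then M.R1 ul ur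
  else glue (M.R1 ul (M.pair1 ul ur).1) (M.R1 (M.pair1 ul ur).2 ur)

/-- Admissible pairs of traces `(uh, uk)` at `x = 0` for the second constrained solver. -/
def R2Cond (ul ur uh uk : State) : Prop :=
  Tendsto (M.R2 uk ur) (𝓝[>] 0) (𝓝 uk) ∧
    Q uh = min M.Q0 (Q (M.uc M.Wmax)) ∧ Q uk = min M.Q0 (Q (M.uc M.Wmax)) ∧
    M.W ul ≤ M.W uh

/-- The admissible pair in `Ωc × Ω` that minimizes the marker of the left trace and maximizes
that of the right trace. When a congested and a free right trace have the same marker, the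
congested one is taken. -/
def IsR2Pair (ul ur : State) (d : State × State) : Prop :=
  d.1 ∈ M.Ωc ∧ d.2 ∈ M.Ω ∧ M.R2Cond ul ur d.1 d.2 ∧
    ∀ e : State × State, e.1 ∈ M.Ωc → e.2 ∈ M.Ω → e ≠ d → M.R2Cond ul ur e.1 e.2 →
      M.W d.1 < M.W e.1 ∨ M.W e.2 < M.W d.2 ∨
        (M.W e.2 = M.W d.2 ∧ d.2 ∈ M.Ωc ∧ e.2 ∉ M.Ωc)

noncomputable def pair2 (ul ur : State) : State × State := Classical.epsilon (M.IsR2Pair ul ur)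

open scoped Classical in
/-- The second constrained Riemann solver. -/
noncomputable def R2c (ul ur : State) : ℝ → State :=
  if (ul, ur) ∈ M.C2 then M.R2 ul ur
  else if ul ∉ M.Ωf ∧ ur ∈ M.Ωf ∧ Q (M.uc (M.W ul)) < M.Q0 then
    glue
      (fun x => if x < σ (M.uf (M.W ul)) (M.pair2 ul ur).1 then M.R2 ul (M.uf (M.W ul)) x
        else (M.pair2 ul ur).1)
      (M.R2 (M.pair2 ul ur).2 ur)
  else glue (M.R2 ul (M.pair2 ul ur).1) (M.R2 (M.pair2 ul ur).2 ur)

end Model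

/-- The function `(t, x) ↦ f (x / t)`. -/
noncomputable def selfSimilar (f : ℝ → State) (t x : ℝ) : State := f (x / t)

/-- The open half plane `{(t, x) : t > 0}`. -/
def halfPlane : Set (ℝ × ℝ) := {z | 0 < z.1}

open scoped Classical in
/-- Weak solutions of the two-phase model with Riemann datum `(ul, ur)`. The mass is conserved on
the whole half plane, also across phase transitions; the generalized momentum `ρ W` is conserved
inside the congested phase, except possibly across the lines `{x = a}`, `a ∈ J`. In the free
phase the equation `v = V(ρ)` is part of the membership in `Ωf`. -/
structure IsWeakSolution (M : Model) (J : Set ℝ) (ul ur : State) (u : ℝ → ℝ → State) :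
    Prop where
  aemeasurable : AEMeasurable (fun z : ℝ × ℝ => u z.1 z.2) (volume.restrict halfPlane)
  mem : ∀ᵐ z ∂(volume.restrict halfPlane), u z.1 z.2 ∈ M.Ω
  initial : ∀ K : ℝ, Tendsto
    (fun t : ℝ => ∫⁻ x in Icc (-K) K, ‖u t x - (if x < 0 then ul else ur)‖ₑ) (𝓝[>] 0) (𝓝 0)
  mass : ∀ φ : ℝ × ℝ → ℝ, ContDiff ℝ ∞ φ → HasCompactSupport φ → tsupport φ ⊆ halfPlane →
    ∫ z in halfPlane, ((u z.1 z.2).1 * fderiv ℝ φ z (1, 0)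
      + Q (u z.1 z.2) * fderiv ℝ φ z (0, 1)) = 0
  momentum : ∀ G : Set (ℝ × ℝ), IsOpen G → G ⊆ halfPlane → (∀ z ∈ G, z.2 ∉ J) →
    (∀ᵐ z ∂(volume.restrict G), u z.1 z.2 ∈ M.Ωc \ M.Ωf) →
    ∀ φ : ℝ × ℝ → ℝ, ContDiff ℝ ∞ φ → HasCompactSupport φ → tsupport φ ⊆ G →
    ∫ z in G, ((u z.1 z.2).1 * M.W (u z.1 z.2) * fderiv ℝ φ z (1, 0)
      + Q (u z.1 z.2) * M.W (u z.1 z.2) * fderiv ℝ φ z (0, 1)) = 0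

end TwoPhase

/-!
All solvers are self-similar, and everything is reduced to functions of the slope `ξ = x / t`.
A bounded self-similar pair `(a, b)` satisfies `a_t + b_x = 0` in the sense of distributions as
soon as its flux through rays `b - ξ a` is continuous with derivative `-a` off a countable set
(`ConservedOn`, `ConservedOn.integral_eq_zero`). This form is stable under joining two profiles at
a slope where the fluxes through rays agree (the Rankine-Hugoniot condition,
`ConservedOn.ite_lt`), and in a centred rarefaction of a concave flux the flux through rays is a
Legendre transform, hence convex with the right subgradient (`fan_conservedOn`). So the solvers are
conservative for the mass; the generalized momentum is treated in the same way inside the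
congested phase, where the marker `W` is constant on a 1-wave and jumps at the contact
discontinuity only, through which no flux passes (`MomentumOn`, `RARZ_momentum`).

The hypotheses on `V` and `p` order the waves around `x = 0`: waves inside the free phase have
positive speed, 1-waves of the congested phase and transitions from the congested to the free
phase have nonpositive speed, and the contact discontinuity has speed `v_r ≥ 0`. The congested
phase is parametrized by marker and speed (`cs`); along a Lax curve the flow increases with the
speed (`Q_cs_lt`). The traces of the solvers at `0` can therefore be listed case by case.

If the constraint is violated (`Exceeds`), an admissible left trace of the first constrained solver
is a strictly congested state on the Lax curve of `u_ℓ`, so that it is determined by its flow, and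
this flow is at most `min Q0 (Q (uc (W u_ℓ)))`. Every such flow has exactly one admissible right
trace (`R1_right_trace`). So there is a unique pair of maximal flow (`exists_isR1Pair`), which
yields the maximality and uniqueness statement. For the second solver, the left trace is found by
minimizing the marker (`exists_isMinLeft`), and on the right there are at most two candidates, one
in each phase (`exists_max_right`). The left trace is actually attained by the solution on `x < 0`
(`R2_left_trace`, `detour_speeds`), so that the mass is conserved across `x = 0`.
-/


namespace TwoPhase

/-! ### Self-similar conservation laws -/

/-- The flux of the self-similar pair `(a, b)` through the ray `x = ξ t`. -/
def rayFlux (a b : ℝ → ℝ) (x : ℝ) : ℝ := b x - x * a x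

/-- The self-similar function `(t, x) ↦ (a (x / t), b (x / t))` satisfies `a_t + b_x = 0` on the
sector `x / t ∈ I`, in the form `(b - ξ a)' = -a` for the flux through rays: this flux is
continuous, and differentiable with the right derivative off a countable set. -/
structure ConservedOn (a b : ℝ → ℝ) (I : Set ℝ) : Prop where
  continuousAt : ∀ x ∈ I, ContinuousAt (rayFlux a b) x
  countable : {x ∈ I | ¬ HasDerivAt (rayFlux a b) (-a x) x}.Countable

namespace ConservedOn

variable {a b a' b' : ℝ → ℝ} {I I' : Set ℝ}

theorem mono (h : ConservedOn a b I) (hI : I' ⊆ I) : ConservedOn a b I' :=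
  ⟨fun x hx => h.1 x (hI hx), h.2.mono fun _ hx => And.intro (hI hx.1) hx.2⟩

theorem union (h : ConservedOn a b I) (h' : ConservedOn a b I') : ConservedOn a b (I ∪ I') := by
  refine ⟨fun x hx => hx.elim (h.1 x) (h'.1 x), (h.2.union h'.2).mono ?_⟩
  rintro x ⟨hx | hx, hd⟩
  exacts [Or.inl (And.intro hx hd), Or.inr (And.intro hx hd)]

theorem congr (h : ConservedOn a b I) (ha : ∀ x ∈ I, a' =ᶠ[𝓝 x] a)
    (hb : ∀ x ∈ I, b' =ᶠ[𝓝 x] b) : ConservedOn a' b' I := by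
  have key : ∀ x ∈ I, rayFlux a' b' =ᶠ[𝓝 x] rayFlux a b := by
    intro x hx
    filter_upwards [ha x hx, hb x hx] with y h1 h2
    simp only [rayFlux, h1, h2]
  refine ⟨fun x hx => (h.1 x hx).congr (key x hx).symm, h.2.mono ?_⟩
  rintro x ⟨hx, hd⟩
  refine ⟨hx, fun hd' => hd ?_⟩
  rw [(ha x hx).eq_of_nhds]
  exact hd'.congr_of_eventuallyEq (key x hx)

theorem const (c d : ℝ) (I : Set ℝ) : ConservedOn (fun _ => c) (fun _ => d) I := by
  have h : ∀ x, HasDerivAt (rayFlux (fun _ => c) (fun _ => d)) (-c) x := by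
    intro x
    have h1 := ((hasDerivAt_id x).mul_const c).const_sub d
    rw [one_mul] at h1
    exact h1
  exact ⟨fun x _ => (h x).continuousAt, by simp [h]⟩

theorem const_mul (w : ℝ) (h : ConservedOn a b I) :
    ConservedOn (fun x => w * a x) (fun x => w * b x) I := by
  have e : rayFlux (fun x => w * a x) (fun x => w * b x) = fun x => w * rayFlux a b x := by
    funext x; simp only [rayFlux]; ring
  refine ⟨fun x hx => ?_, h.2.mono ?_⟩
  · rw [e]; exact continuousAt_const.mul (h.1 x hx)
  · rintro x ⟨hx, hd⟩
    refine ⟨hx, fun hd' => hd ?_⟩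
    rw [e]
    simpa using hd'.const_mul w

/-- Two conserved profiles may be joined at a ray through which their fluxes agree: this is the
Rankine-Hugoniot condition. -/
theorem ite_lt (c : ℝ) (h : ConservedOn a b univ) (h' : ConservedOn a' b' univ)
    (hc : rayFlux a b c = rayFlux a' b' c) :
    ConservedOn (fun x => if x < c then a x else a' x) (fun x => if x < c then b x else b' x)
      univ := by
  set A : ℝ → ℝ := fun x => if x < c then a x else a' x
  set B : ℝ → ℝ := fun x => if x < c then b x else b' x
  have hl : ConservedOn A B (Iio c) := by
    refine (h.mono (subset_univ _)).congr ?_ ?_ <;> intro x hx <;>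
      filter_upwards [Iio_mem_nhds hx] with y hy <;> simp [A, B, mem_Iio.1 hy]
  have hr : ConservedOn A B (Ioi c) := by
    refine (h'.mono (subset_univ _)).congr ?_ ?_ <;> intro x hx <;>
      filter_upwards [Ioi_mem_nhds hx] with y hy <;> simp [A, B, (mem_Ioi.1 hy).not_gt]
  have hm : ConservedOn A B {c} := by
    refine ⟨?_, (countable_singleton c).mono fun x hx => hx.1⟩
    rintro x rfl
    have e : rayFlux A B = fun y => if y < x then rayFlux a b y else rayFlux a' b' y := by
      funext y; simp only [rayFlux, A, B]; split_ifs <;> rfl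
    rw [e, continuousAt_iff_continuous_left'_right']
    have hx : (if x < x then rayFlux a b x else rayFlux a' b' x) = rayFlux a' b' x := by simp
    constructor
    · have := (h.1 x trivial).continuousWithinAt (s := Iio x)
      rw [ContinuousWithinAt, hc] at this
      rw [ContinuousWithinAt, hx]
      refine this.congr' ?_
      filter_upwards [self_mem_nhdsWithin] with y hy
      simp [mem_Iio.1 hy]
    · have := (h'.1 x trivial).continuousWithinAt (s := Ioi x)
      rw [ContinuousWithinAt] at this
      rw [ContinuousWithinAt, hx]
      refine this.congr' ?_
      filter_upwards [self_mem_nhdsWithin] with y hy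
      simp [(mem_Ioi.1 hy).not_gt]
  refine ((hl.union hr).union hm).mono fun x _ => ?_
  rcases lt_trichotomy x c with hx | hx | hx
  exacts [Or.inl (Or.inl hx), Or.inr hx, Or.inl (Or.inr hx)]

/-- A convex function is conserved together with its subgradients. In a centred rarefaction the
flux through rays is a Legendre transform, and this lemma applies to it. -/
theorem of_subgradient (ha : Antitone a)
    (hsub : ∀ x y, rayFlux a b x - (y - x) * a x ≤ rayFlux a b y) : ConservedOn a b univ := by
  set g := rayFlux a b
  have key : ∀ x y, |g y - g x + (y - x) * a x| ≤ |y - x| * |a y - a x| := by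
    intro x y
    rw [← abs_mul, abs_of_nonneg (by linarith [hsub x y]), abs_of_nonpos]
    · linarith [hsub y x]
    · rcases le_total x y with hxy | hxy
      · exact mul_nonpos_of_nonneg_of_nonpos (by linarith) (by linarith [ha hxy])
      · exact mul_nonpos_of_nonpos_of_nonneg (by linarith) (by linarith [ha hxy])
  have hcont : ∀ x, ContinuousAt g x := by
    intro x
    obtain ⟨K, hK⟩ : ∃ K, ∀ y ∈ Icc (x - 1) (x + 1), |a y - a x| ≤ K := by
      refine ⟨a (x - 1) - a (x + 1), fun y hy => ?_⟩
      have h1 := ha hy.1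
      have h2 := ha hy.2
      have h3 := ha (show x - 1 ≤ x by linarith)
      have h4 := ha (show x ≤ x + 1 by linarith)
      rw [abs_le]; constructor <;> linarith
    have hz : Tendsto (fun y => |y - x| * (K + |a x|)) (𝓝 x) (𝓝 0) := by
      have : ContinuousAt (fun y : ℝ => |y - x| * (K + |a x|)) x := by fun_prop
      simpa [ContinuousAt] using this
    rw [ContinuousAt, tendsto_iff_norm_sub_tendsto_zero]
    refine squeeze_zero' (Eventually.of_forall fun y => norm_nonneg _) ?_ hz
    filter_upwards [Icc_mem_nhds (show x - 1 < x by linarith) (show x < x + 1 by linarith)]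
      with y hy
    have h1 := key x y
    have h2 : |y - x| * |a y - a x| ≤ |y - x| * K :=
      mul_le_mul_of_nonneg_left (hK y hy) (abs_nonneg _)
    have h3 : |g y - g x| ≤ |g y - g x + (y - x) * a x| + |(y - x) * a x| := by
      have := abs_sub (g y - g x + (y - x) * a x) ((y - x) * a x)
      simpa using this
    rw [abs_mul (y - x)] at h3
    rw [Real.norm_eq_abs]; linarith
  refine ⟨fun x _ => hcont x, ha.countable_not_continuousAt.mono ?_⟩
  rintro x ⟨-, hx⟩ hcx
  refine hx ?_
  rw [hasDerivAt_iff_isLittleO, Asymptotics.isLittleO_iff]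
  intro ε hε
  have := Metric.continuousAt_iff'.1 hcx ε hε
  filter_upwards [this] with y hy
  rw [Real.dist_eq] at hy
  rw [Real.norm_eq_abs, Real.norm_eq_abs, smul_eq_mul, mul_neg, sub_neg_eq_add]
  calc _ ≤ |y - x| * |a y - a x| := key x y
    _ ≤ |y - x| * ε := mul_le_mul_of_nonneg_left hy.le (abs_nonneg _)
    _ = _ := mul_comm _ _

end ConservedOn

theorem integral_eq_zero_of_hasDerivAt_off_countable {F F' : ℝ → ℝ} {s : Set ℝ}
    (hs : s.Countable) (hF : Continuous F) (hd : ∀ x ∉ s, HasDerivAt F (F' x) x)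
    (hi : Integrable F') {N : ℝ} (hN : ∀ x, N < |x| → F x = 0) : ∫ x, F' x = 0 := by
  have h1 := intervalIntegral_tendsto_integral hi (tendsto_neg_atTop_atBot (G := ℝ)) tendsto_id
  refine tendsto_nhds_unique h1 (tendsto_const_nhds.congr' ?_)
  filter_upwards [eventually_gt_atTop (max N 0)] with n hn
  have hn' := max_lt_iff.1 hn
  have habs : |n| = n := abs_of_pos hn'.2
  rw [MeasureTheory.integral_eq_of_hasDerivAt_off_countable F F' hs hF.continuousOn
    (fun x hx => hd x hx.2) hi.intervalIntegrable, id, hN n (by rw [habs]; exact hn'.1),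
    hN (-n) (by rw [abs_neg, habs]; exact hn'.1), sub_zero]

theorem integrable_bounded_mul {X : Type*} [MeasurableSpace X] {μ : Measure X} {a h : X → ℝ}
    (ha : Measurable a) {C : ℝ} (hC : ∀ x, |a x| ≤ C) (hh : Integrable h μ) :
    Integrable (fun x => a x * h x) μ :=
  hh.bdd_mul ha.aestronglyMeasurable (Eventually.of_forall hC)

/-- A self-similar function satisfies its conservation law in the sense of distributions on every
sector `x / t ∈ I` on which the flux through rays has the right derivative. In the coordinates
`(t, ξ)` with `x = t ξ` the integrand is the divergence of the compactly supported field
`(t a ψ, (b - ξ a) ψ)`, where `ψ(t, ξ) = φ(t, t ξ)`. -/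
theorem ConservedOn.integral_eq_zero {a b : ℝ → ℝ} (ha : Measurable a) (hb : Measurable b)
    {C : ℝ} (haC : ∀ x, |a x| ≤ C) (hbC : ∀ x, |b x| ≤ C) {I : Set ℝ}
    (h : ConservedOn a b I) {φ : ℝ × ℝ → ℝ} (hφ : ContDiff ℝ ∞ φ) (hc : HasCompactSupport φ)
    (hs : ∀ z ∈ tsupport φ, 0 < z.1 ∧ z.2 / z.1 ∈ I) :
    ∫ z : ℝ × ℝ, (a (z.2 / z.1) * fderiv ℝ φ z (1, 0) + b (z.2 / z.1) * fderiv ℝ φ z (0, 1))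
      = 0 := by
  have hφ1 : ContDiff ℝ 1 φ := hφ.of_le (by exact_mod_cast le_top)
  have hdφ : ∀ z, HasFDerivAt φ (fderiv ℝ φ z) z := fun z =>
    (hφ1.differentiable (by norm_num) z).hasFDerivAt
  have hcd : Continuous (fderiv ℝ φ) := hφ1.continuous_fderiv (by norm_num)
  have hcd' : HasCompactSupport (fderiv ℝ φ) := hc.fderiv (𝕜 := ℝ)
  have hdc : ∀ v : ℝ × ℝ, HasCompactSupport fun z => fderiv ℝ φ z v := fun v =>
    hcd'.comp_left (g := fun L : ℝ × ℝ →L[ℝ] ℝ => L v) (by simp)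
  have hdsupp : ∀ z, z ∉ tsupport φ → fderiv ℝ φ z = 0 := fun z hz =>
    Function.notMem_support.1 fun hz' => hz (support_fderiv_subset ℝ hz')
  set T : ℝ × ℝ → ℝ × ℝ := fun z => (z.1, z.1 * z.2) with hT
  have hTc : Continuous T := by fun_prop
  set K : Set (ℝ × ℝ) := (fun z : ℝ × ℝ => (z.1, z.2 / z.1)) '' tsupport φ with hK
  have hKc : IsCompact K := by
    refine hc.isCompact.image_of_continuousOn ?_
    exact continuousOn_fst.prodMk
      (continuousOn_snd.div continuousOn_fst fun z hz => (hs z hz).1.ne')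
  have hKT : ∀ z, T z ∈ tsupport φ → z ∈ K := by
    intro z hz
    have h0 : z.1 ≠ 0 := (hs _ hz).1.ne'
    exact ⟨T z, hz, Prod.ext rfl (by simp only [hT]; field_simp)⟩
  have hKpos : ∀ z ∈ K, 0 < z.1 ∧ z.2 ∈ I := by
    rintro _ ⟨z, hz, rfl⟩
    exact hs z hz
  obtain ⟨N, hN⟩ : ∃ N : ℝ, ∀ z ∈ K, |z.1| ≤ N ∧ |z.2| ≤ N := by
    obtain ⟨N, hN⟩ := hKc.isBounded.exists_norm_le
    exact ⟨N, fun z hz => ⟨(norm_fst_le z).trans (hN z hz), (norm_snd_le z).trans (hN z hz)⟩⟩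
  set ψ : ℝ × ℝ → ℝ := fun z => φ (T z) with hψ
  have hψK : ∀ z ∉ K, ψ z = 0 := fun z hz =>
    image_eq_zero_of_notMem_tsupport (f := φ) (x := T z) fun hz' => hz (hKT z hz')
  have hdK : ∀ z ∉ K, fderiv ℝ φ (T z) = 0 := fun z hz => hdsupp _ fun hz' => hz (hKT z hz')
  have hψ1 : ∀ t ξ, HasDerivAt (fun t => ψ (t, ξ)) (fderiv ℝ φ (T (t, ξ)) (1, ξ)) t := by
    intro t ξ
    have h1 : HasDerivAt (fun t : ℝ => T (t, ξ)) (1, ξ) t := by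
      simpa [hT] using (hasDerivAt_id t).prodMk ((hasDerivAt_id t).mul_const ξ)
    exact (hdφ _).comp_hasDerivAt t h1
  have hψ2 : ∀ t ξ, HasDerivAt (fun ξ => ψ (t, ξ)) (fderiv ℝ φ (T (t, ξ)) (0, t)) ξ := by
    intro t ξ
    have h1 : HasDerivAt (fun ξ : ℝ => T (t, ξ)) (0, t) ξ := by
      simpa [hT] using (hasDerivAt_const ξ t).prodMk ((hasDerivAt_id ξ).const_mul t)
    exact (hdφ _).comp_hasDerivAt ξ h1
  have lin1 : ∀ (z : ℝ × ℝ) (y : ℝ), fderiv ℝ φ z (1, y)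
      = fderiv ℝ φ z (1, 0) + y * fderiv ℝ φ z (0, 1) := by
    intro z y
    rw [← smul_eq_mul, ← map_smul, ← map_add]; simp
  have lin2 : ∀ (z : ℝ × ℝ) (y : ℝ), fderiv ℝ φ z (0, y) = y * fderiv ℝ φ z (0, 1) := by
    intro z y
    rw [← smul_eq_mul, ← map_smul]; simp
  -- integrability of continuous functions that vanish off the compact set `K`
  have hint : ∀ k : ℝ × ℝ → ℝ, Continuous k → (∀ z ∉ K, k z = 0) → Integrable k := fun k hk h0 =>
    hk.integrable_of_hasCompactSupport (HasCompactSupport.of_support_subset_isCompact hKc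
      fun z hz => by_contra fun hz' => hz (h0 z hz'))
  have hψc : Continuous ψ := hφ.continuous.comp hTc
  set D1 : ℝ × ℝ → ℝ := fun z => fderiv ℝ φ (T z) (1, z.2) with hD1
  set D2 : ℝ × ℝ → ℝ := fun z => fderiv ℝ φ (T z) (0, z.1) with hD2
  have hD1c : Continuous D1 := (hcd.comp hTc).clm_apply (by fun_prop)
  have hD2c : Continuous D2 := (hcd.comp hTc).clm_apply (by fun_prop)
  set P1 : ℝ × ℝ → ℝ := fun z => a z.2 * (ψ z + z.1 * D1 z) with hP1
  set P2 : ℝ × ℝ → ℝ := fun z => rayFlux a b z.2 * D2 z - a z.2 * ψ z with hP2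
  have hP1i : Integrable P1 := integrable_bounded_mul (ha.comp measurable_snd) (fun z => haC _)
    (hint _ (by fun_prop) fun z hz => by simp [hD1, hψK z hz, hdK z hz])
  have hP2i : Integrable P2 := by
    have i1 : Integrable fun z : ℝ × ℝ => b z.2 * D2 z :=
      integrable_bounded_mul (hb.comp measurable_snd) (fun z => hbC _)
        (hint _ hD2c fun z hz => by simp [hD2, hdK z hz])
    have i2 : Integrable fun z : ℝ × ℝ => a z.2 * (z.2 * D2 z) :=
      integrable_bounded_mul (ha.comp measurable_snd) (fun z => haC _)
        (hint _ (by fun_prop) fun z hz => by simp [hD2, hdK z hz])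
    have i3 : Integrable fun z : ℝ × ℝ => a z.2 * ψ z :=
      integrable_bounded_mul (ha.comp measurable_snd) (fun z => haC _) (hint _ hψc hψK)
    refine ((i1.sub i2).sub i3).congr (Eventually.of_forall fun z => ?_)
    simp only [Pi.sub_apply, hP2, rayFlux]; ring
  have z1 : ∫ z, P1 z = 0 := by
    rw [Measure.volume_eq_prod] at hP1i ⊢
    rw [integral_prod_symm _ hP1i]
    refine integral_eq_zero_of_ae ?_
    filter_upwards [hP1i.prod_left_ae] with ξ hξ
    refine integral_eq_zero_of_hasDerivAt_off_countable (F := fun t => a ξ * (t * ψ (t, ξ)))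
      countable_empty (by fun_prop) (fun t _ => ?_) hξ (N := N) fun t ht => ?_
    · simpa [hP1, hD1] using (((hasDerivAt_id t).mul (hψ1 t ξ)).const_mul (a ξ))
    · rw [hψK (t, ξ) fun hz => absurd (hN _ hz).1 (not_le.2 ht)]; simp
  have z2 : ∫ z, P2 z = 0 := by
    rw [Measure.volume_eq_prod] at hP2i ⊢
    rw [integral_prod _ hP2i]
    refine integral_eq_zero_of_ae ?_
    filter_upwards [hP2i.prod_right_ae] with t ht
    have hloc : ∀ ξ, ξ ∉ I → (fun ξ => rayFlux a b ξ * ψ (t, ξ)) =ᶠ[𝓝 ξ] 0 := by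
      intro ξ hξ
      have : (t, ξ) ∉ K := fun hz => hξ (hKpos _ hz).2
      have h2 : ∀ᶠ η in 𝓝 ξ, (t, η) ∉ K :=
        (hKc.isClosed.isOpen_compl.preimage (by fun_prop : Continuous fun η : ℝ => (t, η))).mem_nhds
          this
      filter_upwards [h2] with η hη
      simp [hψK _ hη]
    refine integral_eq_zero_of_hasDerivAt_off_countable (F := fun ξ => rayFlux a b ξ * ψ (t, ξ))
      h.countable (continuous_iff_continuousAt.2 fun ξ => ?_) (fun ξ hξ => ?_) ht (N := N)
      fun ξ hξ => ?_
    · by_cases hI : ξ ∈ I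
      · exact (h.continuousAt ξ hI).mul (by fun_prop)
      · exact (hloc ξ hI).continuousAt
    · by_cases hI : ξ ∈ I
      · have hd : HasDerivAt (rayFlux a b) (-a ξ) ξ := by
          by_contra hn; exact hξ ⟨hI, hn⟩
        have e : P2 (t, ξ) = -a ξ * ψ (t, ξ)
            + rayFlux a b ξ * fderiv ℝ φ (T (t, ξ)) (0, t) := by
          simp only [hP2, hD2]; ring
        rw [e]
        exact hd.mul (hψ2 t ξ)
      · have hK0 : (t, ξ) ∉ K := fun hz => hI (hKpos _ hz).2
        have : P2 (t, ξ) = 0 := by simp [hP2, hD2, hψK _ hK0, hdK _ hK0]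
        rw [this]
        exact (hasDerivAt_const ξ (0 : ℝ)).congr_of_eventuallyEq (hloc ξ hI)
    · rw [hψK (t, ξ) fun hz => absurd (hN _ hz).2 (not_le.2 hξ), mul_zero]
  have hmd : Measurable fun z : ℝ × ℝ => z.2 / z.1 := measurable_snd.div measurable_fst
  set F : ℝ × ℝ → ℝ := fun z =>
    a (z.2 / z.1) * fderiv ℝ φ z (1, 0) + b (z.2 / z.1) * fderiv ℝ φ z (0, 1) with hF
  have hFi : Integrable F :=
    (integrable_bounded_mul (ha.comp hmd) (fun z => haC _)
      ((hcd.clm_apply continuous_const).integrable_of_hasCompactSupport (hdc _))).add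
    (integrable_bounded_mul (hb.comp hmd) (fun z => hbC _)
      ((hcd.clm_apply continuous_const).integrable_of_hasCompactSupport (hdc _)))
  have hPi : Integrable (fun z => P1 z + P2 z) := hP1i.add hP2i
  have hFP : ∫ z, F z = ∫ z, (P1 z + P2 z) := by
    rw [Measure.volume_eq_prod] at hFi hPi ⊢
    rw [integral_prod _ hFi, integral_prod _ hPi]
    congr 1
    funext t
    rcases le_or_gt t 0 with ht | ht
    · have e1 : ∀ x, F (t, x) = 0 := fun x => by
        simp [hF, hdsupp (t, x) fun hz => absurd (hs _ hz).1 (not_lt.2 ht)]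
      have e2 : ∀ x, P1 (t, x) + P2 (t, x) = 0 := fun x => by
        have hK0 : (t, x) ∉ K := fun hz => absurd (hKpos _ hz).1 (not_lt.2 ht)
        simp [hP1, hP2, hD1, hD2, hψK _ hK0, hdK _ hK0]
      simp [e1, e2]
    · have e := Measure.integral_comp_mul_left (fun x => F (t, x)) t
      rw [abs_of_pos (inv_pos.2 ht), smul_eq_mul] at e
      have e' : ∫ x, F (t, x) = t * ∫ ξ, F (t, t * ξ) := by
        rw [e, ← mul_assoc, mul_inv_cancel₀ ht.ne', one_mul]
      rw [e', ← integral_const_mul]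
      congr 1
      funext ξ
      simp only [hF, hP1, hP2, hD1, hD2, hT, rayFlux, lin1 _ ξ, lin2 _ t,
        mul_div_cancel_left₀ ξ ht.ne']
      ring
  rw [hFP, integral_add hP1i hP2i, z1, z2, add_zero]

/-! ### Centred rarefactions of a concave flux -/

theorem le_tangent_of_antitoneOn_deriv {F lam : ℝ → ℝ} {S : Set ℝ} (hS : S.OrdConnected)
    (hF : ∀ r ∈ S, HasDerivWithinAt F (lam r) S r) (hlam : AntitoneOn lam S) {r s : ℝ}
    (hr : r ∈ S) (hs : s ∈ S) : F s ≤ F r + lam r * (s - r) := by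
  have mvt : ∀ x ∈ S, ∀ y ∈ S, x < y → ∃ c ∈ Ioo x y, F y - F x = lam c * (y - x) := by
    intro x hx y hy hxy
    have hsub : Icc x y ⊆ S := hS.out hx hy
    obtain ⟨c, hc, hc'⟩ := exists_hasDerivAt_eq_slope F lam hxy
      (fun z hz => ((hF z (hsub hz)).continuousWithinAt).mono hsub)
      (fun z hz => (hF z (hsub (Ioo_subset_Icc_self hz))).hasDerivAt
        (mem_of_superset (Icc_mem_nhds hz.1 hz.2) hsub))
    refine ⟨c, hc, ?_⟩
    rw [hc']; field_simp [sub_ne_zero.2 hxy.ne']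
  rcases lt_trichotomy r s with h | h | h
  · obtain ⟨c, hc, e⟩ := mvt r hr s hs h
    have := hlam hr (hS.out hr hs (Ioo_subset_Icc_self hc)) hc.1.le
    nlinarith
  · subst h; simp
  · obtain ⟨c, hc, e⟩ := mvt s hs r hr h
    have := hlam (hS.out hs hr (Ioo_subset_Icc_self hc)) hr hc.2.le
    nlinarith

open scoped Classical in
/-- The density in a centred rarefaction with density `d` on the left, `c ≤ d` on the right and
characteristic speed `lam`. -/
noncomputable def fan (lam : ℝ → ℝ) (c d x : ℝ) : ℝ :=
  if x < lam d then d else if x ≤ lam c then Function.invFunOn lam (Icc c d) x else c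

section fan

variable {lam F : ℝ → ℝ} {c d : ℝ}

theorem fan_mid (hcd : c ≤ d) (hlam : ContinuousOn lam (Icc c d)) {x : ℝ} (h1 : lam d ≤ x)
    (h2 : x ≤ lam c) : Function.invFunOn lam (Icc c d) x ∈ Icc c d ∧
      lam (Function.invFunOn lam (Icc c d) x) = x := by
  have h : ∃ r ∈ Icc c d, lam r = x := intermediate_value_Icc' hcd hlam ⟨h1, h2⟩
  exact ⟨Function.invFunOn_mem h, Function.invFunOn_eq h⟩

theorem fan_mem (hcd : c ≤ d) (hlam : ContinuousOn lam (Icc c d)) (x : ℝ) :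
    fan lam c d x ∈ Icc c d := by
  unfold fan
  split_ifs with h1 h2
  · exact right_mem_Icc.2 hcd
  · exact (fan_mid hcd hlam (not_lt.1 h1) h2).1
  · exact left_mem_Icc.2 hcd

/-- The density in the fan maximizes `F(s) - x s`: its flux through rays is a Legendre transform. -/
theorem fan_isMax (hcd : c ≤ d) (hlam : ContinuousOn lam (Icc c d))
    (hF : ∀ r ∈ Icc c d, ∀ s ∈ Icc c d, F s ≤ F r + lam r * (s - r)) (x : ℝ) {s : ℝ}
    (hs : s ∈ Icc c d) : F s - x * s ≤ F (fan lam c d x) - x * fan lam c d x := by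
  unfold fan
  split_ifs with h1 h2
  · have := hF d (right_mem_Icc.2 hcd) s hs
    nlinarith [hs.2]
  · obtain ⟨h3, h4⟩ := fan_mid hcd hlam (not_lt.1 h1) h2
    have := hF _ h3 s hs
    rw [h4] at this
    linarith
  · have := hF c (left_mem_Icc.2 hcd) s hs
    nlinarith [hs.1]

theorem fan_antitone (hcd : c ≤ d) (hlam : ContinuousOn lam (Icc c d))
    (hF : ∀ r ∈ Icc c d, ∀ s ∈ Icc c d, F s ≤ F r + lam r * (s - r)) :
    Antitone (fan lam c d) := by
  intro x y hxy
  rcases hxy.eq_or_lt with rfl | hxy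
  · exact le_rfl
  have h1 := fan_isMax hcd hlam hF x (fan_mem hcd hlam y)
  have h2 := fan_isMax hcd hlam hF y (fan_mem hcd hlam x)
  by_contra h
  push Not at h
  nlinarith

theorem fan_conservedOn (hcd : c ≤ d) (hlam : ContinuousOn lam (Icc c d))
    (hF : ∀ r ∈ Icc c d, ∀ s ∈ Icc c d, F s ≤ F r + lam r * (s - r)) :
    ConservedOn (fan lam c d) (fun x => F (fan lam c d x)) univ := by
  refine ConservedOn.of_subgradient (fan_antitone hcd hlam hF) fun x y => ?_
  have := fan_isMax hcd hlam hF y (fan_mem hcd hlam x)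
  simp only [rayFlux]
  linarith

end fan

namespace Model

variable (M : Model)

/-! ### The free phase -/

theorem Rf2_pos : 0 < M.Rf2 := M.Rf1_pos.trans M.Rf1_lt_Rf2

theorem V_hasDerivWithinAt {r : ℝ} (hr : r ∈ Icc 0 M.Rf2) :
    HasDerivWithinAt M.V (derivWithin M.V (Icc 0 M.Rf2) r) (Icc 0 M.Rf2) r :=
  (M.V_contDiffOn.differentiableOn (by norm_num) r hr).hasDerivWithinAt

theorem V_continuousOn : ContinuousOn M.V (Icc 0 M.Rf2) := M.V_contDiffOn.continuousOn

theorem V_antitoneOn : AntitoneOn M.V (Icc 0 M.Rf2) :=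
  antitoneOn_of_hasDerivWithinAt_nonpos (convex_Icc _ _) M.V_continuousOn
    (fun _ hx => (M.V_hasDerivWithinAt (interior_subset hx)).mono interior_subset)
    fun r hr => (M.H1 r (interior_subset hr)).1

theorem freeFlux_hasDerivWithinAt {r : ℝ} (hr : r ∈ Icc 0 M.Rf2) :
    HasDerivWithinAt (fun r => r * M.V r) (M.lamf r) (Icc 0 M.Rf2) r := by
  have := (hasDerivWithinAt_id r (Icc 0 M.Rf2)).mul (M.V_hasDerivWithinAt hr)
  simp only [id, one_mul] at this
  exact this

theorem lamf_pos {r : ℝ} (hr : r ∈ Icc 0 M.Rf2) : 0 < M.lamf r := (M.H1 r hr).2.1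

theorem lamf_hasDerivWithinAt {r : ℝ} (hr : r ∈ Icc 0 M.Rf2) :
    HasDerivWithinAt M.lamf (2 * derivWithin M.V (Icc 0 M.Rf2) r
      + r * iteratedDerivWithin 2 M.V (Icc 0 M.Rf2) r) (Icc 0 M.Rf2) r := by
  have hu := uniqueDiffOn_Icc M.Rf2_pos
  have h1 : ContDiffOn ℝ 1 (derivWithin M.V (Icc 0 M.Rf2)) (Icc 0 M.Rf2) :=
    M.V_contDiffOn.derivWithin hu (by norm_num)
  have h2 := (h1.differentiableOn (by norm_num) r hr).hasDerivWithinAt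
  have e : iteratedDerivWithin 2 M.V (Icc 0 M.Rf2) r
      = derivWithin (derivWithin M.V (Icc 0 M.Rf2)) (Icc 0 M.Rf2) r := by
    rw [iteratedDerivWithin_succ, iteratedDerivWithin_one]
  rw [e]
  have h3 := (M.V_hasDerivWithinAt hr).add ((hasDerivWithinAt_id r (Icc 0 M.Rf2)).mul h2)
  simp only [id, one_mul] at h3
  exact h3.congr_deriv (by ring)

theorem lamf_continuousOn : ContinuousOn M.lamf (Icc 0 M.Rf2) := fun _ hr =>
  (M.lamf_hasDerivWithinAt hr).continuousWithinAt

theorem lamf_antitoneOn : AntitoneOn M.lamf (Icc 0 M.Rf2) :=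
  antitoneOn_of_hasDerivWithinAt_nonpos (convex_Icc _ _) M.lamf_continuousOn
    (fun _ hx => (M.lamf_hasDerivWithinAt (interior_subset hx)).mono interior_subset)
    fun r hr => (M.H1 r (interior_subset hr)).2.2

theorem freeFlux_le_tangent {r s : ℝ} (hr : r ∈ Icc 0 M.Rf2) (hs : s ∈ Icc 0 M.Rf2) :
    s * M.V s ≤ r * M.V r + M.lamf r * (s - r) :=
  le_tangent_of_antitoneOn_deriv ordConnected_Icc
    (fun _ h => M.freeFlux_hasDerivWithinAt h) M.lamf_antitoneOn hr hs

theorem freeFlux_strictMonoOn : StrictMonoOn (fun r => r * M.V r) (Icc 0 M.Rf2) :=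
  strictMonoOn_of_hasDerivWithinAt_pos (convex_Icc _ _)
    (fun _ h => (M.freeFlux_hasDerivWithinAt h).continuousWithinAt)
    (fun _ hx => (M.freeFlux_hasDerivWithinAt (interior_subset hx)).mono interior_subset)
    fun _ hr => M.lamf_pos (interior_subset hr)

theorem V_pos {r : ℝ} (hr : r ∈ Icc 0 M.Rf2) : 0 < M.V r :=
  M.V_Rf2_pos.trans_le (M.V_antitoneOn hr (right_mem_Icc.2 M.Rf2_pos.le) hr.2)

theorem Vmin_le_V {r : ℝ} (hr : r ∈ Icc 0 M.Rf2) : M.Vmin ≤ M.V r :=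
  M.V_antitoneOn hr (right_mem_Icc.2 M.Rf2_pos.le) hr.2

theorem V_le_Vmax {r : ℝ} (hr : r ∈ Icc 0 M.Rf2) : M.V r ≤ M.Vmax :=
  M.V_antitoneOn (left_mem_Icc.2 M.Rf2_pos.le) hr hr.1

theorem Vc_le_V {r : ℝ} (hr : r ∈ Icc 0 M.Rf2) : M.Vc ≤ M.V r := M.Vc_le.trans (M.Vmin_le_V hr)

theorem Rf1_mem : M.Rf1 ∈ Icc 0 M.Rf2 := ⟨M.Rf1_pos.le, M.Rf1_lt_Rf2.le⟩

theorem Icc_Rf_subset : Icc M.Rf1 M.Rf2 ⊆ Icc 0 M.Rf2 := Icc_subset_Icc_left M.Rf1_pos.le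

/-! ### The pressure -/

theorem p_hasDerivAt {r : ℝ} (hr : 0 < r) : HasDerivAt M.p (deriv M.p r) r :=
  ((M.p_contDiffOn.differentiableOn (by norm_num)).differentiableAt (Ioi_mem_nhds hr)).hasDerivAt

theorem p_continuousOn : ContinuousOn M.p (Ioi 0) := M.p_contDiffOn.continuousOn

theorem p_strictMonoOn : StrictMonoOn M.p (Ioi 0) :=
  strictMonoOn_of_deriv_pos (convex_Ioi _) M.p_continuousOn fun r hr => by
    rw [interior_Ioi] at hr; exact (M.H2 r hr).1

theorem p_le_p {r s : ℝ} (hr : 0 < r) (hs : 0 < s) : M.p r ≤ M.p s ↔ r ≤ s :=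
  M.p_strictMonoOn.le_iff_le hr hs

theorem p_lt_p {r s : ℝ} (hr : 0 < r) (hs : 0 < s) : M.p r < M.p s ↔ r < s :=
  M.p_strictMonoOn.lt_iff_lt hr hs

/-- The flow along the Lax curve `v = w - p(ρ)`. -/
def curveFlux (w r : ℝ) : ℝ := r * (w - M.p r)

theorem curveFlux_hasDerivAt (w : ℝ) {r : ℝ} (hr : 0 < r) :
    HasDerivAt (M.curveFlux w) (M.lam1 w r) r := by
  have := (hasDerivAt_id r).mul ((M.p_hasDerivAt hr).const_sub w)
  simp only [id, one_mul] at this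
  exact this.congr_deriv (by simp only [lam1]; ring)

theorem lam1_hasDerivAt (w : ℝ) {r : ℝ} (hr : 0 < r) :
    HasDerivAt (M.lam1 w) (-(2 * deriv M.p r + r * iteratedDeriv 2 M.p r)) r := by
  have h1 : ContDiffOn ℝ 1 (deriv M.p) (Ioi 0) :=
    M.p_contDiffOn.deriv_of_isOpen isOpen_Ioi (by norm_num)
  have h2 := ((h1.differentiableOn (by norm_num)).differentiableAt (Ioi_mem_nhds hr)).hasDerivAt
  have e : iteratedDeriv 2 M.p r = deriv (deriv M.p) r := by
    rw [iteratedDeriv_succ, iteratedDeriv_one]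
  rw [e]
  have h3 := ((M.p_hasDerivAt hr).const_sub w).sub ((hasDerivAt_id r).mul h2)
  simp only [id, one_mul] at h3
  exact h3.congr_deriv (by ring)

theorem lam1_continuousOn (w : ℝ) : ContinuousOn (M.lam1 w) (Ioi 0) := fun _ hr =>
  (M.lam1_hasDerivAt w hr).continuousAt.continuousWithinAt

theorem lam1_strictAntiOn (w : ℝ) : StrictAntiOn (M.lam1 w) (Ioi 0) :=
  strictAntiOn_of_hasDerivWithinAt_neg (convex_Ioi _) (M.lam1_continuousOn w)
    (fun r hr => (M.lam1_hasDerivAt w (interior_subset hr)).hasDerivWithinAt)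
    fun r hr => by have := (M.H2 r (interior_subset hr)).2; linarith

theorem curveFlux_le_tangent (w : ℝ) {r s : ℝ} (hr : 0 < r) (hs : 0 < s) :
    M.curveFlux w s ≤ M.curveFlux w r + M.lam1 w r * (s - r) :=
  le_tangent_of_antitoneOn_deriv ordConnected_Ioi
    (fun _ h => (M.curveFlux_hasDerivAt w h).hasDerivWithinAt) (M.lam1_strictAntiOn w).antitoneOn
    (mem_Ioi.2 hr) (mem_Ioi.2 hs)

/-- The pressure may be bounded, but it reaches the largest marker: `ρ p(ρ)` is convex, so that
`p(ρ) ≥ p(R) + R p'(R) (1 - R / ρ)`, and `R p'(R) > V(R)` at `R = Rf2`. -/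
theorem exists_p_ge_Wmax : ∃ r, M.Rf2 < r ∧ M.Wmax ≤ M.p r := by
  set R := M.Rf2
  have hR : 0 < R := M.Rf2_pos
  have h3 := (M.H3 R ⟨M.Rf1_lt_Rf2.le, le_rfl⟩).2
  have hv : 0 < M.Vmin := M.V_Rf2_pos
  set k := R * deriv M.p R
  have hk : M.Vmin < k := h3
  have hkv : 0 < k - M.Vmin := sub_pos.2 hk
  have hr : R < R * k / (k - M.Vmin) := by
    rw [lt_div_iff₀ hkv]; nlinarith
  refine ⟨R * k / (k - M.Vmin), hr, ?_⟩
  set r := R * k / (k - M.Vmin)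
  have hr0 : 0 < r := hR.trans hr
  have e : r * (k - M.Vmin) = R * k := div_mul_cancel₀ _ hkv.ne'
  have h := M.curveFlux_le_tangent 0 hR hr0
  simp only [curveFlux, lam1] at h
  have h5 : r * M.Wmax ≤ r * M.p r := by
    have : M.Wmax = M.p R + M.Vmin := rfl
    rw [this]
    nlinarith
  exact le_of_mul_le_mul_left h5 hr0

theorem pInv_p {r : ℝ} (hr : 0 < r) : M.pInv (M.p r) = r :=
  M.p_strictMonoOn.injOn.leftInvOn_invFunOn (mem_Ioi.2 hr)

theorem pInv_spec {y : ℝ} (h1 : M.p M.Rf1 ≤ y) (h2 : y ≤ M.Wmax) :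
    M.Rf1 ≤ M.pInv y ∧ M.p (M.pInv y) = y := by
  obtain ⟨R, hR, hRW⟩ := M.exists_p_ge_Wmax
  have hle : M.Rf1 ≤ R := M.Rf1_lt_Rf2.le.trans hR.le
  obtain ⟨r, hr, rfl⟩ := intermediate_value_Icc hle
    (M.p_continuousOn.mono fun x hx => M.Rf1_pos.trans_le hx.1) ⟨h1, h2.trans hRW⟩
  rw [M.pInv_p (M.Rf1_pos.trans_le hr.1)]
  exact ⟨hr.1, rfl⟩

/-! ### Markers and Lax curves -/

/-- The range of the marker. -/
def markers : Set ℝ := Icc M.Wc M.Wmax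

/-- On `[Rf1, Rf2]` the marker of a free state increases with the density. -/
theorem Vp_strictMonoOn : StrictMonoOn (fun r => M.V r + M.p r) (Icc M.Rf1 M.Rf2) := by
  have hd : ∀ r ∈ Icc M.Rf1 M.Rf2, HasDerivWithinAt (fun r => M.V r + M.p r)
      (derivWithin M.V (Icc 0 M.Rf2) r + deriv M.p r) (Icc M.Rf1 M.Rf2) r := fun r hr =>
    ((M.V_hasDerivWithinAt (M.Icc_Rf_subset hr)).mono M.Icc_Rf_subset).add
      (M.p_hasDerivAt (M.Rf1_pos.trans_le hr.1)).hasDerivWithinAt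
  exact strictMonoOn_of_hasDerivWithinAt_pos (convex_Icc _ _)
    (fun r hr => (hd r hr).continuousWithinAt)
    (fun r hr => (hd r (interior_subset hr)).mono interior_subset)
    fun r hr => (M.H3 r (interior_subset hr)).1

theorem Vp_continuousOn : ContinuousOn (fun r => M.V r + M.p r) (Icc M.Rf1 M.Rf2) :=
  (M.V_continuousOn.mono M.Icc_Rf_subset).add
    (M.p_continuousOn.mono fun _ hx => M.Rf1_pos.trans_le hx.1)

theorem Vp_mem_markers {r : ℝ} (hr : r ∈ Icc M.Rf1 M.Rf2) : M.V r + M.p r ∈ M.markers := by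
  have h := M.Vp_strictMonoOn.monotoneOn
  have h1 := h (left_mem_Icc.2 M.Rf1_lt_Rf2.le) hr hr.1
  have h2 := h hr (right_mem_Icc.2 M.Rf1_lt_Rf2.le) hr.2
  simp only at h1 h2
  constructor
  · rw [Wc]; linarith
  · rw [Wmax, Vmin]; linarith

theorem Wc_mem : M.Wc ∈ M.markers := by
  have := M.Vp_mem_markers (left_mem_Icc.2 M.Rf1_lt_Rf2.le)
  rwa [add_comm] at this

theorem Wmax_mem : M.Wmax ∈ M.markers := ⟨M.Wc_mem.2, le_rfl⟩

variable {M} in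
theorem rhof_spec {w : ℝ} (hw : w ∈ M.markers) :
    M.rhof w ∈ Icc M.Rf1 M.Rf2 ∧ M.V (M.rhof w) + M.p (M.rhof w) = w := by
  have h : ∃ r ∈ Icc M.Rf1 M.Rf2, (fun r => M.V r + M.p r) r = w := by
    refine intermediate_value_Icc M.Rf1_lt_Rf2.le M.Vp_continuousOn ?_
    have h1 := hw.1
    have h2 := hw.2
    rw [Wc] at h1
    rw [Wmax, Vmin] at h2
    exact ⟨by linarith, by linarith⟩
  exact ⟨Function.invFunOn_mem h, Function.invFunOn_eq (f := fun r => M.V r + M.p r) h⟩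

theorem rhof_eq {r : ℝ} (hr : r ∈ Icc M.Rf1 M.Rf2) : M.rhof (M.V r + M.p r) = r :=
  M.Vp_strictMonoOn.injOn (rhof_spec (M.Vp_mem_markers hr)).1 hr
    (rhof_spec (M.Vp_mem_markers hr)).2

variable {M}

theorem rhof_pos {w : ℝ} (hw : w ∈ M.markers) : 0 < M.rhof w :=
  M.Rf1_pos.trans_le (rhof_spec hw).1.1

/-- To the right of the free state with marker `w`, the first characteristic speed on the Lax
curve with marker `w` is negative. -/
theorem lam1_neg {w : ℝ} (hw : w ∈ M.markers) {r : ℝ} (hr : M.rhof w ≤ r) : M.lam1 w r < 0 := by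
  have h0 := rhof_pos hw
  have h1 := (M.lam1_strictAntiOn w).antitoneOn (mem_Ioi.2 h0) (mem_Ioi.2 (h0.trans_le hr)) hr
  refine h1.trans_lt ?_
  have h2 := (rhof_spec hw).2
  have h3 := (M.H3 _ (rhof_spec hw).1).2
  rw [lam1]; linarith

/-- Along a Lax curve, the flow decreases with the density to the right of the free state. -/
theorem curveFlux_strictAntiOn {w : ℝ} (hw : w ∈ M.markers) :
    StrictAntiOn (M.curveFlux w) (Ici (M.rhof w)) := by
  intro r hr s hs hrs
  have h0 := rhof_pos hw
  have h := M.curveFlux_le_tangent w (h0.trans_le hr) (h0.trans_le hs)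
  have := lam1_neg hw hr
  nlinarith

theorem curveFlux_continuousOn (w : ℝ) : ContinuousOn (M.curveFlux w) (Ioi 0) := fun _ hr =>
  (M.curveFlux_hasDerivAt w hr).continuousAt.continuousWithinAt

theorem curveFlux_rhof {w : ℝ} (hw : w ∈ M.markers) : M.curveFlux w (M.rhof w) = Q (M.uf w) := by
  have h := (rhof_spec hw).2
  have e : w - M.p (M.rhof w) = M.V (M.rhof w) := by linarith
  simp only [curveFlux, Q, uf, e]

/-! ### States -/

variable (M : Model)

/-- The congested state with marker `w` and speed `v`. For `w ∈ markers` and `v ∈ speeds` these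
are exactly the states of `Ωc`. -/
noncomputable def cs (w v : ℝ) : State := (M.pInv (w - v), v)

theorem um_eq (ul ur : State) : M.um ul ur = M.cs (M.W ul) ur.2 := rfl

theorem uc_eq (w : ℝ) : M.uc w = M.cs w M.Vc := rfl

/-- The range of the speed in the congested phase. -/
def speeds : Set ℝ := Icc 0 M.Vc

theorem zero_mem_speeds : (0 : ℝ) ∈ M.speeds := ⟨le_rfl, M.Vc_pos.le⟩

theorem Vc_mem_speeds : M.Vc ∈ M.speeds := ⟨M.Vc_pos.le, le_rfl⟩

variable {M}

section cs

variable {w w' v v' : ℝ}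

theorem cs_spec (hw : w ∈ M.markers) (hv : v ∈ M.speeds) :
    M.Rf1 ≤ (M.cs w v).1 ∧ M.p (M.cs w v).1 = w - v := by
  refine M.pInv_spec ?_ ?_
  · have h1 := hw.1
    have h2 := hv.2
    have h3 := M.Vc_le_V M.Rf1_mem
    rw [Wc] at h1
    linarith
  · linarith [hw.2, hv.1]

theorem cs_pos (hw : w ∈ M.markers) (hv : v ∈ M.speeds) : 0 < (M.cs w v).1 :=
  M.Rf1_pos.trans_le (cs_spec hw hv).1

theorem p_cs (hw : w ∈ M.markers) (hv : v ∈ M.speeds) : M.p (M.cs w v).1 = w - v :=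
  (cs_spec hw hv).2

theorem rhof_le_cs (hw : w ∈ M.markers) (hv : v ∈ M.speeds) : M.rhof w ≤ (M.cs w v).1 := by
  rw [← M.p_le_p (rhof_pos hw) (cs_pos hw hv), p_cs hw hv]
  have h1 := rhof_spec hw
  have h2 := M.Vc_le_V (M.Icc_Rf_subset h1.1)
  have h3 := hv.2
  linarith

theorem Q_cs (hw : w ∈ M.markers) (hv : v ∈ M.speeds) :
    Q (M.cs w v) = M.curveFlux w (M.cs w v).1 := by
  rw [curveFlux, p_cs hw hv, sub_sub_cancel]; rfl

theorem W_cs (hw : w ∈ M.markers) (hv : v ∈ M.speeds) : M.W (M.cs w v) = w := by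
  rw [W, if_neg (not_lt.2 (cs_spec hw hv).1), p_cs hw hv]
  simp [cs]

theorem p_Rmax : M.p M.Rmax = M.Wmax ∧ M.Rf1 ≤ M.Rmax := by
  have h := M.pInv_spec (y := M.Wmax) ?_ le_rfl
  · exact ⟨h.2, h.1⟩
  · have h1 := M.Wmax_mem.1
    have := M.V_pos M.Rf1_mem
    rw [Wc] at h1
    linarith

theorem Rmax_pos : 0 < M.Rmax := M.Rf1_pos.trans_le p_Rmax.2

theorem Rf2_le_Rmax : M.Rf2 ≤ M.Rmax := by
  rw [← M.p_le_p M.Rf2_pos Rmax_pos, p_Rmax.1, Wmax]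
  have : 0 < M.Vmin := M.V_Rf2_pos
  linarith

theorem cs_mem (hw : w ∈ M.markers) (hv : v ∈ M.speeds) : M.cs w v ∈ M.Ωc := by
  have h := cs_spec hw hv
  refine ⟨⟨h.1, ?_⟩, hv, ?_⟩
  · rw [← M.p_le_p (cs_pos hw hv) Rmax_pos, p_Rmax.1, h.2]
    linarith [hw.2, hv.1]
  · rw [h.2, show (M.cs w v).2 = v from rfl, sub_add_cancel]
    exact hw

theorem cs_fst_lt (hw : w ∈ M.markers) (hv : v ∈ M.speeds)
    (hv' : v' ∈ M.speeds) (h : v < v') : (M.cs w v').1 < (M.cs w v).1 := by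
  rw [← M.p_lt_p (cs_pos hw hv') (cs_pos hw hv), p_cs hw hv, p_cs hw hv']
  linarith

theorem cs_fst_le (hw : w ∈ M.markers) (hv : v ∈ M.speeds)
    (hv' : v' ∈ M.speeds) (h : v ≤ v') : (M.cs w v').1 ≤ (M.cs w v).1 := by
  rw [← M.p_le_p (cs_pos hw hv') (cs_pos hw hv), p_cs hw hv, p_cs hw hv']
  linarith

theorem cs_fst_lt_marker (hw : w ∈ M.markers) (hv : v ∈ M.speeds)
    (hw' : w' ∈ M.markers) : (M.cs w v).1 < (M.cs w' v).1 ↔ w < w' := by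
  rw [← M.p_lt_p (cs_pos hw hv) (cs_pos hw' hv), p_cs hw hv, p_cs hw' hv]
  constructor <;> intro <;> linarith

/-- Along a Lax curve the flow increases with the speed. -/
theorem Q_cs_lt (hw : w ∈ M.markers) (hv : v ∈ M.speeds)
    (hv' : v' ∈ M.speeds) : Q (M.cs w v) < Q (M.cs w v') ↔ v < v' := by
  have key : ∀ v ∈ M.speeds, ∀ v' ∈ M.speeds, v < v' → Q (M.cs w v) < Q (M.cs w v') := by
    intro v hv v' hv' h
    rw [Q_cs hw hv, Q_cs hw hv']
    exact curveFlux_strictAntiOn hw (rhof_le_cs hw hv') (rhof_le_cs hw hv)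
      (cs_fst_lt hw hv hv' h)
  refine ⟨fun h => ?_, key v hv v' hv'⟩
  by_contra hn
  rcases (not_lt.1 hn).eq_or_lt with rfl | h'
  · exact lt_irrefl _ h
  · exact lt_asymm h (key v' hv' v hv h')

theorem Q_cs_le (hw : w ∈ M.markers) (hv : v ∈ M.speeds)
    (hv' : v' ∈ M.speeds) : Q (M.cs w v) ≤ Q (M.cs w v') ↔ v ≤ v' := by
  rw [← not_lt, ← not_lt, Q_cs_lt hw hv' hv]

theorem Q_cs_inj (hw : w ∈ M.markers) (hv : v ∈ M.speeds)
    (hv' : v' ∈ M.speeds) (h : Q (M.cs w v) = Q (M.cs w v')) : v = v' :=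
  le_antisymm ((Q_cs_le hw hv hv').1 h.le) ((Q_cs_le hw hv' hv).1 h.ge)

theorem Q_cs_le_uf (hw : w ∈ M.markers) (hv : v ∈ M.speeds) : Q (M.cs w v) ≤ Q (M.uf w) := by
  rw [Q_cs hw hv, ← curveFlux_rhof hw]
  exact (curveFlux_strictAntiOn hw).antitoneOn (mem_Ici.2 le_rfl) (rhof_le_cs hw hv)
    (rhof_le_cs hw hv)

theorem Q_cs_zero : Q (M.cs w 0) = 0 := by simp [Q, cs]

theorem Q_cs_eq : Q (M.cs w v) = (M.cs w v).1 * v := rfl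

/-- Every flow between `0` and that of the fastest congested state is attained on a Lax curve. -/
theorem exists_Q_cs_eq (hw : w ∈ M.markers) {q : ℝ} (h0 : 0 ≤ q) (hq : q ≤ Q (M.uc w)) :
    ∃ v ∈ M.speeds, Q (M.cs w v) = q := by
  have hle := cs_fst_le hw M.zero_mem_speeds M.Vc_mem_speeds M.Vc_pos.le
  have hpos := cs_pos hw M.Vc_mem_speeds
  obtain ⟨r, hr, hrq⟩ := intermediate_value_Icc' hle
    ((M.curveFlux_continuousOn w).mono fun x hx => hpos.trans_le hx.1)
    (show q ∈ Icc (M.curveFlux w (M.cs w 0).1) (M.curveFlux w (M.cs w M.Vc).1) from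
      ⟨by rw [← Q_cs hw M.zero_mem_speeds, Q_cs_zero]; exact h0,
        by rw [← Q_cs hw M.Vc_mem_speeds]; exact hq⟩)
  have hr0 : 0 < r := hpos.trans_le hr.1
  have h1 := (M.p_le_p hpos hr0).2 hr.1
  have h2 := (M.p_le_p hr0 (cs_pos hw M.zero_mem_speeds)).2 hr.2
  rw [p_cs hw M.Vc_mem_speeds] at h1
  rw [p_cs hw M.zero_mem_speeds] at h2
  refine ⟨w - M.p r, ⟨by linarith, by linarith⟩, ?_⟩
  rw [Q, cs, sub_sub_cancel, M.pInv_p hr0]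
  exact hrq

end cs

section Ωc

variable {u : State}

theorem Ωc_pos (hu : u ∈ M.Ωc) : 0 < u.1 := M.Rf1_pos.trans_le hu.1.1

theorem Ωc_speed (hu : u ∈ M.Ωc) : u.2 ∈ M.speeds := hu.2.1

theorem Ωc_W (hu : u ∈ M.Ωc) : M.W u = u.2 + M.p u.1 := if_neg (not_lt.2 hu.1.1)

theorem Ωc_marker (hu : u ∈ M.Ωc) : M.W u ∈ M.markers := by
  rw [Ωc_W hu, add_comm]; exact hu.2.2

theorem cs_W (hu : u ∈ M.Ωc) : M.cs (M.W u) u.2 = u := by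
  rw [Ωc_W hu, cs, add_sub_cancel_left, M.pInv_p (Ωc_pos hu)]

theorem Ωc_eq_of (hu : u ∈ M.Ωc) {u' : State} (hu' : u' ∈ M.Ωc) (h : M.W u = M.W u')
    (h' : u.2 = u'.2) :
    u = u' := by
  rw [← cs_W hu, ← cs_W hu', h, h']

theorem Ωc_eq_of_Q (hu : u ∈ M.Ωc) {u' : State} (hu' : u' ∈ M.Ωc) (h : M.W u = M.W u')
    (h' : Q u = Q u') :
    u = u' := by
  refine Ωc_eq_of hu hu' h (Q_cs_inj (Ωc_marker hu) (Ωc_speed hu) (Ωc_speed hu') ?_)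
  rw [cs_W hu, h, cs_W hu', h']

end Ωc

theorem Q_le_Q_uc {u : State} (hu : u ∈ M.Ωc) : Q u ≤ Q (M.uc (M.W u)) := by
  conv_lhs => rw [← cs_W hu]
  exact (Q_cs_le (Ωc_marker hu) (Ωc_speed hu) M.Vc_mem_speeds).2 hu.2.1.2

section Ωf

theorem mem_Ωf_iff {u : State} : u ∈ M.Ωf ↔ u.1 ∈ Icc 0 M.Rf2 ∧ u.2 = M.V u.1 := by
  refine ⟨fun h => ⟨h.1, h.2.2⟩, fun h => ⟨h.1, ?_, h.2⟩⟩
  rw [h.2]; exact ⟨M.Vmin_le_V h.1, M.V_le_Vmax h.1⟩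

theorem free_mem {r : ℝ} (hr : r ∈ Icc 0 M.Rf2) : ((r, M.V r) : State) ∈ M.Ωf :=
  mem_Ωf_iff.2 ⟨hr, rfl⟩

variable {u u' : State}

theorem Q_free (hu : u ∈ M.Ωf) : Q u = u.1 * M.V u.1 := by rw [Q, (mem_Ωf_iff.1 hu).2]

theorem free_eq_of_fst (hu : u ∈ M.Ωf) (hu' : u' ∈ M.Ωf) (h : u.1 = u'.1) : u = u' := by
  refine Prod.ext h ?_
  rw [(mem_Ωf_iff.1 hu).2, (mem_Ωf_iff.1 hu').2, h]

theorem Q_free_lt (hu : u ∈ M.Ωf) (hu' : u' ∈ M.Ωf) : Q u < Q u' ↔ u.1 < u'.1 := by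
  rw [Q_free hu, Q_free hu']
  exact M.freeFlux_strictMonoOn.lt_iff_lt hu.1 hu'.1

theorem Q_free_le (hu : u ∈ M.Ωf) (hu' : u' ∈ M.Ωf) : Q u ≤ Q u' ↔ u.1 ≤ u'.1 := by
  rw [← not_lt, ← not_lt, Q_free_lt hu' hu]

theorem free_eq_of_Q (hu : u ∈ M.Ωf) (hu' : u' ∈ M.Ωf) (h : Q u = Q u') : u = u' :=
  free_eq_of_fst hu hu' (le_antisymm ((Q_free_le hu hu').1 h.le) ((Q_free_le hu' hu).1 h.ge))

theorem exists_free_Q_eq {q : ℝ} (h0 : 0 ≤ q) (hq : q ≤ M.Q0) : ∃ u ∈ M.Ωf, Q u = q := by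
  obtain ⟨r, hr, h⟩ := intermediate_value_Icc (f := fun r => r * M.V r) M.Rf2_pos.le
    (fun _ h => (M.freeFlux_hasDerivWithinAt h).continuousWithinAt)
    ⟨by simpa using h0, hq.trans M.Q0_lt.le⟩
  exact ⟨(r, M.V r), free_mem hr, h⟩

theorem free_speed_pos (hu : u ∈ M.Ωf) : 0 < u.2 := by
  rw [(mem_Ωf_iff.1 hu).2]; exact M.V_pos hu.1

theorem Vc_le_free (hu : u ∈ M.Ωf) : M.Vc ≤ u.2 := M.Vc_le.trans hu.2.1.1

theorem W_free_of_ge (hu : u ∈ M.Ωf) (h : M.Rf1 ≤ u.1) : M.W u = M.V u.1 + M.p u.1 := by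
  rw [W, if_neg (not_lt.2 h), (mem_Ωf_iff.1 hu).2]

theorem W_of_lt (h : u.1 < M.Rf1) : M.W u = M.Wc := if_pos h

theorem free_marker (hu : u ∈ M.Ωf) : M.W u ∈ M.markers := by
  rcases lt_or_ge u.1 M.Rf1 with h | h
  · rw [W_of_lt h]; exact M.Wc_mem
  · rw [W_free_of_ge hu h]; exact M.Vp_mem_markers ⟨h, hu.1.2⟩

theorem uf_mem {w : ℝ} (hw : w ∈ M.markers) : M.uf w ∈ M.Ωf :=
  free_mem (M.Icc_Rf_subset (rhof_spec hw).1)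

theorem W_uf {w : ℝ} (hw : w ∈ M.markers) : M.W (M.uf w) = w := by
  rw [W_free_of_ge (uf_mem hw) (rhof_spec hw).1.1]; exact (rhof_spec hw).2

theorem uf_W_of_ge (hu : u ∈ M.Ωf) (h : M.Rf1 ≤ u.1) : M.uf (M.W u) = u := by
  refine free_eq_of_fst (uf_mem (free_marker hu)) hu ?_
  rw [W_free_of_ge hu h]; exact M.rhof_eq ⟨h, hu.1.2⟩

/-- A free state carries at most the flow of the free state of `[Rf1, Rf2]` with the same marker;
the two differ only for densities below `Rf1`. -/
theorem Q_le_Q_uf (hu : u ∈ M.Ωf) : Q u ≤ Q (M.uf (M.W u)) := by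
  rcases lt_or_ge u.1 M.Rf1 with h | h
  · rw [Q_free_le hu (uf_mem (free_marker hu))]
    exact h.le.trans (rhof_spec (free_marker hu)).1.1
  · rw [uf_W_of_ge hu h]

/-- The congested states with the marker of a free state are at least as dense as this state. -/
theorem fst_le_cs (hu : u ∈ M.Ωf) {v : ℝ} (hv : v ∈ M.speeds) : u.1 ≤ (M.cs (M.W u) v).1 :=
  ((Q_free_le hu (uf_mem (free_marker hu))).1 (Q_le_Q_uf hu)).trans (rhof_le_cs (free_marker hu) hv)

theorem cs_eq_of_fst_eq (hu : u ∈ M.Ωf) {v : ℝ} (hv : v ∈ M.speeds)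
    (h : u.1 = (M.cs (M.W u) v).1) : M.cs (M.W u) v = u := by
  have h1 := cs_spec (free_marker hu) hv
  rw [← h] at h1
  rw [W_free_of_ge hu h1.1] at h1
  refine Prod.ext h.symm ?_
  rw [(mem_Ωf_iff.1 hu).2]
  exact (by linarith [h1.2] : v = M.V u.1)

/-- A state common to both phases is the free state with the same marker. -/
theorem uf_eq_of_mem (hu : u ∈ M.Ωf) (hu' : u ∈ M.Ωc) : M.uf (M.W u) = u :=
  uf_W_of_ge hu hu'.1.1

end Ωf

theorem Ω_marker {u : State} (hu : u ∈ M.Ω) : M.W u ∈ M.markers :=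
  hu.elim free_marker Ωc_marker

theorem Ω_bounds {u : State} (hu : u ∈ M.Ω) :
    u.1 ∈ Icc 0 M.Rmax ∧ u.2 ∈ Icc 0 M.Vmax := by
  rcases hu with hu | hu
  · exact ⟨⟨hu.1.1, hu.1.2.trans Rf2_le_Rmax⟩, (free_speed_pos hu).le, hu.2.1.2⟩
  · exact ⟨⟨(Ωc_pos hu).le, hu.1.2⟩, hu.2.1.1, hu.2.1.2.trans
      ((M.Vc_le_V M.Rf1_mem).trans (M.V_le_Vmax M.Rf1_mem))⟩

theorem Q_nonneg {u : State} (hu : u ∈ M.Ω) : 0 ≤ Q u :=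
  mul_nonneg (Ω_bounds hu).1.1 (Ω_bounds hu).2.1

end Model

/-! ### Self-similar weak solutions -/

/-- A profile `f` in `Ω`, equal to `a` near `-∞` and to `b` near `+∞`, whose self-similar extension
conserves the mass. -/
structure Profile (M : Model) (a b : State) (f : ℝ → State) : Prop where
  measurable : Measurable f
  mem : ∀ x, f x ∈ M.Ω
  left : ∃ L, ∀ x < L, f x = a
  right : ∃ L, ∀ x > L, f x = b
  mass : ConservedOn (fun x => (f x).1) (fun x => Q (f x)) univ

/-- The self-similar extension of `f` conserves the generalized momentum in every sector inside
`x / t ∈ I`, with `I ⊆ O` open, in which `f` is congested. Instead of asking that almost all slopes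
in `I` are congested, it is only required that the congested slopes are dense in `I`; this makes
the property stronger, and easier to handle. -/
def MomentumOn (M : Model) (f : ℝ → State) (O : Set ℝ) : Prop :=
  ∀ I : Set ℝ, IsOpen I → I ⊆ O → I ⊆ closure {x | f x ∈ M.Ωc \ M.Ωf} →
    ConservedOn (fun x => (f x).1 * M.W (f x)) (fun x => Q (f x) * M.W (f x)) I

theorem measurable_W (M : Model) : Measurable M.W := by
  have hp : Continuous fun r : ℝ => M.p (max r M.Rf1) :=
    M.p_continuousOn.comp_continuous (by fun_prop)
      fun r => M.Rf1_pos.trans_le (le_max_right _ _)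
  have e : M.W = fun u : State => if u.1 < M.Rf1 then M.Wc else u.2 + M.p (max u.1 M.Rf1) := by
    funext u
    unfold Model.W
    split_ifs with h
    · rfl
    · rw [max_eq_left (not_lt.1 h)]
  rw [e]
  exact Measurable.ite (measurableSet_lt measurable_fst measurable_const) measurable_const
    (measurable_snd.add (hp.measurable.comp measurable_fst))

theorem measurable_Q : Measurable Q := measurable_fst.mul measurable_snd

namespace MomentumOn

variable {M : Model} {f f' : ℝ → State} {O O' : Set ℝ}

theorem union (h : MomentumOn M f O) (h' : MomentumOn M f O') (hO : IsOpen O) (hO' : IsOpen O') :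
    MomentumOn M f (O ∪ O') := by
  intro I hI hsubO hIc
  refine ((h (I ∩ O) (hI.inter hO) inter_subset_right (inter_subset_left.trans hIc)).union
    (h' (I ∩ O') (hI.inter hO') inter_subset_right (inter_subset_left.trans hIc))).mono ?_
  rw [← inter_union_distrib_left]
  exact subset_inter Subset.rfl hsubO

theorem congr (h : MomentumOn M f O) (hO : IsOpen O) (hf : ∀ x ∈ O, f' x = f x) :
    MomentumOn M f' O := by
  intro I hI hsubO hIc
  have key : ∀ x ∈ I, f' =ᶠ[𝓝 x] f := fun x hx => by
    filter_upwards [hO.mem_nhds (hsubO hx)] with y hy using hf y hy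
  refine (h I hI hsubO fun x hx => ?_).congr (fun x hx => ?_) (fun x hx => ?_)
  · rw [mem_closure_iff_frequently]
    refine ((mem_closure_iff_frequently.1 (hIc hx)).and_eventually (key x hx)).mono ?_
    rintro y ⟨h1, h2⟩
    rwa [mem_ofPred_eq, ← h2]
  · filter_upwards [key x hx] with y hy; rw [hy]
  · filter_upwards [key x hx] with y hy; rw [hy]

theorem mono (h : MomentumOn M f O) (hO : O' ⊆ O) : MomentumOn M f O' :=
  fun I hI hsubO hIc => h I hI (hsubO.trans hO) hIc

/-- Where the profile is free there is nothing to conserve. -/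
theorem of_free (hf : ∀ x ∈ O, f x ∈ M.Ωf) : MomentumOn M f O := by
  intro I hI hsubO hIc
  have : I = ∅ := by
    refine eq_empty_of_forall_notMem fun x hx => ?_
    obtain ⟨y, hy, h⟩ := mem_closure_iff.1 (hIc hx) I hI hx
    exact h.2 (hf y (hsubO hy))
  rw [this]
  exact ⟨fun x hx => hx.elim, by simp⟩

/-- A slope that borders on a free zone can be added: it has no congested neighbourhood. -/
theorem of_diff_singleton {c : ℝ} {U : Set ℝ} (hU : IsOpen U) (hcU : c ∈ closure U)
    (hfree : ∀ x ∈ U, f x ∈ M.Ωf) (h : MomentumOn M f (O \ {c})) : MomentumOn M f O := by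
  intro I hI hsubO hIc
  refine h I hI (fun x hx => ⟨hsubO hx, ?_⟩) hIc
  rintro rfl
  obtain ⟨y, hyI, hyU⟩ := mem_closure_iff.1 hcU I hI hx
  obtain ⟨z, hz, h⟩ := mem_closure_iff.1 (hIc hyI) U hU hyU
  exact h.2 (hfree z hz)

theorem of_sides (c : ℝ) (h : MomentumOn M f (Iio c)) (h' : MomentumOn M f (Ioi c)) :
    MomentumOn M f {c}ᶜ := by
  refine (h.union h' isOpen_Iio isOpen_Ioi).mono fun x hx => ?_
  rcases lt_or_gt_of_ne hx with h | h
  exacts [Or.inl h, Or.inr h]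

theorem of_free_left {c : ℝ} (hfree : ∀ x < c, f x ∈ M.Ωf) (h : MomentumOn M f (Ioi c)) :
    MomentumOn M f univ := by
  refine of_diff_singleton (c := c) isOpen_Iio (by simp) hfree ?_
  rw [← compl_eq_univ_sdiff]
  exact of_sides c (of_free hfree) h

theorem of_free_right {c : ℝ} (hfree : ∀ x > c, f x ∈ M.Ωf) (h : MomentumOn M f (Iio c)) :
    MomentumOn M f univ := by
  refine of_diff_singleton (c := c) isOpen_Ioi (by simp) hfree ?_
  rw [← compl_eq_univ_sdiff]
  exact of_sides c h (of_free hfree)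

end MomentumOn

section

variable {M : Model} {a b c d ul ur : State} {f g : ℝ → State}

theorem Profile.const {u : State} (hu : u ∈ M.Ω) : Profile M u u fun _ => u :=
  ⟨measurable_const, fun _ => hu, ⟨0, fun _ _ => rfl⟩, ⟨0, fun _ _ => rfl⟩,
    ConservedOn.const _ _ _⟩

open scoped Classical in
/-- Two profiles joined at a slope `s` where the flux through rays is the same. -/
theorem Profile.ite_lt (hf : Profile M a b f) (hg : Profile M c d g) (s : ℝ)
    (h : Q (f s) - s * (f s).1 = Q (g s) - s * (g s).1) :
    Profile M a d fun x => if x < s then f x else g x := by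
  obtain ⟨L, hL⟩ := hf.left
  obtain ⟨R, hR⟩ := hg.right
  refine ⟨hf.measurable.ite measurableSet_Iio hg.measurable, fun x => ?_, ⟨min L s, fun x hx => ?_⟩,
    ⟨max R s, fun x hx => ?_⟩, ?_⟩
  · split_ifs
    exacts [hf.mem x, hg.mem x]
  · rw [lt_min_iff] at hx
    rw [if_pos hx.2, hL x hx.1]
  · rw [gt_iff_lt, max_lt_iff] at hx
    rw [if_neg hx.2.not_gt, hR x hx.1]
  · have := ConservedOn.ite_lt s hf.mass hg.mass h
    convert this using 2 <;> split_ifs <;> rfl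

theorem norm_le_of_mem {u : State} (hu : u ∈ M.Ω) : ‖u‖ ≤ M.Rmax + M.Vmax := by
  obtain ⟨h1, h2⟩ := Model.Ω_bounds hu
  have h3 : 0 ≤ M.Rmax := h1.1.trans h1.2
  have h4 : 0 ≤ M.Vmax := h2.1.trans h2.2
  refine (norm_prod_le_iff).2 ⟨?_, ?_⟩ <;> rw [Real.norm_eq_abs, abs_of_nonneg]
  exacts [by linarith [h1.2], h1.1, by linarith [h2.2], h2.1]

/-- The profile takes its values at infinity outside a sector whose sections shrink to `0`. -/
theorem Profile.initial (hf : Profile M ul ur f) (K : ℝ) : Tendsto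
    (fun t : ℝ => ∫⁻ x in Icc (-K) K, ‖selfSimilar f t x - (if x < 0 then ul else ur)‖ₑ)
    (𝓝[>] 0) (𝓝 0) := by
  obtain ⟨L, hL⟩ := hf.left
  obtain ⟨R, hR⟩ := hf.right
  have hul : ul ∈ M.Ω := by rw [← hL (L - 1) (by linarith)]; exact hf.mem _
  have hur : ur ∈ M.Ω := by rw [← hR (R + 1) (by linarith)]; exact hf.mem _
  set N : ℝ := max |L| |R|
  have hN : 0 ≤ N := (abs_nonneg L).trans (le_max_left _ _)
  set C : ℝ := 2 * (M.Rmax + M.Vmax)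
  have hlim : Tendsto (fun t : ℝ => ENNReal.ofReal C * ENNReal.ofReal (t * N - -(t * N)))
      (𝓝[>] 0) (𝓝 0) := by
    have h1 : Tendsto (fun t : ℝ => C * (t * N - -(t * N))) (𝓝[>] 0) (𝓝 0) := by
      have : Continuous fun t : ℝ => C * (t * N - -(t * N)) := by fun_prop
      simpa using (this.tendsto 0).mono_left nhdsWithin_le_nhds
    have h2 := ENNReal.tendsto_ofReal h1
    rw [ENNReal.ofReal_zero] at h2
    have hC : 0 ≤ C := by
      have := (norm_nonneg ul).trans (norm_le_of_mem hul)
      simp only [C]; linarith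
    simpa only [ENNReal.ofReal_mul hC] using h2
  refine tendsto_of_tendsto_of_tendsto_of_le_of_le' tendsto_const_nhds hlim
    (Eventually.of_forall fun _ => zero_le) ?_
  filter_upwards [self_mem_nhdsWithin] with t ht
  have ht : 0 < t := ht
  calc ∫⁻ x in Icc (-K) K, ‖selfSimilar f t x - (if x < 0 then ul else ur)‖ₑ
      ≤ ∫⁻ x, ‖selfSimilar f t x - (if x < 0 then ul else ur)‖ₑ := setLIntegral_le_lintegral _ _
    _ ≤ ∫⁻ x, (Icc (-(t * N)) (t * N)).indicator (fun _ => ENNReal.ofReal C) x := by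
      refine lintegral_mono fun x => ?_
      by_cases hx : x ∈ Icc (-(t * N)) (t * N)
      · rw [indicator_of_mem hx, ← ofReal_norm]
        refine ENNReal.ofReal_le_ofReal ((norm_sub_le _ _).trans ?_)
        have h1 := norm_le_of_mem (hf.mem (x / t))
        have h2 : ‖if x < 0 then ul else ur‖ ≤ M.Rmax + M.Vmax := by
          split_ifs
          exacts [norm_le_of_mem hul, norm_le_of_mem hur]
        simp only [selfSimilar, C]; linarith
      · rw [indicator_of_notMem hx]
        rw [mem_Icc, not_and_or, not_le, not_le] at hx
        rcases hx with hx | hx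
        · have h1 : x < 0 := by nlinarith [mul_nonneg ht.le hN]
          have h2 : x / t < L := by
            rw [div_lt_iff₀ ht]
            nlinarith [neg_abs_le L, le_max_left |L| |R|]
          simp [selfSimilar, h1, hL _ h2]
        · have h1 : 0 < x := by nlinarith [mul_nonneg ht.le hN]
          have h2 : R < x / t := by
            rw [lt_div_iff₀ ht]
            nlinarith [le_abs_self R, le_max_right |L| |R|]
          simp [selfSimilar, h1.not_gt, hR _ h2]
    _ = ENNReal.ofReal C * ENNReal.ofReal (t * N - -(t * N)) := by
      rw [lintegral_indicator_const measurableSet_Icc, Real.volume_Icc]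

theorem setIntegral_eq_of_tsupport_subset {φ : ℝ × ℝ → ℝ} {G : Set (ℝ × ℝ)}
    (h : tsupport φ ⊆ G) (α β : ℝ × ℝ → ℝ) :
    ∫ z in G, (α z * fderiv ℝ φ z (1, 0) + β z * fderiv ℝ φ z (0, 1))
      = ∫ z, (α z * fderiv ℝ φ z (1, 0) + β z * fderiv ℝ φ z (0, 1)) := by
  refine setIntegral_eq_integral_of_forall_compl_eq_zero fun z hz => ?_
  have : fderiv ℝ φ z = 0 := Function.notMem_support.1
    fun hz' => hz (h (support_fderiv_subset ℝ hz'))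
  simp [this]

/-- A set `G` of positive times on which the self-similar extension of `f` is congested almost
everywhere is contained in an open sector in which the congested slopes are dense. -/
theorem congested_sector {G : Set (ℝ × ℝ)} (hG : IsOpen G) (hpos : G ⊆ halfPlane)
    (hc : ∀ᵐ z ∂(volume.restrict G), selfSimilar f z.1 z.2 ∈ M.Ωc \ M.Ωf) :
    IsOpen ((fun z : ℝ × ℝ => z.2 / z.1) '' G) ∧
      (fun z : ℝ × ℝ => z.2 / z.1) '' G ⊆ closure {x | f x ∈ M.Ωc \ M.Ωf} := by
  have hcont : ContinuousOn (fun z : ℝ × ℝ => z.2 / z.1) G :=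
    continuousOn_snd.div continuousOn_fst fun z hz => (hpos hz).ne'
  constructor
  · rw [isOpen_iff_mem_nhds]
    rintro _ ⟨⟨t, x⟩, hz, rfl⟩
    have ht : 0 < t := hpos hz
    have h1 : {η : ℝ | (t, t * η) ∈ G} ∈ 𝓝 (x / t) := by
      refine (hG.preimage (by fun_prop : Continuous fun η : ℝ => (t, t * η))).mem_nhds ?_
      rwa [mem_preimage, mul_div_cancel₀ _ ht.ne']
    filter_upwards [h1] with η hη
    exact ⟨_, hη, by simp [ht.ne']⟩
  · rintro _ ⟨z, hz, rfl⟩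
    rw [mem_closure_iff]
    intro o ho hzo
    have hU := hcont.isOpen_inter_preimage hG ho
    have hd := Measure.dense_of_ae ((ae_restrict_iff' hG.measurableSet).1 hc)
    obtain ⟨y, hy, hy'⟩ := hd.inter_open_nonempty _ hU ⟨z, hz, hzo⟩
    exact ⟨_, hy.2, hy' hy.1⟩

theorem Profile.isWeakSolution (hf : Profile M ul ur f) {J O : Set ℝ}
    (hJ : ∀ t > 0, ∀ x, t * x ∉ J → x ∈ O) (hm : MomentumOn M f O) :
    IsWeakSolution M J ul ur (selfSimilar f) := by
  set C : ℝ := M.Rmax + M.Vmax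
  obtain ⟨B, hB⟩ : ∃ B, ∀ w ∈ M.markers, |w| ≤ B :=
    ⟨_, fun w hw => abs_le_max_abs_abs hw.1 hw.2⟩
  have h1 : ∀ x, |(f x).1| ≤ C := fun x => (norm_fst_le _).trans (norm_le_of_mem (hf.mem x))
  have h2 : ∀ x, |(f x).2| ≤ C := fun x => (norm_snd_le _).trans (norm_le_of_mem (hf.mem x))
  have h3 : ∀ x, |Q (f x)| ≤ C * C := fun x => by
    rw [Q, abs_mul]
    exact mul_le_mul (h1 x) (h2 x) (abs_nonneg _) ((abs_nonneg _).trans (h1 x))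
  have h4 : ∀ x, |M.W (f x)| ≤ B := fun x => hB _ (Model.Ω_marker (hf.mem x))
  have m1 : Measurable fun x => (f x).1 := measurable_fst.comp hf.measurable
  have m2 : Measurable fun x => Q (f x) := measurable_Q.comp hf.measurable
  have m3 : Measurable fun x => M.W (f x) := (measurable_W M).comp hf.measurable
  refine ⟨(hf.measurable.comp (measurable_snd.div measurable_fst)).aemeasurable,
    Eventually.of_forall fun z => hf.mem _, hf.initial, ?_, ?_⟩
  · intro φ hφ hφc hφs
    rw [setIntegral_eq_of_tsupport_subset hφs]
    exact hf.mass.integral_eq_zero m1 m2 (C := max C (C * C))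
      (fun x => (h1 x).trans (le_max_left _ _)) (fun x => (h3 x).trans (le_max_right _ _))
      hφ hφc fun z hz => ⟨hφs hz, trivial⟩
  · intro G hG hGpos hGJ hGc φ hφ hφc hφs
    obtain ⟨hI, hIc⟩ := congested_sector hG hGpos hGc
    have hsubO : (fun z : ℝ × ℝ => z.2 / z.1) '' G ⊆ O := by
      rintro _ ⟨z, hz, rfl⟩
      have ht : 0 < z.1 := hGpos hz
      refine hJ z.1 ht _ ?_
      rw [mul_div_cancel₀ _ ht.ne']
      exact hGJ z hz
    rw [setIntegral_eq_of_tsupport_subset hφs]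
    have hb : ∀ k : ℝ → ℝ, ∀ D, (∀ x, |k x| ≤ D) → ∀ x, |k x * M.W (f x)| ≤ D * B := by
      intro k D hk x
      rw [abs_mul]
      exact mul_le_mul (hk x) (h4 x) (abs_nonneg _) ((abs_nonneg _).trans (hk x))
    exact (hm _ hI hsubO hIc).integral_eq_zero (m1.mul m3) (m2.mul m3)
      (C := max (C * B) (C * C * B))
      (fun x => (hb _ _ h1 x).trans (le_max_left _ _))
      (fun x => (hb _ _ h3 x).trans (le_max_right _ _))
      hφ hφc fun z hz => ⟨hGpos (hφs hz), mem_image_of_mem _ (hφs hz)⟩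

end

/-! ### Shocks, rarefactions and 1-waves -/

/-- The Rankine-Hugoniot condition. -/
theorem rankineHugoniot {ul ur : State} (h : ul.1 = ur.1 → ul = ur) :
    Q ul - σ ul ur * ul.1 = Q ur - σ ul ur * ur.1 := by
  by_cases hne : ul.1 = ur.1
  · rw [h hne]
  · have h1 : ur.1 - ul.1 ≠ 0 := sub_ne_zero.2 (Ne.symm hne)
    have : σ ul ur * (ur.1 - ul.1) = Q ur - Q ul := div_mul_cancel₀ _ h1
    linarith

theorem σ_self (u : State) : σ u u = 0 := by simp [σ]

theorem σ_comm (ul ur : State) : σ ul ur = σ ur ul := by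
  rw [σ, σ, ← neg_sub (Q ul), ← neg_sub ul.1, neg_div_neg_eq]

theorem σ_neg {ul ur : State} (h : ul.1 < ur.1) (hQ : Q ur < Q ul) : σ ul ur < 0 :=
  div_neg_of_neg_of_pos (by linarith) (by linarith)

theorem σ_pos {ul ur : State} (h : ul.1 < ur.1) (hQ : Q ul < Q ur) : 0 < σ ul ur :=
  div_pos (by linarith) (by linarith)

section fan

variable {lam F : ℝ → ℝ} {c d : ℝ}

theorem fan_of_lt {x : ℝ} (hx : x < lam d) : fan lam c d x = d := if_pos hx

theorem fan_of_ge (hcd : c ≤ d) (hlam : ContinuousOn lam (Icc c d))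
    (hinj : StrictAntiOn lam (Icc c d)) {x : ℝ} (hx : lam c ≤ x) : fan lam c d x = c := by
  have hdc : lam d ≤ lam c :=
    hinj.antitoneOn (left_mem_Icc.2 hcd) (right_mem_Icc.2 hcd) hcd
  unfold fan
  rw [if_neg (not_lt.2 (hdc.trans hx))]
  split_ifs with h
  · obtain ⟨h1, h2⟩ := fan_mid hcd hlam (hdc.trans hx) h
    exact hinj.injOn h1 (left_mem_Icc.2 hcd) (h2.trans (le_antisymm h hx))
  · rfl

theorem Profile.fan {M : Model} {v : ℝ → ℝ} (hcd : c ≤ d) (hlam : ContinuousOn lam (Icc c d))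
    (hanti : AntitoneOn lam (Icc c d))
    (hF : ∀ r ∈ Icc c d, ∀ s ∈ Icc c d, s * v s ≤ r * v r + lam r * (s - r))
    (hv : AntitoneOn v (Icc c d)) (hmem : ∀ r ∈ Icc c d, ((r, v r) : State) ∈ M.Ω) :
    Profile M (d, v d) (c, v c) fun x => (fan lam c d x, v (fan lam c d x)) := by
  have ha : Antitone (TwoPhase.fan lam c d) :=
    fan_antitone (F := fun r => r * v r) hcd hlam hF
  have hv' : Monotone fun x => v (TwoPhase.fan lam c d x) := fun x y hxy =>
    hv (fan_mem hcd hlam y) (fan_mem hcd hlam x) (ha hxy)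
  refine ⟨ha.measurable.prodMk hv'.measurable, fun x => hmem _ (fan_mem hcd hlam x),
    ⟨lam d, fun x hx => by rw [fan_of_lt hx]⟩, ⟨lam c, fun x hx => ?_⟩,
    fan_conservedOn (F := fun r => r * v r) hcd hlam hF⟩
  have hx' : lam c < x := hx
  have : TwoPhase.fan lam c d x = c := by
    unfold TwoPhase.fan
    rw [if_neg (not_lt.2 ((hanti (left_mem_Icc.2 hcd) (right_mem_Icc.2 hcd) hcd).trans hx'.le)),
      if_neg (not_le.2 hx')]
  rw [this]

end fan

theorem Profile.jump {M : Model} {ul ur : State} (hl : ul ∈ M.Ω) (hr : ur ∈ M.Ω)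
    (h : ul.1 = ur.1 → ul = ur) : Profile M ul ur fun x => if x < σ ul ur then ul else ur :=
  (Profile.const hl).ite_lt (Profile.const hr) _ (rankineHugoniot h)

namespace Model

variable {M : Model} {ul ur : State}

theorem RLWR_eq_fan (hl : ul ∈ M.Ωf) (hr : ur ∈ M.Ωf) (h : ur.1 < ul.1) (x : ℝ) :
    M.RLWR ul ur x = (fan M.lamf ur.1 ul.1 x, M.V (fan M.lamf ur.1 ul.1 x)) := by
  unfold RLWR fan
  rw [if_neg (not_le.2 h)]
  split_ifs
  · exact Prod.ext rfl (mem_Ωf_iff.1 hl).2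
  · rfl
  · exact Prod.ext rfl (mem_Ωf_iff.1 hr).2

theorem RLWR_profile (hl : ul ∈ M.Ωf) (hr : ur ∈ M.Ωf) : Profile M ul ur (M.RLWR ul ur) := by
  rcases le_or_gt ul.1 ur.1 with h | h
  · have e : M.RLWR ul ur = fun x => if x < σ ul ur then ul else ur := by
      funext x; rw [RLWR, if_pos h]
    rw [e]
    exact Profile.jump (Or.inl hl) (Or.inl hr) (free_eq_of_fst hl hr)
  · have hsub : Icc ur.1 ul.1 ⊆ Icc 0 M.Rf2 := Icc_subset_Icc hr.1.1 hl.1.2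
    have := Profile.fan (M := M) h.le (M.lamf_continuousOn.mono hsub)
      (M.lamf_antitoneOn.mono hsub)
      (fun r hr s hs => M.freeFlux_le_tangent (hsub hr) (hsub hs)) (M.V_antitoneOn.mono hsub)
      (fun r hr => Or.inl (free_mem (hsub hr)))
    rw [← (mem_Ωf_iff.1 hl).2, ← (mem_Ωf_iff.1 hr).2] at this
    rwa [show M.RLWR ul ur = _ from funext (RLWR_eq_fan hl hr h)]

theorem RLWR_mem (hl : ul ∈ M.Ωf) (hr : ur ∈ M.Ωf) (x : ℝ) : M.RLWR ul ur x ∈ M.Ωf := by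
  rcases le_or_gt ul.1 ur.1 with h | h
  · rw [RLWR, if_pos h]; split_ifs <;> assumption
  · have hsub : Icc ur.1 ul.1 ⊆ Icc 0 M.Rf2 := Icc_subset_Icc hr.1.1 hl.1.2
    rw [RLWR_eq_fan hl hr h]
    exact free_mem (hsub (fan_mem h.le (M.lamf_continuousOn.mono hsub) x))

/-- Waves in the free phase have positive speed. -/
theorem RLWR_near_zero (hl : ul ∈ M.Ωf) (hr : ur ∈ M.Ωf) :
    ∃ s > 0, ∀ x < s, M.RLWR ul ur x = ul := by
  rcases lt_trichotomy ul.1 ur.1 with h | h | h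
  · exact ⟨σ ul ur, σ_pos h ((Q_free_lt hl hr).2 h), fun x hx => by
      rw [RLWR, if_pos h.le, if_pos hx]⟩
  · have := free_eq_of_fst hl hr h
    subst this
    exact ⟨1, one_pos, fun x _ => by simp [RLWR]⟩
  · exact ⟨M.lamf ul.1, M.lamf_pos hl.1, fun x hx => by
      rw [RLWR, if_neg (not_le.2 h), if_pos hx]⟩

variable (M) in
open scoped Classical in
/-- The 1-wave of the congested phase from `ul` to a state `um` on the same Lax curve. -/
noncomputable def wave1 (ul um : State) (x : ℝ) : State :=
  if um.2 ≤ ul.2 then if x < σ ul um then ul else um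
  else (fan (M.lam1 (M.W ul)) um.1 ul.1 x, M.W ul - M.p (fan (M.lam1 (M.W ul)) um.1 ul.1 x))

theorem RARZ_eq (hl : ul ∈ M.Ωc) (hr : ur.2 ∈ M.speeds) (x : ℝ) :
    M.RARZ ul ur x = if x < ur.2 then M.wave1 ul (M.um ul ur) x else ur := by
  have h2 : (M.um ul ur).2 = ur.2 := rfl
  have h3 : M.W ul - M.p (M.um ul ur).1 = ur.2 := by
    rw [um_eq, p_cs (Ωc_marker hl) hr, sub_sub_cancel]
  unfold RARZ wave1 fan
  rw [h2]
  split_ifs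
  · rfl
  · rfl
  · exact Prod.ext rfl (by rw [Ωc_W hl]; simp)
  · rfl
  · exact Prod.ext rfl h3.symm
  · rfl

section wave1

variable {w v : ℝ}

theorem wave1_eq_of_le (h : v ≤ ul.2) (x : ℝ) :
    M.wave1 ul (M.cs w v) x = if x < σ ul (M.cs w v) then ul else M.cs w v :=
  if_pos h

theorem wave1_eq_of_gt (h : ul.2 < v) (x : ℝ) :
    M.wave1 ul (M.cs w v) x = (fan (M.lam1 (M.W ul)) (M.cs w v).1 ul.1 x,
      M.W ul - M.p (fan (M.lam1 (M.W ul)) (M.cs w v).1 ul.1 x)) :=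
  if_neg (not_le.2 h)

theorem cs_fst_le_of_le (hl : ul ∈ M.Ωc) (hv : v ∈ M.speeds) (h : ul.2 ≤ v) :
    (M.cs (M.W ul) v).1 ≤ ul.1 := by
  conv_rhs => rw [← cs_W hl]
  exact cs_fst_le (Ωc_marker hl) (Ωc_speed hl) hv h

theorem fan_domain (hl : ul ∈ M.Ωc) (hv : v ∈ M.speeds) :
    Icc (M.cs (M.W ul) v).1 ul.1 ⊆ Ioi 0 := fun _ hx =>
  (cs_pos (Ωc_marker hl) hv).trans_le hx.1

theorem curve_mem (hl : ul ∈ M.Ωc) (hv : v ∈ M.speeds) {r : ℝ}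
    (hr : r ∈ Icc (M.cs (M.W ul) v).1 ul.1) :
    ((r, M.W ul - M.p r) : State) ∈ M.Ωc ∧ M.W (r, M.W ul - M.p r) = M.W ul := by
  have hw := Ωc_marker hl
  have h0 : 0 < r := fan_domain hl hv hr
  have h1 := (M.p_le_p (cs_pos hw hv) h0).2 hr.1
  have h2 := (M.p_le_p h0 (Ωc_pos hl)).2 hr.2
  rw [p_cs hw hv] at h1
  have h3 := Ωc_W hl
  have hv' : M.W ul - M.p r ∈ M.speeds :=
    ⟨by linarith [hl.2.1.1], by linarith [hv.2]⟩
  have e : ((r, M.W ul - M.p r) : State) = M.cs (M.W ul) (M.W ul - M.p r) := by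
    rw [cs, sub_sub_cancel, M.pInv_p h0]
  rw [e]
  exact ⟨cs_mem hw hv', W_cs hw hv'⟩

theorem eq_cs_of_fst_eq (hl : ul ∈ M.Ωc) (hv : v ∈ M.speeds) (h : ul.1 = (M.cs (M.W ul) v).1) :
    ul = M.cs (M.W ul) v := by
  refine Prod.ext h ?_
  have h1 := p_cs (Ωc_marker hl) hv
  rw [← h] at h1
  have h2 := Ωc_W hl
  exact (by linarith : ul.2 = v)

theorem wave1_profile (hl : ul ∈ M.Ωc) (hv : v ∈ M.speeds) :
    Profile M ul (M.cs (M.W ul) v) (M.wave1 ul (M.cs (M.W ul) v)) := by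
  have hw := Ωc_marker hl
  rcases le_or_gt v ul.2 with h | h
  · rw [show M.wave1 ul (M.cs (M.W ul) v) = _ from funext (wave1_eq_of_le h)]
    exact Profile.jump (Or.inr hl) (Or.inr (cs_mem hw hv)) (eq_cs_of_fst_eq hl hv)
  · have hsub := fan_domain hl hv
    have := Profile.fan (M := M) (v := fun r => M.W ul - M.p r) (cs_fst_le_of_le hl hv h.le)
      ((M.lam1_continuousOn (M.W ul)).mono hsub)
      ((M.lam1_strictAntiOn (M.W ul)).antitoneOn.mono hsub)
      (fun r hr s hs => M.curveFlux_le_tangent (M.W ul) (hsub hr) (hsub hs))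
      (fun r hr s hs hrs => sub_le_sub_left ((M.p_le_p (hsub hr) (hsub hs)).2 hrs) _)
      (fun r hr => Or.inr (curve_mem hl hv hr).1)
    rw [show M.wave1 ul (M.cs (M.W ul) v) = _ from funext (wave1_eq_of_gt h)]
    convert this using 1
    · exact Prod.ext rfl (by rw [Ωc_W hl]; simp)
    · exact Prod.ext rfl (by rw [p_cs hw hv, sub_sub_cancel]; rfl)

theorem wave1_mem (hl : ul ∈ M.Ωc) (hv : v ∈ M.speeds) (x : ℝ) :
    M.wave1 ul (M.cs (M.W ul) v) x ∈ M.Ωc ∧ M.W (M.wave1 ul (M.cs (M.W ul) v) x) = M.W ul := by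
  have hw := Ωc_marker hl
  rcases le_or_gt v ul.2 with h | h
  · rw [wave1_eq_of_le h]
    split_ifs
    exacts [⟨hl, rfl⟩, ⟨cs_mem hw hv, W_cs hw hv⟩]
  · rw [wave1_eq_of_gt h]
    exact curve_mem hl hv (fan_mem (cs_fst_le_of_le hl hv h.le)
      ((M.lam1_continuousOn (M.W ul)).mono (fan_domain hl hv)) x)

theorem wave1_self (hl : ul ∈ M.Ωc) (x : ℝ) : M.wave1 ul (M.cs (M.W ul) ul.2) x = ul := by
  rw [wave1_eq_of_le le_rfl, cs_W hl, ite_self]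

theorem wave1_of_lam1_le (hl : ul ∈ M.Ωc) (hv : v ∈ M.speeds) (h : ul.2 ≤ v) {x : ℝ}
    (hx : M.lam1 (M.W ul) (M.cs (M.W ul) v).1 ≤ x) :
    M.wave1 ul (M.cs (M.W ul) v) x = M.cs (M.W ul) v := by
  rcases h.eq_or_lt with h | h
  · subst h; rw [wave1_self hl, cs_W hl]
  · have hsub := fan_domain hl hv
    rw [wave1_eq_of_gt h, fan_of_ge (cs_fst_le_of_le hl hv h.le)
      ((M.lam1_continuousOn (M.W ul)).mono hsub) ((M.lam1_strictAntiOn (M.W ul)).mono hsub) hx]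
    exact Prod.ext rfl (by rw [p_cs (Ωc_marker hl) hv, sub_sub_cancel]; rfl)

/-- The 1-waves of the congested phase have negative speed. -/
theorem wave1_near_zero (hl : ul ∈ M.Ωc) (hv : v ∈ M.speeds) :
    ∃ s < 0, ∀ x > s, M.wave1 ul (M.cs (M.W ul) v) x = M.cs (M.W ul) v := by
  have hw := Ωc_marker hl
  rcases lt_trichotomy v ul.2 with h | h | h
  · refine ⟨σ ul (M.cs (M.W ul) v), σ_neg ?_ ?_, fun x hx => ?_⟩
    · conv_lhs => rw [← cs_W hl]
      exact cs_fst_lt hw hv (Ωc_speed hl) h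
    · conv_rhs => rw [← cs_W hl]
      exact (Q_cs_lt hw hv (Ωc_speed hl)).2 h
    · rw [wave1_eq_of_le h.le, if_neg (not_lt.2 (le_of_lt hx))]
  · subst h
    exact ⟨-1, by norm_num, fun x _ => by rw [wave1_self hl, cs_W hl]⟩
  · exact ⟨_, lam1_neg hw (rhof_le_cs hw hv), fun x hx => wave1_of_lam1_le hl hv h.le (le_of_lt hx)⟩

end wave1

/-- The 1-wave is over at the slope `v_r` of the contact discontinuity. -/
theorem wave1_contact (hl : ul ∈ M.Ωc) (hr : ur.2 ∈ M.speeds) :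
    M.wave1 ul (M.um ul ur) ur.2 = M.um ul ur := by
  obtain ⟨s, hs, h⟩ := wave1_near_zero hl hr
  exact h _ (hs.trans_le hr.1)

/-- No flux passes through the ray whose slope is the speed of the state. -/
theorem Q_sub_speed (u : State) : Q u - u.2 * u.1 = 0 := by rw [Q]; ring

theorem RARZ_profile (hl : ul ∈ M.Ωc) (hr : ur ∈ M.Ωc) : Profile M ul ur (M.RARZ ul ur) := by
  have hv := Ωc_speed hr
  rw [show M.RARZ ul ur = _ from funext (RARZ_eq hl hv)]
  refine (wave1_profile hl hv).ite_lt (Profile.const (Or.inr hr)) ur.2 ?_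
  have := wave1_contact hl hv
  rw [um_eq] at this
  rw [this, Q_sub_speed ur]
  exact Q_sub_speed (M.cs (M.W ul) ur.2)

/-- The marker is constant up to the contact discontinuity, where the flux through the ray vanishes
for both markers. -/
theorem RARZ_momentum (hl : ul ∈ M.Ωc) (hr : ur ∈ M.Ωc) : MomentumOn M (M.RARZ ul ur) univ := by
  have hv := Ωc_speed hr
  intro I _ _ _
  have h1 := (wave1_profile hl hv).mass.const_mul (M.W ul)
  have h2 : ConservedOn (fun _ => ur.1 * M.W ur) (fun _ => Q ur * M.W ur) univ :=
    ConservedOn.const _ _ _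
  have h3 := ConservedOn.ite_lt ur.2 h1 h2 ?_
  · refine ConservedOn.mono ?_ (subset_univ I)
    convert h3 using 2 with x x <;>
    · rw [RARZ_eq hl hv]
      split_ifs
      · rw [um_eq, (wave1_mem hl hv x).2, mul_comm]
      · rfl
  · have := wave1_contact hl hv
    rw [um_eq] at this
    have e1 := Q_sub_speed (M.cs (M.W ul) ur.2)
    have e2 := Q_sub_speed ur
    rw [show (M.cs (M.W ul) ur.2).2 = ur.2 from rfl] at e1
    simp only [rayFlux]
    rw [this]
    linear_combination M.W ul * e1 - M.W ur * e2

/-! ### The first solver -/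

theorem R1_of_free_free (hl : ul ∈ M.Ωf) (hr : ur ∈ M.Ωf) : M.R1 ul ur = M.RLWR ul ur := by
  funext x; rw [R1, if_pos hl, if_pos hr]

theorem R1_of_cong_cong (hl : ul ∉ M.Ωf) (hr : ur ∉ M.Ωf) : M.R1 ul ur = M.RARZ ul ur := by
  funext x; rw [R1, if_neg hl, if_neg hr]

theorem Ωc_of_notMem {u : State} (hu : u ∈ M.Ω) (h : u ∉ M.Ωf) : u ∈ M.Ωc := hu.resolve_left h

section fc

/-- After the phase transition, only the contact discontinuity is left. -/
theorem RARZ_um (hl : ul ∈ M.Ω) (hv : ur.2 ∈ M.speeds) (x : ℝ) :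
    M.RARZ (M.um ul ur) ur x = if x < ur.2 then M.um ul ur else ur := by
  have hw := Ω_marker hl
  have hm := cs_mem hw hv
  rw [← um_eq] at hm
  rw [RARZ_eq hm hv]
  have : M.um (M.um ul ur) ur = M.cs (M.W (M.um ul ur)) (M.um ul ur).2 := rfl
  rw [this, wave1_self hm]

theorem R1_of_free_cong (hl : ul ∈ M.Ωf) (hr : ur ∈ M.Ωc) (hr' : ur ∉ M.Ωf) (x : ℝ) :
    M.R1 ul ur x = if x < σ ul (M.um ul ur) then ul
      else if x < ur.2 then M.um ul ur else ur := by
  rw [R1, if_pos hl, if_neg hr', RARZ_um (Or.inl hl) (Ωc_speed hr)]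

theorem um_eq_of_fst_eq (hl : ul ∈ M.Ωf) (hv : ur.2 ∈ M.speeds) (h : ul.1 = (M.um ul ur).1) :
    ul = M.um ul ur := (cs_eq_of_fst_eq hl hv h).symm

/-- The phase transition is not faster than the contact discontinuity. -/
theorem σ_um_le (hl : ul ∈ M.Ωf) (hv : ur.2 ∈ M.speeds) : σ ul (M.um ul ur) ≤ ur.2 := by
  rcases (fst_le_cs hl hv).eq_or_lt with h | h
  · rw [← um_eq_of_fst_eq hl hv h, σ_self]
    exact hv.1
  · have h1 : 0 < (M.um ul ur).1 - ul.1 := sub_pos.2 h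
    rw [σ, div_le_iff₀ h1]
    have h2 := Q_sub_speed (M.um ul ur)
    have h3 : (M.um ul ur).2 = ur.2 := rfl
    rw [h3] at h2
    have h4 : Q ul = ul.1 * ul.2 := rfl
    have h5 : ul.1 * ur.2 ≤ ul.1 * ul.2 :=
      mul_le_mul_of_nonneg_left (hv.2.trans (Vc_le_free hl)) hl.1.1
    linarith

theorem R1_profile_fc (hl : ul ∈ M.Ωf) (hr : ur ∈ M.Ωc) (hr' : ur ∉ M.Ωf) :
    Profile M ul ur (M.R1 ul ur) := by
  have hv := Ωc_speed hr
  have hm : M.um ul ur ∈ M.Ωc := cs_mem (free_marker hl) hv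
  have e : M.R1 ul ur = fun x => if x < σ ul (M.um ul ur) then ul
      else M.RARZ (M.um ul ur) ur x := by
    funext x; rw [R1, if_pos hl, if_neg hr']
  rw [e]
  refine (Profile.const (Or.inl hl)).ite_lt (RARZ_profile hm hr) _ ?_
  rw [rankineHugoniot (um_eq_of_fst_eq hl hv), RARZ_um (Or.inl hl) hv]
  split_ifs with h
  · rfl
  · rw [le_antisymm (σ_um_le hl hv) (not_lt.1 h), Q_sub_speed ur]
    exact Q_sub_speed (M.um ul ur)

theorem R1_momentum_fc (hl : ul ∈ M.Ωf) (hr : ur ∈ M.Ωc) (hr' : ur ∉ M.Ωf) :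
    MomentumOn M (M.R1 ul ur) univ := by
  have hv := Ωc_speed hr
  have hm : M.um ul ur ∈ M.Ωc := cs_mem (free_marker hl) hv
  refine MomentumOn.of_free_left (c := σ ul (M.um ul ur)) (fun x hx => ?_)
    (((RARZ_momentum hm hr).mono (subset_univ _)).congr isOpen_Ioi fun x hx => ?_)
  · rw [R1_of_free_cong hl hr hr', if_pos hx]; exact hl
  · rw [R1, if_pos hl, if_neg hr', if_neg (not_lt.2 (le_of_lt (mem_Ioi.1 hx)))]

end fc

section cf

theorem uc_mem {w : ℝ} (hw : w ∈ M.markers) : M.uc w ∈ M.Ωc := cs_mem hw M.Vc_mem_speeds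

theorem uf_fst_le_uc {w : ℝ} (hw : w ∈ M.markers) : (M.uf w).1 ≤ (M.uc w).1 :=
  rhof_le_cs hw M.Vc_mem_speeds

theorem uc_eq_uf_of_fst_eq {w : ℝ} (hw : w ∈ M.markers) (h : (M.uc w).1 = (M.uf w).1) :
    M.uc w = M.uf w := by
  have := cs_eq_of_fst_eq (uf_mem hw) M.Vc_mem_speeds
  rw [W_uf hw] at this
  exact this h.symm

theorem σ_uc_uf_nonpos {w : ℝ} (hw : w ∈ M.markers) : σ (M.uc w) (M.uf w) ≤ 0 :=
  div_nonpos_of_nonneg_of_nonpos (sub_nonneg.2 (Q_cs_le_uf hw M.Vc_mem_speeds))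
    (sub_nonpos.2 (uf_fst_le_uc hw))

/-- The phase transition to the free phase is not slower than the preceding rarefaction. -/
theorem lam1_le_σ_uc_uf {w : ℝ} (hw : w ∈ M.markers) :
    M.lam1 w (M.uc w).1 ≤ σ (M.uc w) (M.uf w) := by
  rcases (uf_fst_le_uc hw).eq_or_lt with h | h
  · rw [← uc_eq_uf_of_fst_eq hw h.symm, σ_self]
    exact (lam1_neg hw (rhof_le_cs hw M.Vc_mem_speeds)).le
  · have h1 : (M.uf w).1 - (M.uc w).1 < 0 := sub_neg.2 h
    rw [σ, le_div_iff_of_neg h1, ← curveFlux_rhof hw, uc_eq, Q_cs hw M.Vc_mem_speeds]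
    have := M.curveFlux_le_tangent w (cs_pos hw M.Vc_mem_speeds) (rhof_pos hw)
    rw [show (M.uf w).1 = M.rhof w from rfl]
    linarith

theorem R1_of_cong_free (hl : ul ∉ M.Ωf) (hr : ur ∈ M.Ωf) (x : ℝ) :
    M.R1 ul ur x = if x < σ (M.uc (M.W ul)) (M.uf (M.W ul)) then M.RARZ ul (M.uc (M.W ul)) x
      else M.RLWR (M.uf (M.W ul)) ur x := by
  rw [R1, if_neg hl, if_pos hr]

theorem RARZ_uc_end (hl : ul ∈ M.Ωc) {x : ℝ} (hx : σ (M.uc (M.W ul)) (M.uf (M.W ul)) ≤ x)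
    (hx0 : x ≤ 0) : M.RARZ ul (M.uc (M.W ul)) x = M.uc (M.W ul) := by
  rw [RARZ_eq hl M.Vc_mem_speeds, if_pos (hx0.trans_lt (show 0 < (M.uc (M.W ul)).2 from M.Vc_pos))]
  exact wave1_of_lam1_le hl M.Vc_mem_speeds hl.2.1.2 ((lam1_le_σ_uc_uf (Ωc_marker hl)).trans hx)

theorem RLWR_of_nonpos (hl : ul ∈ M.Ωf) (hr : ur ∈ M.Ωf) {x : ℝ} (hx : x ≤ 0) :
    M.RLWR ul ur x = ul := by
  obtain ⟨s, hs, h⟩ := RLWR_near_zero hl hr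
  exact h x (hx.trans_lt hs)

theorem R1_profile_cf (hl : ul ∈ M.Ωc) (hl' : ul ∉ M.Ωf) (hr : ur ∈ M.Ωf) :
    Profile M ul ur (M.R1 ul ur) := by
  have hw := Ωc_marker hl
  rw [show M.R1 ul ur = _ from funext (R1_of_cong_free hl' hr)]
  refine (RARZ_profile hl (uc_mem hw)).ite_lt (RLWR_profile (uf_mem hw) hr) _ ?_
  rw [RARZ_uc_end hl le_rfl (σ_uc_uf_nonpos hw),
    RLWR_of_nonpos (uf_mem hw) hr (σ_uc_uf_nonpos hw)]
  exact rankineHugoniot (uc_eq_uf_of_fst_eq hw)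

theorem R1_momentum_cf (hl : ul ∈ M.Ωc) (hl' : ul ∉ M.Ωf) (hr : ur ∈ M.Ωf) :
    MomentumOn M (M.R1 ul ur) univ := by
  have hw := Ωc_marker hl
  refine MomentumOn.of_free_right (c := σ (M.uc (M.W ul)) (M.uf (M.W ul))) (fun x hx => ?_)
    (((RARZ_momentum hl (uc_mem hw)).mono (subset_univ _)).congr isOpen_Iio fun x hx => ?_)
  · rw [R1_of_cong_free hl' hr, if_neg (not_lt.2 (le_of_lt hx))]
    exact RLWR_mem (uf_mem hw) hr x
  · rw [R1_of_cong_free hl' hr, if_pos (mem_Iio.1 hx)]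

end cf

theorem R1_profile (hl : ul ∈ M.Ω) (hr : ur ∈ M.Ω) : Profile M ul ur (M.R1 ul ur) := by
  by_cases h1 : ul ∈ M.Ωf <;> by_cases h2 : ur ∈ M.Ωf
  · rw [R1_of_free_free h1 h2]; exact RLWR_profile h1 h2
  · exact R1_profile_fc h1 (Ωc_of_notMem hr h2) h2
  · exact R1_profile_cf (Ωc_of_notMem hl h1) h1 h2
  · rw [R1_of_cong_cong h1 h2]; exact RARZ_profile (Ωc_of_notMem hl h1) (Ωc_of_notMem hr h2)

theorem R1_momentum (hl : ul ∈ M.Ω) (hr : ur ∈ M.Ω) : MomentumOn M (M.R1 ul ur) univ := by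
  by_cases h1 : ul ∈ M.Ωf <;> by_cases h2 : ur ∈ M.Ωf
  · rw [R1_of_free_free h1 h2]; exact MomentumOn.of_free fun x _ => RLWR_mem h1 h2 x
  · exact R1_momentum_fc h1 (Ωc_of_notMem hr h2) h2
  · exact R1_momentum_cf (Ωc_of_notMem hl h1) h1 h2
  · rw [R1_of_cong_cong h1 h2]; exact RARZ_momentum (Ωc_of_notMem hl h1) (Ωc_of_notMem hr h2)

/-! ### The second solver -/

variable (M) in
/-- The data for which the second solver differs from the first one. -/
def IsJump (ul ur : State) : Prop :=
  ul ∈ M.Ωf ∧ ur ∉ M.Ωf ∧ ul.1 ≠ 0 ∧ M.W ul < M.W ur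

theorem R2_of_jump (h : M.IsJump ul ur) (x : ℝ) :
    M.R2 ul ur x = if x < σ ul ur then ul else ur :=
  if_pos h

theorem R2_of_not_jump (h : ¬ M.IsJump ul ur) : M.R2 ul ur = M.R1 ul ur := by
  funext x; exact if_neg h

theorem IsJump.fst_lt (h : M.IsJump ul ur) (hr : ur ∈ M.Ω) : ul.1 < ur.1 := by
  have hc := Ωc_of_notMem hr h.2.1
  have h1 := fst_le_cs h.1 (Ωc_speed hc)
  have h2 := (cs_fst_lt_marker (free_marker h.1) (Ωc_speed hc) (Ωc_marker hc)).2 h.2.2.2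
  rw [cs_W hc] at h2
  exact h1.trans_lt h2

theorem R2_profile (hl : ul ∈ M.Ω) (hr : ur ∈ M.Ω) : Profile M ul ur (M.R2 ul ur) := by
  by_cases h : M.IsJump ul ur
  · rw [show M.R2 ul ur = _ from funext (R2_of_jump h)]
    exact Profile.jump hl hr fun e => absurd e (h.fst_lt hr).ne
  · rw [R2_of_not_jump h]; exact R1_profile hl hr

theorem R2_momentum (hl : ul ∈ M.Ω) (hr : ur ∈ M.Ω) : MomentumOn M (M.R2 ul ur) univ := by
  by_cases h : M.IsJump ul ur
  · have hc : MomentumOn M (fun _ => ur) (Ioi (σ ul ur)) := fun _ _ _ _ =>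
      ConservedOn.const _ _ _
    refine MomentumOn.of_free_left (c := σ ul ur) (fun x hx => ?_)
      (hc.congr isOpen_Ioi fun x hx => ?_)
    · rw [R2_of_jump h, if_pos hx]; exact h.1
    · rw [R2_of_jump h, if_neg (not_lt.2 (le_of_lt (mem_Ioi.1 hx)))]
  · rw [R2_of_not_jump h]; exact R1_momentum hl hr

end Model

/-! ### Traces of the unconstrained solvers -/

/-- `f` is equal to `a` on a left neighbourhood of `0`. -/
def LeftAt (f : ℝ → State) (a : State) : Prop := ∀ᶠ x in 𝓝[<] (0 : ℝ), f x = a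

/-- `f` is equal to `a` on a right neighbourhood of `0`. -/
def RightAt (f : ℝ → State) (a : State) : Prop := ∀ᶠ x in 𝓝[>] (0 : ℝ), f x = a

section

variable {f : ℝ → State} {a b : State}

theorem LeftAt.tendsto (h : LeftAt f a) : Tendsto f (𝓝[<] 0) (𝓝 a) :=
  tendsto_const_nhds.congr' (h.mono fun _ hx => hx.symm)

theorem RightAt.tendsto (h : RightAt f a) : Tendsto f (𝓝[>] 0) (𝓝 a) :=
  tendsto_const_nhds.congr' (h.mono fun _ hx => hx.symm)

theorem LeftAt.eq (h : LeftAt f a) (hb : Tendsto f (𝓝[<] 0) (𝓝 b)) : b = a :=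
  tendsto_nhds_unique hb h.tendsto

theorem RightAt.eq (h : RightAt f a) (hb : Tendsto f (𝓝[>] 0) (𝓝 b)) : b = a :=
  tendsto_nhds_unique hb h.tendsto

theorem LeftAt.of_Ioo {s : ℝ} (hs : s < 0) (h : ∀ x, s < x → x < 0 → f x = a) : LeftAt f a := by
  filter_upwards [Ioo_mem_nhdsLT hs] with x hx using h x hx.1 hx.2

theorem RightAt.of_Ioo {s : ℝ} (hs : 0 < s) (h : ∀ x, 0 < x → x < s → f x = a) :
    RightAt f a := by
  filter_upwards [Ioo_mem_nhdsGT hs] with x hx using h x hx.1 hx.2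

end

namespace Model

variable {M : Model} {ul ur : State}

theorem Q_pos_of_speed_pos (hr : ur ∈ M.Ωc) (h : 0 < ur.2) : 0 < Q ur := mul_pos (Ωc_pos hr) h

theorem Q_um_of_speed_zero (h : ur.2 = 0) : Q (M.um ul ur) = 0 := by
  rw [um_eq, h, Q_cs_zero]

theorem Q_of_speed_zero {u : State} (h : u.2 = 0) : Q u = 0 := by rw [Q, h, mul_zero]

/-- In the names of the lemmas on traces, the letters `f` and `c` tell the phases, free and strictly
congested, of the left and of the right state. -/
theorem R1_left_ff (hl : ul ∈ M.Ωf) (hr : ur ∈ M.Ωf) : LeftAt (M.R1 ul ur) ul := by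
  obtain ⟨s, hs, h⟩ := RLWR_near_zero hl hr
  rw [R1_of_free_free hl hr]
  exact LeftAt.of_Ioo neg_one_lt_zero fun x _ hx => h x (hx.trans hs)

theorem R1_right_ff (hl : ul ∈ M.Ωf) (hr : ur ∈ M.Ωf) : RightAt (M.R1 ul ur) ul := by
  obtain ⟨s, hs, h⟩ := RLWR_near_zero hl hr
  rw [R1_of_free_free hl hr]
  exact RightAt.of_Ioo hs fun x _ hx => h x hx

theorem R1_left_cc (hl : ul ∈ M.Ωc) (hl' : ul ∉ M.Ωf) (hr : ur ∈ M.Ωc) (hr' : ur ∉ M.Ωf) :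
    LeftAt (M.R1 ul ur) (M.um ul ur) := by
  have hv := Ωc_speed hr
  obtain ⟨s, hs, h⟩ := wave1_near_zero hl hv
  rw [R1_of_cong_cong hl' hr']
  refine LeftAt.of_Ioo hs fun x hx hx0 => ?_
  rw [RARZ_eq hl hv, if_pos (hx0.trans_le hv.1)]
  exact h x hx

theorem R1_right_cc (hl : ul ∈ M.Ωc) (hl' : ul ∉ M.Ωf) (hr : ur ∈ M.Ωc) (hr' : ur ∉ M.Ωf)
    (h0 : 0 < ur.2) : RightAt (M.R1 ul ur) (M.um ul ur) := by
  have hv := Ωc_speed hr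
  obtain ⟨s, hs, h⟩ := wave1_near_zero hl hv
  rw [R1_of_cong_cong hl' hr']
  refine RightAt.of_Ioo h0 fun x hx hx0 => ?_
  rw [RARZ_eq hl hv, if_pos hx0]
  exact h x (hs.trans hx)

theorem R1_right_cc_zero (hl : ul ∈ M.Ωc) (hl' : ul ∉ M.Ωf) (hr : ur ∈ M.Ωc) (hr' : ur ∉ M.Ωf)
    (h0 : ur.2 = 0) : RightAt (M.R1 ul ur) ur := by
  rw [R1_of_cong_cong hl' hr']
  refine RightAt.of_Ioo one_pos fun x hx _ => ?_
  rw [RARZ_eq hl (Ωc_speed hr), if_neg (by rw [h0]; exact hx.le.not_gt)]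

theorem R1_left_fc_um (hl : ul ∈ M.Ωf) (hr : ur ∈ M.Ωc) (hr' : ur ∉ M.Ωf)
    (hQ : Q (M.um ul ur) < Q ul) : LeftAt (M.R1 ul ur) (M.um ul ur) := by
  have hv := Ωc_speed hr
  have hlt : ul.1 < (M.um ul ur).1 := (fst_le_cs hl hv).lt_of_ne fun e =>
    hQ.ne' (congrArg Q (um_eq_of_fst_eq hl hv e))
  refine LeftAt.of_Ioo (σ_neg hlt hQ) fun x hx hx0 => ?_
  rw [R1_of_free_cong hl hr hr', if_neg hx.le.not_gt, if_pos (hx0.trans_le hv.1)]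

theorem R1_left_fc_ul (hl : ul ∈ M.Ωf) (hr : ur ∈ M.Ωc) (hr' : ur ∉ M.Ωf)
    (hQ : Q ul ≤ Q (M.um ul ur)) : LeftAt (M.R1 ul ur) ul := by
  have hv := Ωc_speed hr
  refine LeftAt.of_Ioo neg_one_lt_zero fun x _ hx0 => ?_
  have hσ : 0 ≤ σ ul (M.um ul ur) :=
    div_nonneg (sub_nonneg.2 hQ) (sub_nonneg.2 (fst_le_cs hl hv))
  rw [R1_of_free_cong hl hr hr', if_pos (hx0.trans_le hσ)]

theorem R1_right_fc_um (hl : ul ∈ M.Ωf) (hr : ur ∈ M.Ωc) (hr' : ur ∉ M.Ωf) (h0 : 0 < ur.2)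
    (hQ : Q (M.um ul ur) ≤ Q ul) : RightAt (M.R1 ul ur) (M.um ul ur) := by
  refine RightAt.of_Ioo h0 fun x hx hx0 => ?_
  have hσ : σ ul (M.um ul ur) ≤ 0 :=
    div_nonpos_of_nonpos_of_nonneg (sub_nonpos.2 hQ) (sub_nonneg.2 (fst_le_cs hl (Ωc_speed hr)))
  rw [R1_of_free_cong hl hr hr', if_neg (hσ.trans hx.le).not_gt, if_pos hx0]

theorem R1_right_fc_ul (hl : ul ∈ M.Ωf) (hr : ur ∈ M.Ωc) (hr' : ur ∉ M.Ωf)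
    (hQ : Q ul < Q (M.um ul ur)) : RightAt (M.R1 ul ur) ul := by
  have hv := Ωc_speed hr
  have hlt : ul.1 < (M.um ul ur).1 := (fst_le_cs hl hv).lt_of_ne fun e =>
    hQ.ne (congrArg Q (um_eq_of_fst_eq hl hv e))
  refine RightAt.of_Ioo (σ_pos hlt hQ) fun x _ hx => ?_
  rw [R1_of_free_cong hl hr hr', if_pos hx]

theorem R1_right_fc_zero (hl : ul ∈ M.Ωf) (hr : ur ∈ M.Ωc) (hr' : ur ∉ M.Ωf) (h0 : ur.2 = 0) :
    RightAt (M.R1 ul ur) ur := by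
  refine RightAt.of_Ioo one_pos fun x hx _ => ?_
  have hσ := σ_um_le hl (Ωc_speed hr)
  rw [h0] at hσ
  rw [R1_of_free_cong hl hr hr', if_neg (hσ.trans hx.le).not_gt, h0, if_neg hx.le.not_gt]

theorem R1_left_cf (hl : ul ∈ M.Ωc) (hl' : ul ∉ M.Ωf) (hr : ur ∈ M.Ωf) :
    LeftAt (M.R1 ul ur) (M.uf (M.W ul)) := by
  have hw := Ωc_marker hl
  rcases (σ_uc_uf_nonpos hw).lt_or_eq with h | h
  · refine LeftAt.of_Ioo h fun x hx hx0 => ?_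
    rw [R1_of_cong_free hl' hr, if_neg hx.le.not_gt, RLWR_of_nonpos (uf_mem hw) hr hx0.le]
  · have e : M.uc (M.W ul) = M.uf (M.W ul) := by
      refine uc_eq_uf_of_fst_eq hw (by_contra fun hne => ?_)
      have hlt : (M.uf (M.W ul)).1 < (M.uc (M.W ul)).1 := (uf_fst_le_uc hw).lt_of_ne (Ne.symm hne)
      have hQ : Q (M.uc (M.W ul)) < Q (M.uf (M.W ul)) := by
        rw [uc_eq, Q_cs hw M.Vc_mem_speeds, ← curveFlux_rhof hw]
        exact curveFlux_strictAntiOn hw (mem_Ici.2 le_rfl) (rhof_le_cs hw M.Vc_mem_speeds) hlt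
      have : σ (M.uc (M.W ul)) (M.uf (M.W ul)) < 0 :=
        div_neg_of_pos_of_neg (sub_pos.2 hQ) (sub_neg.2 hlt)
      exact this.ne h
    obtain ⟨s, hs, hs'⟩ := wave1_near_zero hl M.Vc_mem_speeds
    refine LeftAt.of_Ioo hs fun x hx hx0 => ?_
    rw [R1_of_cong_free hl' hr, h, if_pos hx0, RARZ_eq hl M.Vc_mem_speeds,
      if_pos (hx0.trans (show 0 < (M.uc (M.W ul)).2 from M.Vc_pos)), ← e]
    exact hs' x hx

theorem R1_right_cf (hl : ul ∈ M.Ωc) (hl' : ul ∉ M.Ωf) (hr : ur ∈ M.Ωf) :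
    RightAt (M.R1 ul ur) (M.uf (M.W ul)) := by
  have hw := Ωc_marker hl
  obtain ⟨s, hs, h⟩ := RLWR_near_zero (uf_mem hw) hr
  refine RightAt.of_Ioo hs fun x hx hx' => ?_
  rw [R1_of_cong_free hl' hr, if_neg ((σ_uc_uf_nonpos hw).trans hx.le).not_gt, h x hx']

theorem R2_left_ur (h : M.IsJump ul ur) (hr : ur ∈ M.Ω) (hQ : Q ur < Q ul) :
    LeftAt (M.R2 ul ur) ur :=
  LeftAt.of_Ioo (σ_neg (h.fst_lt hr) hQ) fun x hx _ => by
    rw [R2_of_jump h, if_neg hx.le.not_gt]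

theorem R2_left_ul (h : M.IsJump ul ur) (hr : ur ∈ M.Ω) (hQ : Q ul ≤ Q ur) :
    LeftAt (M.R2 ul ur) ul :=
  LeftAt.of_Ioo neg_one_lt_zero fun x _ hx => by
    have hσ : 0 ≤ σ ul ur := div_nonneg (sub_nonneg.2 hQ) (sub_nonneg.2 (h.fst_lt hr).le)
    rw [R2_of_jump h, if_pos (hx.trans_le hσ)]

theorem R2_right_ur (h : M.IsJump ul ur) (hr : ur ∈ M.Ω) (hQ : Q ur ≤ Q ul) :
    RightAt (M.R2 ul ur) ur :=
  RightAt.of_Ioo one_pos fun x hx _ => by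
    have hσ : σ ul ur ≤ 0 :=
      div_nonpos_of_nonpos_of_nonneg (sub_nonpos.2 hQ) (sub_nonneg.2 (h.fst_lt hr).le)
    rw [R2_of_jump h, if_neg (hσ.trans hx.le).not_gt]

theorem R2_right_ul (h : M.IsJump ul ur) (hr : ur ∈ M.Ω) (hQ : Q ul < Q ur) :
    RightAt (M.R2 ul ur) ul :=
  RightAt.of_Ioo (σ_pos (h.fst_lt hr) hQ) fun x _ hx => by
    rw [R2_of_jump h, if_pos hx]

/-! ### Data that violate the constraint -/

/-- The consequences of a violation of the flux constraint that the constructions of the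
admissible traces rely on: the flow exceeds `Q0` both where it is supplied and where it is
received. -/
structure Exceeds (M : Model) (ul ur : State) : Prop where
  left_free : ul ∈ M.Ωf → M.Q0 < Q ul
  left_cong : ul ∉ M.Ωf → M.Q0 < Q (M.uf (M.W ul))
  right : ur ∉ M.Ωf → 0 < ur.2 ∧ ∃ w ∈ M.markers, M.Q0 < Q (M.cs w ur.2)
  both : ul ∉ M.Ωf → ur ∉ M.Ωf → M.Q0 < Q (M.um ul ur)

theorem Q0_lt_of_not_fluxConstraint {f : ℝ → State} {a b : State} (h : ¬ M.FluxConstraint f)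
    (ha : LeftAt f a) (hb : RightAt f b) (hab : Q a = Q b) : M.Q0 < Q a := by
  by_contra hn
  exact h ⟨a, b, ha.tendsto, hb.tendsto, not_lt.1 hn, hab ▸ not_lt.1 hn⟩

theorem exceeds_of_R1 (hl : ul ∈ M.Ω) (hr : ur ∈ M.Ω) (h : ¬ M.FluxConstraint (M.R1 ul ur)) :
    M.Exceeds ul ur := by
  have hw := Ω_marker hl
  by_cases hlf : ul ∈ M.Ωf <;> by_cases hrf : ur ∈ M.Ωf
  · exact ⟨fun _ => Q0_lt_of_not_fluxConstraint h (R1_left_ff hlf hrf) (R1_right_ff hlf hrf) rfl,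
      fun h => (h hlf).elim, fun h => (h hrf).elim, fun h => (h hlf).elim⟩
  · have hc := Ωc_of_notMem hr hrf
    have hv := Ωc_speed hc
    have key : 0 < ur.2 ∧ M.Q0 < Q ul ∧ M.Q0 < Q (M.um ul ur) := by
      rcases hv.1.eq_or_lt with h0 | h0
      · exfalso
        have hQm : Q (M.um ul ur) = 0 := Q_um_of_speed_zero h0.symm
        have hQr : Q ur = 0 := Q_of_speed_zero h0.symm
        have hright := R1_right_fc_zero hlf hc hrf h0.symm
        rcases (Q_nonneg hl).eq_or_lt with hQl | hQl
        · have := Q0_lt_of_not_fluxConstraint h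
            (R1_left_fc_ul hlf hc hrf (hQl.symm.trans hQm.symm).le) hright
            (hQl.symm.trans hQr.symm)
          exact lt_asymm M.Q0_pos (hQl ▸ this)
        · have := Q0_lt_of_not_fluxConstraint h
            (R1_left_fc_um hlf hc hrf (hQm.trans_lt hQl)) hright (hQm.trans hQr.symm)
          exact lt_asymm M.Q0_pos (hQm ▸ this)
      · refine ⟨h0, ?_⟩
        rcases lt_trichotomy (Q ul) (Q (M.um ul ur)) with hQ | hQ | hQ
        · have := Q0_lt_of_not_fluxConstraint h (R1_left_fc_ul hlf hc hrf hQ.le)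
            (R1_right_fc_ul hlf hc hrf hQ) rfl
          exact ⟨this, this.trans hQ⟩
        · have := Q0_lt_of_not_fluxConstraint h (R1_left_fc_ul hlf hc hrf hQ.le)
            (R1_right_fc_um hlf hc hrf h0 hQ.ge) hQ
          exact ⟨this, hQ ▸ this⟩
        · have := Q0_lt_of_not_fluxConstraint h (R1_left_fc_um hlf hc hrf hQ)
            (R1_right_fc_um hlf hc hrf h0 hQ.le) rfl
          exact ⟨this.trans hQ, this⟩
    exact ⟨fun _ => key.2.1, fun h => (h hlf).elim, fun _ => ⟨key.1, _, hw, key.2.2⟩,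
      fun h => (h hlf).elim⟩
  · have hc := Ωc_of_notMem hl hlf
    exact ⟨fun h => (hlf h).elim, fun _ => Q0_lt_of_not_fluxConstraint h (R1_left_cf hc hlf hrf)
      (R1_right_cf hc hlf hrf) rfl, fun h => (h hrf).elim, fun _ h => (h hrf).elim⟩
  · have hc := Ωc_of_notMem hl hlf
    have hc' := Ωc_of_notMem hr hrf
    have hv := Ωc_speed hc'
    have hleft := R1_left_cc hc hlf hc' hrf
    have key : 0 < ur.2 ∧ M.Q0 < Q (M.um ul ur) := by
      rcases hv.1.eq_or_lt with h0 | h0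
      · exfalso
        have hQm : Q (M.um ul ur) = 0 := Q_um_of_speed_zero h0.symm
        have := Q0_lt_of_not_fluxConstraint h hleft (R1_right_cc_zero hc hlf hc' hrf h0.symm)
          (hQm.trans (Q_of_speed_zero h0.symm).symm)
        exact lt_asymm M.Q0_pos (hQm ▸ this)
      · exact ⟨h0, Q0_lt_of_not_fluxConstraint h hleft (R1_right_cc hc hlf hc' hrf h0) rfl⟩
    exact ⟨fun h => (hlf h).elim, fun _ => key.2.trans_le (Q_cs_le_uf hw hv),
      fun _ => ⟨key.1, _, hw, key.2⟩, fun _ _ => key.2⟩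

theorem exceeds_of_R2 (hl : ul ∈ M.Ω) (hr : ur ∈ M.Ω) (h : ¬ M.FluxConstraint (M.R2 ul ur)) :
    M.Exceeds ul ur := by
  by_cases hj : M.IsJump ul ur
  · have hc := Ωc_of_notMem hr hj.2.1
    have key : M.Q0 < Q ul ∧ M.Q0 < Q ur := by
      rcases lt_trichotomy (Q ul) (Q ur) with hQ | hQ | hQ
      · have := Q0_lt_of_not_fluxConstraint h (R2_left_ul hj hr hQ.le) (R2_right_ul hj hr hQ) rfl
        exact ⟨this, this.trans hQ⟩
      · have := Q0_lt_of_not_fluxConstraint h (R2_left_ul hj hr hQ.le) (R2_right_ur hj hr hQ.ge) hQ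
        exact ⟨this, hQ ▸ this⟩
      · have := Q0_lt_of_not_fluxConstraint h (R2_left_ur hj hr hQ) (R2_right_ur hj hr hQ.le) rfl
        exact ⟨this.trans hQ, this⟩
    have hpos : 0 < ur.2 := (Ωc_speed hc).1.lt_of_ne fun e => by
      have h1 := key.2
      rw [Q_of_speed_zero e.symm] at h1
      exact lt_asymm M.Q0_pos h1
    exact ⟨fun _ => key.1, fun h => (h hj.1).elim,
      fun _ => ⟨hpos, _, Ωc_marker hc, by rw [cs_W hc]; exact key.2⟩, fun h => (h hj.1).elim⟩
  · rw [R2_of_not_jump hj] at h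
    exact exceeds_of_R1 hl hr h

theorem Exceeds.Q0_lt_uf (h : M.Exceeds ul ur) : M.Q0 < Q (M.uf (M.W ul)) := by
  by_cases hf : ul ∈ M.Ωf
  · exact (h.left_free hf).trans_le (Q_le_Q_uf hf)
  · exact h.left_cong hf

variable {M : Model} {ul ur : State}

/-! ### Admissible traces on the right -/

theorem Q_cs_lt_marker {w w' v : ℝ} (hw : w ∈ M.markers) (hw' : w' ∈ M.markers)
    (hv : v ∈ M.speeds) (h0 : 0 < v) : Q (M.cs w v) < Q (M.cs w' v) ↔ w < w' := by
  rw [← cs_fst_lt_marker hw hv hw', Q_cs_eq, Q_cs_eq]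
  exact mul_lt_mul_iff_left₀ h0

theorem Q_cs_le_marker {w w' v : ℝ} (hw : w ∈ M.markers) (hw' : w' ∈ M.markers)
    (hv : v ∈ M.speeds) (h0 : 0 < v) : Q (M.cs w v) ≤ Q (M.cs w' v) ↔ w ≤ w' := by
  rw [← not_lt, ← not_lt, Q_cs_lt_marker hw' hw hv h0]

/-- At a fixed positive speed, the flows between those of two markers are attained. -/
theorem exists_marker {w₁ w₂ v q : ℝ} (h1 : w₁ ∈ M.markers) (h2 : w₂ ∈ M.markers)
    (hv : v ∈ M.speeds) (h0 : 0 < v) (hq1 : Q (M.cs w₁ v) ≤ q) (hq2 : q ≤ Q (M.cs w₂ v)) :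
    ∃ w ∈ M.markers, Q (M.cs w v) = q := by
  rw [Q_cs_eq, ← le_div_iff₀ h0] at hq1
  rw [Q_cs_eq, ← div_le_iff₀ h0] at hq2
  have hr : 0 < q / v := (cs_pos h1 hv).trans_le hq1
  have hp1 := (M.p_le_p (cs_pos h1 hv) hr).2 hq1
  have hp2 := (M.p_le_p hr (cs_pos h2 hv)).2 hq2
  rw [p_cs h1 hv] at hp1
  rw [p_cs h2 hv] at hp2
  refine ⟨v + M.p (q / v), ⟨by linarith [h1.1], by linarith [h2.2]⟩, ?_⟩
  rw [Q_cs_eq, cs, add_sub_cancel_left, M.pInv_p hr, div_mul_cancel₀ _ h0.ne']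

/-- For `ρ ≥ Rf1` a free state carries the largest flow of its Lax curve. So a larger flow at the
same marker is possible only for `ρ < Rf1`, where the marker is `Wc`. -/
theorem W_eq_Wc_of_Q_lt {u : State} (hu : u ∈ M.Ωf) {v : ℝ} (hv : v ∈ M.speeds)
    (h : Q u < Q (M.cs (M.W u) v)) : M.W u = M.Wc := by
  rcases lt_or_ge u.1 M.Rf1 with h1 | h1
  · exact W_of_lt h1
  · have := Q_cs_le_uf (free_marker hu) hv
    rw [uf_W_of_ge hu h1] at this
    exact absurd h this.not_gt

theorem eq_of_Q_of_speed {u u' : State} (h : Q u = Q u') (h' : u.2 = u'.2) (h0 : 0 < u.2) :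
    u = u' := by
  refine Prod.ext ?_ h'
  rw [Q, Q, ← h'] at h
  exact mul_right_cancel₀ h0.ne' h

theorem R1_right_trace_free (hl : ul ∈ M.Ωf) (hr : ur ∈ M.Ωc) (hr' : ur ∉ M.Ωf) (h0 : 0 < ur.2)
    (h : Tendsto (M.R1 ul ur) (𝓝[>] 0) (𝓝 ul)) : Q ul < Q (M.um ul ur) ∨ ul = M.um ul ur :=
  or_iff_not_imp_left.2 fun hn => (R1_right_fc_um hl hr hr' h0 (not_lt.1 hn)).eq h

theorem R1_right_trace_cong (hl : ul ∈ M.Ωc) (hl' : ul ∉ M.Ωf) (hr : ur ∈ M.Ωc)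
    (hr' : ur ∉ M.Ωf) (h0 : 0 < ur.2) (h : Tendsto (M.R1 ul ur) (𝓝[>] 0) (𝓝 ul)) :
    ul.2 = ur.2 := by
  rw [(R1_right_cc hl hl' hr hr' h0).eq h]; rfl

theorem R1_right_trace_um (hl : ul ∈ M.Ω) (hr : ur ∈ M.Ωc) (hr' : ur ∉ M.Ωf) (h0 : 0 < ur.2)
    (h : M.um ul ur = ul) : RightAt (M.R1 ul ur) ul := by
  by_cases hf : ul ∈ M.Ωf
  · have := R1_right_fc_um hf hr hr' h0 (congrArg Q h).le
    rwa [h] at this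
  · have := R1_right_cc (Ωc_of_notMem hl hf) hf hr hr' h0
    rwa [h] at this

/-- The trace on the right of a congested datum with a free one is free. -/
theorem not_right_trace_cf (hl : ul ∈ M.Ωc) (hl' : ul ∉ M.Ωf) (hr : ur ∈ M.Ωf) :
    ¬ Tendsto (M.R1 ul ur) (𝓝[>] 0) (𝓝 ul) := fun h =>
  hl' ((R1_right_cf hl hl' hr).eq h ▸ uf_mem (Ωc_marker hl))

/-- For every flow up to `Q0` that the datum on the right can receive, there is exactly one state
with this flow that is a trace at `0+` of the first solver. It is free or congested according as
the flow is below or above that of the Lax curve with marker `Wc` at the speed of the datum. -/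
theorem R1_right_trace {q : ℝ} (hr : ur ∈ M.Ω) (h0 : 0 ≤ q) (hq : q ≤ M.Q0)
    (hrec : ur ∉ M.Ωf → 0 < ur.2 ∧ ∃ w ∈ M.markers, q < Q (M.cs w ur.2)) :
    ∃ uk ∈ M.Ω, Q uk = q ∧ Tendsto (M.R1 uk ur) (𝓝[>] 0) (𝓝 uk) ∧
      ∀ u ∈ M.Ω, Q u = q → Tendsto (M.R1 u ur) (𝓝[>] 0) (𝓝 u) → u = uk := by
  obtain ⟨F, hF, hFq⟩ := exists_free_Q_eq h0 hq
  by_cases hrf : ur ∈ M.Ωf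
  · refine ⟨F, Or.inl hF, hFq, (R1_right_ff hF hrf).tendsto, fun u hu huq hut => ?_⟩
    by_cases huf : u ∈ M.Ωf
    · exact free_eq_of_Q huf hF (huq.trans hFq.symm)
    · exact (not_right_trace_cf (Ωc_of_notMem hu huf) huf hrf hut).elim
  have hc := Ωc_of_notMem hr hrf
  have hv := Ωc_speed hc
  obtain ⟨hpos, w, hw, hqw⟩ := hrec hrf
  rcases lt_or_ge q (Q (M.cs M.Wc ur.2)) with hA | hA
  · have hlow : ∀ w ∈ M.markers, q < Q (M.cs w ur.2) := fun w hw =>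
      hA.trans_le ((Q_cs_le_marker M.Wc_mem hw hv hpos).2 hw.1)
    refine ⟨F, Or.inl hF, hFq, (R1_right_fc_ul hF hc hrf ?_).tendsto, fun u hu huq hut => ?_⟩
    · rw [hFq]; exact hlow _ (free_marker hF)
    · by_cases huf : u ∈ M.Ωf
      · exact free_eq_of_Q huf hF (huq.trans hFq.symm)
      · have huc := Ωc_of_notMem hu huf
        have h1 := hlow _ (Ωc_marker huc)
        rw [← R1_right_trace_cong huc huf hc hrf hpos hut, cs_W huc, huq] at h1
        exact (lt_irrefl _ h1).elim
  · obtain ⟨w', hw', hQw'⟩ := exists_marker M.Wc_mem hw hv hpos hA hqw.le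
    have hm : M.cs w' ur.2 ∈ M.Ωc := cs_mem hw' hv
    have hum : M.um (M.cs w' ur.2) ur = M.cs w' ur.2 := by rw [um_eq, W_cs hw' hv]
    refine ⟨_, Or.inr hm, hQw', (R1_right_trace_um (Or.inr hm) hc hrf hpos hum).tendsto,
      fun u hu huq hut => ?_⟩
    have hspeed : u.2 = ur.2 → u = M.cs w' ur.2 := fun h =>
      eq_of_Q_of_speed (huq.trans hQw'.symm) h (h ▸ hpos)
    by_cases huf : u ∈ M.Ωf
    · rcases R1_right_trace_free huf hc hrf hpos hut with h | h
      · have h1 := W_eq_Wc_of_Q_lt huf hv h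
        rw [um_eq, h1, huq] at h
        exact absurd h hA.not_gt
      · exact hspeed (show u.2 = (M.um u ur).2 from congrArg Prod.snd h)
    · exact hspeed (R1_right_trace_cong (Ωc_of_notMem hu huf) huf hc hrf hpos hut)

/-! ### The admissible pair of the first constrained solver -/

theorem Q_uc_pos {w : ℝ} (hw : w ∈ M.markers) : 0 < Q (M.uc w) :=
  Q_pos_of_speed_pos (uc_mem hw) M.Vc_pos

/-- A congested state on the Lax curve of `ul` is a trace at `0-` of the solver, provided that its
flow is less than the one supplied by a free `ul`. -/
theorem R1_left_trace {uh : State} (hl : ul ∈ M.Ω) (hc : uh ∈ M.Ωc) (hc' : uh ∉ M.Ωf)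
    (hW : M.W uh = M.W ul) (hQ : ul ∈ M.Ωf → Q uh < Q ul) : LeftAt (M.R1 ul uh) uh := by
  have hum : M.um ul uh = uh := by rw [um_eq, ← hW, cs_W hc]
  by_cases hf : ul ∈ M.Ωf
  · have := R1_left_fc_um hf hc hc' (by rw [hum]; exact hQ hf)
    rwa [hum] at this
  · have := R1_left_cc (Ωc_of_notMem hl hf) hf hc hc'
    rwa [hum] at this

/-- Admissible left traces are congested: a free trace carries the whole supplied flow. -/
theorem Exceeds.not_free_trace (h : M.Exceeds ul ur) (hl : ul ∈ M.Ω) {uh : State}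
    (hQ : Q uh ≤ M.Q0) (ht : Tendsto (M.R1 ul uh) (𝓝[<] 0) (𝓝 uh)) : uh ∉ M.Ωf := by
  intro hf
  by_cases hlf : ul ∈ M.Ωf
  · have := (R1_left_ff hlf hf).eq ht
    rw [this] at hQ
    exact hQ.not_gt (h.left_free hlf)
  · have := (R1_left_cf (Ωc_of_notMem hl hlf) hlf hf).eq ht
    rw [this] at hQ
    exact hQ.not_gt (h.left_cong hlf)

/-- A congested state on the Lax curve of `ul` with flow at most `Q0` is not free. -/
theorem Exceeds.not_free_of_Q_le (h : M.Exceeds ul ur) {uh : State} (hc : uh ∈ M.Ωc)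
    (hW : M.W uh = M.W ul) (hQ : Q uh ≤ M.Q0) : uh ∉ M.Ωf := by
  intro hf
  have e := uf_eq_of_mem hf hc
  rw [hW] at e
  rw [← e] at hQ
  exact hQ.not_gt h.Q0_lt_uf

/-- The maximal flow is the smaller one of `Q0` and the flow of `uc (W ul)`. -/
theorem exists_isR1Pair (hl : ul ∈ M.Ω) (hr : ur ∈ M.Ω) (h : M.Exceeds ul ur) :
    ∃ d, M.IsR1Pair ul ur d := by
  have hw := Ω_marker hl
  set q := min M.Q0 (Q (M.uc (M.W ul)))
  have hq0 : 0 < q := lt_min M.Q0_pos (Q_uc_pos hw)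
  have hqQ : q ≤ M.Q0 := min_le_left _ _
  obtain ⟨v, hv, hvq⟩ := exists_Q_cs_eq hw hq0.le (min_le_right _ _)
  set uh := M.cs (M.W ul) v
  have hc : uh ∈ M.Ωc := cs_mem hw hv
  have hW : M.W uh = M.W ul := W_cs hw hv
  have hc' : uh ∉ M.Ωf := h.not_free_of_Q_le hc hW (hvq.le.trans hqQ)
  obtain ⟨uk, hk, hkq, hkt, huniq⟩ := R1_right_trace hr hq0.le hqQ fun hrf => by
    obtain ⟨h1, w, h2, h3⟩ := h.right hrf
    exact ⟨h1, w, h2, hqQ.trans_lt h3⟩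
  refine ⟨(uh, uk), hc, hk, ⟨?_, hkt, hvq.trans hkq.symm, hkq.le.trans hqQ, hW⟩, ?_⟩
  · exact (R1_left_trace hl hc hc' hW fun hf =>
      (hvq.le.trans hqQ).trans_lt (h.left_free hf)).tendsto
  · rintro ⟨eh, ek⟩ heh hek hne ⟨h1, h2, h3, h4, h5⟩
    change eh ∈ M.Ω at heh
    change ek ∈ M.Ω at hek
    have hehc := Ωc_of_notMem heh (h.not_free_trace hl (h3.le.trans h4) h1)
    have hle : Q eh ≤ q := by
      refine le_min (h3.le.trans h4) ?_
      have := Q_le_Q_uc hehc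
      rwa [h5] at this
    refine lt_of_le_of_ne (hle.trans hvq.ge) fun e => hne ?_
    have e' : Q eh = Q uh := e
    have e1 : eh = uh := Ωc_eq_of_Q hehc hc (h5.trans hW.symm) e'
    have e2 : ek = uk := huniq ek hek (h3.symm.trans (e'.trans hvq)) h2
    rw [e1, e2]

/-! ### The admissible pair of the second constrained solver -/

variable (M) in
/-- The flow through `x = 0` for the second constrained solver. -/
noncomputable def flow2 : ℝ := min M.Q0 (Q (M.uc M.Wmax))

theorem flow2_pos : 0 < M.flow2 := lt_min M.Q0_pos (Q_uc_pos M.Wmax_mem)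

theorem flow2_le : M.flow2 ≤ M.Q0 := min_le_left _ _

variable (M) in
/-- The optimal left trace: it lies on the Lax curve of `ul` if the flow can be attained there,
and has the speed `Vc` otherwise. -/
structure IsMinLeft (ul uh : State) : Prop where
  mem : uh ∈ M.Ωc
  flow : Q uh = M.flow2
  marker : M.W ul ≤ M.W uh
  min : ∀ e ∈ M.Ωc, Q e = M.flow2 → M.W ul ≤ M.W e → e ≠ uh → M.W uh < M.W e
  same_marker : M.flow2 ≤ Q (M.uc (M.W ul)) → M.W uh = M.W ul
  speed : Q (M.uc (M.W ul)) < M.flow2 → uh.2 = M.Vc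

theorem exists_isMinLeft (hl : ul ∈ M.Ω) : ∃ uh, M.IsMinLeft ul uh := by
  have hw := Ω_marker hl
  rcases le_or_gt M.flow2 (Q (M.uc (M.W ul))) with hq | hq
  · obtain ⟨v, hv, hvq⟩ := exists_Q_cs_eq hw flow2_pos.le hq
    have hc := cs_mem hw hv
    have hW : M.W (M.cs (M.W ul) v) = M.W ul := W_cs hw hv
    refine ⟨M.cs (M.W ul) v, hc, hvq, hW.ge, fun e he heq hle hne => ?_, fun _ => hW,
      fun h => absurd h hq.not_gt⟩
    rw [hW]
    exact hle.lt_of_ne fun h' =>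
      hne (Ωc_eq_of_Q he hc (h'.symm.trans hW.symm) (heq.trans hvq.symm))
  · obtain ⟨w, hw', hwq⟩ := exists_marker hw M.Wmax_mem M.Vc_mem_speeds M.Vc_pos hq.le
      (min_le_right _ _)
    have hc := cs_mem hw' M.Vc_mem_speeds
    have hW : M.W (M.cs w M.Vc) = w := W_cs hw' M.Vc_mem_speeds
    refine ⟨M.cs w M.Vc, hc, hwq, ?_, fun e he heq hle hne => ?_, fun h => absurd hq h.not_gt,
      fun _ => rfl⟩
    · rw [hW, ← Q_cs_le_marker hw hw' M.Vc_mem_speeds M.Vc_pos, hwq]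
      exact hq.le
    · have h1 := Q_le_Q_uc he
      rw [heq, ← hwq, uc_eq,
        Q_cs_le_marker hw' (Ωc_marker he) M.Vc_mem_speeds M.Vc_pos] at h1
      rw [hW]
      exact h1.lt_of_ne fun h' =>
        hne (Ωc_eq_of_Q he hc (h'.symm.trans hW.symm) (heq.trans hwq.symm))

theorem not_isJump_of_notMem (h : ul ∉ M.Ωf) : ¬ M.IsJump ul ur := fun hj => h hj.1

theorem not_isJump_of_mem (h : ur ∈ M.Ωf) : ¬ M.IsJump ul ur := fun hj => hj.2.1 h

/-- Some state of the prescribed flow is a right trace of the second solver. -/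
theorem exists_R2_right_trace (hr : ur ∈ M.Ω) (h : M.Exceeds ul ur) :
    ∃ uk ∈ M.Ω, Q uk = M.flow2 ∧ Tendsto (M.R2 uk ur) (𝓝[>] 0) (𝓝 uk) := by
  obtain ⟨F, hF, hFq⟩ := exists_free_Q_eq (M := M) flow2_pos.le flow2_le
  by_cases hrf : ur ∈ M.Ωf
  · refine ⟨F, Or.inl hF, hFq, ?_⟩
    rw [R2_of_not_jump (not_isJump_of_mem hrf)]
    exact (R1_right_ff hF hrf).tendsto
  have hc := Ωc_of_notMem hr hrf
  have hv := Ωc_speed hc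
  obtain ⟨hpos, w, hw, hqw⟩ := h.right hrf
  rcases lt_or_ge M.flow2 (Q (M.cs M.Wc ur.2)) with hA | hA
  · have hlow : ∀ w ∈ M.markers, M.flow2 < Q (M.cs w ur.2) := fun w hw =>
      hA.trans_le ((Q_cs_le_marker M.Wc_mem hw hv hpos).2 hw.1)
    refine ⟨F, Or.inl hF, hFq, ?_⟩
    by_cases hj : M.IsJump F ur
    · refine (R2_right_ul hj hr ?_).tendsto
      have := hlow _ (Ωc_marker hc)
      rwa [cs_W hc, ← hFq] at this
    · rw [R2_of_not_jump hj]
      refine (R1_right_fc_ul hF hc hrf ?_).tendsto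
      rw [hFq]; exact hlow _ (free_marker hF)
  · obtain ⟨w', hw', hQw'⟩ := exists_marker M.Wc_mem hw hv hpos hA (flow2_le.trans hqw.le)
    have hm : M.cs w' ur.2 ∈ M.Ωc := cs_mem hw' hv
    have hW : M.W (M.cs w' ur.2) = w' := W_cs hw' hv
    refine ⟨_, Or.inr hm, hQw', ?_⟩
    by_cases hj : M.IsJump (M.cs w' ur.2) ur
    · refine (R2_right_ul hj hr ?_).tendsto
      have h1 := hj.2.2.2
      rw [hW, ← Q_cs_lt_marker hw' (Ωc_marker hc) hv hpos, cs_W hc] at h1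
      exact h1
    · rw [R2_of_not_jump hj]
      exact (R1_right_trace_um (Or.inr hm) hc hrf hpos (by rw [um_eq, hW])).tendsto

/-- There is at most one strictly congested right trace of a given positive flow. -/
theorem R2_right_trace_cong_unique (hr : ur ∈ M.Ω) (hpos : ur ∉ M.Ωf → 0 < ur.2) {u u' : State}
    (hu : u ∈ M.Ωc) (hu' : u ∉ M.Ωf) (ht : Tendsto (M.R2 u ur) (𝓝[>] 0) (𝓝 u))
    (hv : u' ∈ M.Ωc) (hv' : u' ∉ M.Ωf) (ht' : Tendsto (M.R2 u' ur) (𝓝[>] 0) (𝓝 u'))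
    (hQ : Q u = Q u') : u = u' := by
  rw [R2_of_not_jump (not_isJump_of_notMem hu')] at ht
  rw [R2_of_not_jump (not_isJump_of_notMem hv')] at ht'
  by_cases hrf : ur ∈ M.Ωf
  · exact (not_right_trace_cf hu hu' hrf ht).elim
  · have hc := Ωc_of_notMem hr hrf
    have h1 := R1_right_trace_cong hu hu' hc hrf (hpos hrf) ht
    have h2 := R1_right_trace_cong hv hv' hc hrf (hpos hrf) ht'
    exact eq_of_Q_of_speed hQ (h1.trans h2.symm) (h1 ▸ hpos hrf)

/-- The optimal right trace: there are at most two candidates, one in each phase. -/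
theorem exists_max_right (hr : ur ∈ M.Ω) (h : M.Exceeds ul ur) :
    ∃ uk ∈ M.Ω, Q uk = M.flow2 ∧ Tendsto (M.R2 uk ur) (𝓝[>] 0) (𝓝 uk) ∧
      ∀ e ∈ M.Ω, Q e = M.flow2 → Tendsto (M.R2 e ur) (𝓝[>] 0) (𝓝 e) → e ≠ uk →
        M.W e < M.W uk ∨ (M.W e = M.W uk ∧ uk ∈ M.Ωc ∧ e ∉ M.Ωc) := by
  have hpos : ur ∉ M.Ωf → 0 < ur.2 := fun hf => (h.right hf).1
  have hcong : ∀ u ∈ M.Ω, u ∉ M.Ωf → Q u = M.flow2 → Tendsto (M.R2 u ur) (𝓝[>] 0) (𝓝 u) →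
      ∀ e ∈ M.Ω, e ∉ M.Ωf → Q e = M.flow2 → Tendsto (M.R2 e ur) (𝓝[>] 0) (𝓝 e) → e = u :=
    fun u hu hu' huq hut e he he' heq het => R2_right_trace_cong_unique hr hpos
      (Ωc_of_notMem he he') he' het (Ωc_of_notMem hu hu') hu' hut (heq.trans huq.symm)
  by_cases hex : ∃ g ∈ M.Ω, g ∉ M.Ωf ∧ Q g = M.flow2 ∧ Tendsto (M.R2 g ur) (𝓝[>] 0) (𝓝 g)
  · obtain ⟨g, hg, hg', hgq, hgt⟩ := hex
    have hgc := Ωc_of_notMem hg hg'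
    by_cases hfx : ∃ f ∈ M.Ωf, Q f = M.flow2 ∧ Tendsto (M.R2 f ur) (𝓝[>] 0) (𝓝 f) ∧
        M.W g < M.W f
    · obtain ⟨f, hf, hfq, hft, hlt⟩ := hfx
      refine ⟨f, Or.inl hf, hfq, hft, fun e he heq het hne => Or.inl ?_⟩
      by_cases hef : e ∈ M.Ωf
      · exact (hne (free_eq_of_Q hef hf (heq.trans hfq.symm))).elim
      · rwa [hcong g hg hg' hgq hgt e he hef heq het]
    · refine ⟨g, hg, hgq, hgt, fun e he heq het hne => ?_⟩
      by_cases hef : e ∈ M.Ωf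
      · have hle : M.W e ≤ M.W g := not_lt.1 fun hlt => hfx ⟨e, hef, heq, het, hlt⟩
        rcases hle.lt_or_eq with hlt | heq'
        · exact Or.inl hlt
        · exact Or.inr ⟨heq', hgc, fun hec => hne (Ωc_eq_of_Q hec hgc heq' (heq.trans hgq.symm))⟩
      · exact (hne (hcong g hg hg' hgq hgt e he hef heq het)).elim
  · obtain ⟨f, hf, hfq, hft⟩ := exists_R2_right_trace hr h
    have hall : ∀ e ∈ M.Ω, Q e = M.flow2 → Tendsto (M.R2 e ur) (𝓝[>] 0) (𝓝 e) → e ∈ M.Ωf :=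
      fun e he heq het => by_contra fun hn => hex ⟨e, he, hn, heq, het⟩
    exact ⟨f, hf, hfq, hft, fun e he heq het hne => (hne (free_eq_of_Q (hall e he heq het)
      (hall f hf hfq hft) (heq.trans hfq.symm))).elim⟩

theorem exists_isR2Pair (hl : ul ∈ M.Ω) (hr : ur ∈ M.Ω) (h : M.Exceeds ul ur) :
    ∃ d, M.IsR2Pair ul ur d := by
  obtain ⟨uh, hh⟩ := exists_isMinLeft hl
  obtain ⟨uk, hk, hkq, hkt, hmax⟩ := exists_max_right hr h
  refine ⟨(uh, uk), hh.mem, hk, ⟨hkt, hh.flow, hkq, hh.marker⟩, ?_⟩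
  rintro ⟨eh, ek⟩ heh hek hne ⟨h1, h2, h3, h4⟩
  by_cases hhe : eh = uh
  · refine Or.inr (hmax ek hek h3 h1 fun hke => hne ?_)
    rw [hhe, hke]
  · exact Or.inl (hh.min eh heh h2 h4 hhe)

/-- The left traces of the optimal pairs are the optimal left traces. -/
theorem IsR2Pair.isMinLeft {d : State × State} (hl : ul ∈ M.Ω) (hd : M.IsR2Pair ul ur d) :
    M.IsMinLeft ul d.1 := by
  obtain ⟨uh, hh⟩ := exists_isMinLeft hl
  obtain ⟨h1, h2, ⟨h3, h4, h5, h6⟩, h7⟩ := hd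
  have e : d.1 = uh := by
    by_contra hne
    have hlt := hh.min d.1 h1 h4 h6 hne
    rcases h7 (uh, d.2) hh.mem h2 (fun e => hne (congrArg Prod.fst e).symm)
      ⟨h3, hh.flow, h5, hh.marker⟩ with h | h | h
    · exact lt_asymm h hlt
    · exact lt_irrefl _ h
    · exact h.2.2 h.2.1
  rw [e]; exact hh

end Model

/-! ### Juxtaposition at the constraint -/

section glue

variable {M : Model} {a b c d uh uk : State} {f g : ℝ → State}

/-- The flux through the ray `x = 0` is the flow, and it is continuous there: the flow at `0` is
that of either trace. -/
theorem Profile.flow_at_zero (hf : Profile M a b f) {l : Filter ℝ} [l.NeBot] (hl : l ≤ 𝓝 0)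
    (h : Tendsto f l (𝓝 uh)) : Q (f 0) = Q uh := by
  have h1 : Tendsto (rayFlux (fun x => (f x).1) fun x => Q (f x)) l (𝓝 (Q (f 0))) := by
    have := (hf.mass.continuousAt 0 trivial).tendsto.mono_left hl
    simpa [rayFlux] using this
  have hQ : Continuous Q := continuous_fst.mul continuous_snd
  have h2 : Tendsto (rayFlux (fun x => (f x).1) fun x => Q (f x)) l (𝓝 (Q uh - 0 * uh.1)) :=
    ((hQ.tendsto uh).comp h).sub
      ((tendsto_id.mono_left hl).mul ((continuous_fst.tendsto uh).comp h))
  simpa using tendsto_nhds_unique h1 h2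

theorem Profile.glue (hf : Profile M a b f) (hg : Profile M c d g)
    (h1 : Tendsto f (𝓝[<] 0) (𝓝 uh)) (h2 : Tendsto g (𝓝[>] 0) (𝓝 uk)) (hQ : Q uh = Q uk) :
    Profile M a d (glue f g) := by
  refine hf.ite_lt hg 0 ?_
  rw [hf.flow_at_zero nhdsWithin_le_nhds h1, hg.flow_at_zero nhdsWithin_le_nhds h2, hQ]
  simp

theorem MomentumOn.glue (hf : MomentumOn M f (Iio 0)) (hg : MomentumOn M g univ) :
    MomentumOn M (glue f g) {0}ᶜ :=
  .of_sides 0 (hf.congr isOpen_Iio fun _ hx => if_pos (mem_Iio.1 hx))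
    ((hg.mono (subset_univ _)).congr isOpen_Ioi fun _ hx => if_neg (mem_Ioi.1 hx).le.not_gt)

theorem glue_left (h : Tendsto f (𝓝[<] 0) (𝓝 uh)) : Tendsto (glue f g) (𝓝[<] 0) (𝓝 uh) := by
  refine h.congr' ?_
  filter_upwards [self_mem_nhdsWithin] with x hx using (if_pos (mem_Iio.1 hx)).symm

theorem glue_right (h : Tendsto g (𝓝[>] 0) (𝓝 uk)) : Tendsto (glue f g) (𝓝[>] 0) (𝓝 uk) := by
  refine h.congr' ?_
  filter_upwards [self_mem_nhdsWithin] with x hx using (if_neg (mem_Ioi.1 hx).le.not_gt).symm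

theorem selfSimilar_left {t : ℝ} (ht : 0 < t) (h : Tendsto f (𝓝[<] 0) (𝓝 uh)) :
    Tendsto (selfSimilar f t) (𝓝[<] 0) (𝓝 uh) := by
  refine h.comp (tendsto_nhdsWithin_iff.2 ⟨?_, ?_⟩)
  · have : Continuous fun x : ℝ => x / t := by fun_prop
    simpa using (this.tendsto 0).mono_left nhdsWithin_le_nhds
  · filter_upwards [self_mem_nhdsWithin] with x hx using div_neg_of_neg_of_pos hx ht

theorem selfSimilar_right {t : ℝ} (ht : 0 < t) (h : Tendsto f (𝓝[>] 0) (𝓝 uk)) :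
    Tendsto (selfSimilar f t) (𝓝[>] 0) (𝓝 uk) := by
  refine h.comp (tendsto_nhdsWithin_iff.2 ⟨?_, ?_⟩)
  · have : Continuous fun x : ℝ => x / t := by fun_prop
    simpa using (this.tendsto 0).mono_left nhdsWithin_le_nhds
  · filter_upwards [self_mem_nhdsWithin] with x hx using div_pos hx ht

theorem fluxConstraint_selfSimilar {t : ℝ} (ht : 0 < t) (h : M.FluxConstraint f) :
    M.FluxConstraint (selfSimilar f t) := by
  obtain ⟨a, b, h1, h2, h3, h4⟩ := h
  exact ⟨a, b, selfSimilar_left ht h1, selfSimilar_right ht h2, h3, h4⟩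

/-- Profiles that are equal almost everywhere have the same left trace. -/
theorem left_trace_eq_of_ae (hfg : f =ᵐ[volume] g) (hf : Tendsto f (𝓝[<] 0) (𝓝 uh))
    (hg : Tendsto g (𝓝[<] 0) (𝓝 uk)) : uh = uk := by
  have hfr : ∃ᶠ x in 𝓝[<] (0 : ℝ), f x = g x := by
    intro hev
    obtain ⟨s, hs, hsub⟩ := mem_nhdsLT_iff_exists_Ioo_subset.1 hev
    obtain ⟨x, hx, hfx⟩ := (Measure.dense_of_ae hfg).inter_open_nonempty _ isOpen_Ioo
      (nonempty_Ioo.2 hs)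
    exact hsub hx hfx
  by_contra hne
  obtain ⟨U, V, hU, hV, hU', hV', hUV⟩ := t2_separation hne
  obtain ⟨x, hx, h1, h2⟩ := (hfr.and_eventually
    ((hf.eventually (hU.mem_nhds hU')).and (hg.eventually (hV.mem_nhds hV')))).exists
  exact hUV.le_bot ⟨h1, hx ▸ h2⟩

end glue

namespace Model

variable {M : Model} {ul ur : State}

/-! ### The first constrained solver -/

theorem pair1_spec (hl : ul ∈ M.Ω) (hr : ur ∈ M.Ω) (h : (ul, ur) ∈ M.N1) :
    M.IsR1Pair ul ur (M.pair1 ul ur) :=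
  Classical.epsilon_spec (exists_isR1Pair hl hr
    (exceeds_of_R1 hl hr fun hf => h.2 ⟨hl, hr, hf⟩))

theorem R1c_of_mem_C1 (h : (ul, ur) ∈ M.C1) : M.R1c ul ur = M.R1 ul ur := if_pos h

theorem R1c_of_mem_N1 (h : (ul, ur) ∈ M.N1) :
    M.R1c ul ur = glue (M.R1 ul (M.pair1 ul ur).1) (M.R1 (M.pair1 ul ur).2 ur) := if_neg h.2

theorem R1c_isWeakSolution_of_mem_N1 (hl : ul ∈ M.Ω) (hr : ur ∈ M.Ω) (h : (ul, ur) ∈ M.N1) :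
    IsWeakSolution M {0} ul ur (selfSimilar (M.R1c ul ur)) := by
  obtain ⟨hh, hk, ⟨h1, h2, h3, -, -⟩, -⟩ := pair1_spec hl hr h
  rw [R1c_of_mem_N1 h]
  refine ((R1_profile hl (Or.inr hh)).glue (R1_profile hk hr) h1 h2 h3).isWeakSolution
    (O := {0}ᶜ) (fun t ht x hx hx0 => hx ?_)
    (((R1_momentum hl (Or.inr hh)).mono (subset_univ _)).glue (R1_momentum hk hr))
  rw [mem_singleton_iff.1 hx0, mul_zero]; rfl

theorem R1c_fluxConstraint (hl : ul ∈ M.Ω) (hr : ur ∈ M.Ω) : M.FluxConstraint (M.R1c ul ur) := by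
  by_cases h : (ul, ur) ∈ M.C1
  · rw [R1c_of_mem_C1 h]; exact h.2.2
  · have hN : (ul, ur) ∈ M.N1 := ⟨⟨hl, hr⟩, h⟩
    obtain ⟨-, -, ⟨h1, h2, h3, h4, -⟩, -⟩ := pair1_spec hl hr hN
    rw [R1c_of_mem_N1 hN]
    exact ⟨_, _, glue_left h1, glue_right h2, h3.le.trans h4, h4⟩

/-! ### The second constrained solver -/

theorem pair2_spec (hl : ul ∈ M.Ω) (hr : ur ∈ M.Ω) (h : M.Exceeds ul ur) :
    M.IsR2Pair ul ur (M.pair2 ul ur) :=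
  Classical.epsilon_spec (exists_isR2Pair hl hr h)

theorem exceeds_of_mem_N2 (hl : ul ∈ M.Ω) (hr : ur ∈ M.Ω) (h : (ul, ur) ∈ M.N2) :
    M.Exceeds ul ur :=
  exceeds_of_R2 hl hr fun hf => h.2 ⟨hl, hr, hf⟩

theorem R2c_of_mem_C2 (h : (ul, ur) ∈ M.C2) : M.R2c ul ur = M.R2 ul ur := if_pos h

variable (M) in
/-- The exceptional data of the second constrained solver, for which the solution on `x < 0` passes
from the congested to the free phase and back. -/
def IsDetour (ul ur : State) : Prop :=
  ul ∉ M.Ωf ∧ ur ∈ M.Ωf ∧ Q (M.uc (M.W ul)) < M.Q0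

open scoped Classical in
variable (M) in
/-- The part of the second constrained solver on the left of the constraint. -/
noncomputable def R2cLeft (ul ur : State) : ℝ → State :=
  if M.IsDetour ul ur then
    fun x => if x < σ (M.uf (M.W ul)) (M.pair2 ul ur).1 then M.R2 ul (M.uf (M.W ul)) x
      else (M.pair2 ul ur).1
  else M.R2 ul (M.pair2 ul ur).1

theorem R2c_of_mem_N2 (h : (ul, ur) ∈ M.N2) :
    M.R2c ul ur = glue (M.R2cLeft ul ur) (M.R2 (M.pair2 ul ur).2 ur) := by
  have h' : (ul, ur) ∉ M.C2 := h.2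
  unfold R2c R2cLeft IsDetour
  rw [if_neg h']
  split_ifs <;> rfl

/-- Without a detour, the optimal left trace is attained by the second solver. -/
theorem R2_left_trace (hl : ul ∈ M.Ω) (hr : ur ∈ M.Ω) (hE : M.Exceeds ul ur)
    (hd : ¬ M.IsDetour ul ur) {uh : State} (hh : M.IsMinLeft ul uh) : LeftAt (M.R2 ul uh) uh := by
  have hc := hh.mem
  have hQ : Q uh ≤ M.Q0 := hh.flow.le.trans flow2_le
  by_cases hlf : ul ∈ M.Ωf
  · have hlt : Q uh < Q ul := hQ.trans_lt (hE.left_free hlf)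
    have hhf : uh ∉ M.Ωf := fun hf => by
      -- a free trace with a larger marker would be denser than `ul`, hence carry more flow
      have e := uf_eq_of_mem hf hc
      have hw := free_marker hlf
      have h1 : M.rhof (M.W ul) ≤ M.rhof (M.W uh) := by
        refine (M.Vp_strictMonoOn.le_iff_le (rhof_spec hw).1
          (rhof_spec (Ωc_marker hc)).1).1 ?_
        simp only [(rhof_spec hw).2, (rhof_spec (Ωc_marker hc)).2]
        exact hh.marker
      have h2 : Q (M.uf (M.W ul)) ≤ Q (M.uf (M.W uh)) :=
        (Q_free_le (uf_mem hw) (uf_mem (Ωc_marker hc))).2 h1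
      rw [e] at h2
      exact absurd ((Q_le_Q_uf hlf).trans h2) hlt.not_ge
    by_cases hj : M.IsJump ul uh
    · exact R2_left_ur hj (Or.inr hc) hlt
    · have h0 : ul.1 ≠ 0 := fun h0 => by
        have := hE.left_free hlf
        rw [Q, h0, zero_mul] at this
        exact lt_asymm this M.Q0_pos
      have hW : M.W uh = M.W ul :=
        le_antisymm (not_lt.1 fun h => hj ⟨hlf, hhf, h0, h⟩) hh.marker
      rw [R2_of_not_jump hj]
      exact R1_left_trace hl hc hhf hW fun _ => hlt
  · have hlc := Ωc_of_notMem hl hlf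
    have hw := Ωc_marker hlc
    have hflow : M.flow2 ≤ Q (M.uc (M.W ul)) := by
      refine flow2_le.trans ?_
      by_cases hrf : ur ∈ M.Ωf
      · exact not_lt.1 fun h => hd ⟨hlf, hrf, h⟩
      · exact (hE.both hlf hrf).le.trans ((Q_cs_le hw (Ωc_speed (Ωc_of_notMem hr hrf))
          M.Vc_mem_speeds).2 (Ωc_of_notMem hr hrf).2.1.2)
    have hW := hh.same_marker hflow
    rw [R2_of_not_jump (not_isJump_of_notMem hlf)]
    exact R1_left_trace hl hc (hE.not_free_of_Q_le hc hW hQ) hW fun h => (hlf h).elim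

section detour

variable {uh : State}

/-- In the detour, the return to the congested phase has negative speed. It is faster than the
transition to the free phase, unless the two transitions cancel: the states `uc` and `uh` are in
this order on the ray `v = Vc`, below the free state. -/
theorem detour_speeds (hl : ul ∈ M.Ω) (hE : M.Exceeds ul ur) (hd : M.IsDetour ul ur)
    (hh : M.IsMinLeft ul uh) :
    (M.uf (M.W ul)).1 < uh.1 ∧
      σ (M.uf (M.W ul)) uh < 0 ∧
      (σ (M.uc (M.W ul)) (M.uf (M.W ul)) < σ (M.uf (M.W ul)) uh ∨ uh = M.uc (M.W ul)) := by
  obtain ⟨hlf, hrf, hQc⟩ := hd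
  have hw := Ω_marker hl
  set w := M.W ul
  have hQf := hE.left_cong hlf
  have hc := hh.mem
  have hlt : (M.uf w).1 < (M.uc w).1 := (uf_fst_le_uc hw).lt_of_ne fun e => by
    rw [uc_eq_uf_of_fst_eq hw e.symm] at hQc
    exact lt_asymm hQc hQf
  have hflow : Q (M.uc w) ≤ M.flow2 := by
    refine le_min hQc.le ?_
    exact (Q_cs_le_marker hw M.Wmax_mem M.Vc_mem_speeds M.Vc_pos).2 hw.2
  have hv : uh.2 = M.Vc := by
    rcases hflow.lt_or_eq with h | h
    · exact hh.speed h
    · have e : uh = M.uc w := Ωc_eq_of_Q hc (uc_mem hw)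
        ((hh.same_marker h.ge).trans (W_cs hw M.Vc_mem_speeds).symm) (hh.flow.trans h.symm)
      rw [e]; rfl
  have hle : (M.uc w).1 ≤ uh.1 := by
    have h1 : Q (M.uc w) ≤ Q uh := hflow.trans hh.flow.ge
    rw [Q, Q, hv, show (M.uc w).2 = M.Vc from rfl] at h1
    exact le_of_mul_le_mul_right h1 M.Vc_pos
  have hlt' := hlt.trans_le hle
  have hneg : σ (M.uf w) uh < 0 :=
    σ_neg hlt' ((hh.flow.le.trans flow2_le).trans_lt hQf)
  refine ⟨hlt', hneg, hle.lt_or_eq.imp (fun hlt'' => ?_) fun e => Prod.ext e.symm hv⟩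
  have h1 : Q uh = uh.1 * M.Vc := by rw [Q, hv]
  have h2 : Q (M.uc w) = (M.uc w).1 * M.Vc := rfl
  have h3 : (M.uf w).1 * M.Vc < Q (M.uf w) := by
    refine mul_lt_mul_of_pos_left ?_ (rhof_pos hw)
    have h4 := (M.p_lt_p (rhof_pos hw) (cs_pos hw M.Vc_mem_speeds)).2 hlt
    rw [p_cs hw M.Vc_mem_speeds] at h4
    have h5 := (rhof_spec hw).2
    exact (by linarith : M.Vc < M.V (M.rhof w))
  rw [σ_comm, σ, σ, div_lt_div_iff₀ (sub_pos.2 hlt) (sub_pos.2 hlt'), h1, h2]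
  nlinarith [mul_pos (sub_pos.2 hlt'') (sub_pos.2 h3)]

theorem detour_right_end (hl : ul ∈ M.Ω) (hlf : ul ∉ M.Ωf) {x : ℝ}
    (hx : σ (M.uc (M.W ul)) (M.uf (M.W ul)) ≤ x) (hx0 : x ≤ 0) :
    M.R2 ul (M.uf (M.W ul)) x = M.uf (M.W ul) := by
  have hf := uf_mem (Ω_marker hl)
  rw [R2_of_not_jump (not_isJump_of_mem hf), R1_of_cong_free hlf hf, if_neg (not_lt.2 hx),
    RLWR_of_nonpos hf hf hx0]

end detour

theorem R2cLeft_spec (hl : ul ∈ M.Ω) (hr : ur ∈ M.Ω) (hE : M.Exceeds ul ur) :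
    Profile M ul (M.pair2 ul ur).1 (M.R2cLeft ul ur) ∧ MomentumOn M (M.R2cLeft ul ur) (Iio 0) ∧
      LeftAt (M.R2cLeft ul ur) (M.pair2 ul ur).1 := by
  have hh := (pair2_spec hl hr hE).isMinLeft hl
  set uh := (M.pair2 ul ur).1
  have hhΩ : uh ∈ M.Ω := Or.inr hh.mem
  by_cases hd : M.IsDetour ul ur
  · obtain ⟨h1, h3, h2⟩ := detour_speeds hl hE hd hh
    have hw := Ω_marker hl
    have hf := uf_mem hw
    set s := σ (M.uf (M.W ul)) uh with hs
    have hle : σ (M.uc (M.W ul)) (M.uf (M.W ul)) ≤ s := by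
      rcases h2 with h2 | h2
      · exact h2.le
      · rw [hs, h2, σ_comm]
    have e : M.R2cLeft ul ur = fun x => if x < s then M.R2 ul (M.uf (M.W ul)) x else uh :=
      if_pos hd
    rw [e]
    refine ⟨(R2_profile hl (Or.inl hf)).ite_lt (Profile.const hhΩ) s ?_, ?_,
      LeftAt.of_Ioo h3 fun x hx _ => if_neg hx.le.not_gt⟩
    · rw [detour_right_end hl hd.1 hle h3.le]
      exact rankineHugoniot fun e => absurd e h1.ne
    · rcases h2 with h2 | h2
      · -- the congested zones are separated by a free one
        have hm := (R2_momentum hl (Or.inl hf)).mono (subset_univ (Iio s))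
        have hc : MomentumOn M (fun _ => uh) (Ioi s) := fun _ _ _ _ => ConservedOn.const _ _ _
        refine (MomentumOn.of_diff_singleton (c := s) (O := univ)
          (U := Ioo (σ (M.uc (M.W ul)) (M.uf (M.W ul))) s) isOpen_Ioo ?_ (fun x hx => ?_)
          ?_).mono (subset_univ _)
        · rw [closure_Ioo h2.ne]; exact right_mem_Icc.2 h2.le
        · rw [if_pos hx.2, detour_right_end hl hd.1 hx.1.le (hx.2.trans h3).le]; exact hf
        · rw [← compl_eq_univ_sdiff]
          exact .of_sides s (hm.congr isOpen_Iio fun x hx => if_pos (mem_Iio.1 hx))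
            (hc.congr isOpen_Ioi fun x hx => if_neg (mem_Ioi.1 hx).le.not_gt)
      · -- the two phase transitions cancel, and a single rarefaction remains
        have hlc := Ωc_of_notMem hl hd.1
        have hs' : s = σ (M.uc (M.W ul)) (M.uf (M.W ul)) := by rw [hs, h2, σ_comm]
        refine ((RARZ_momentum hlc (uc_mem hw)).mono (subset_univ _)).congr isOpen_Iio
          fun x hx => ?_
        split_ifs with hxs
        · rw [R2_of_not_jump (not_isJump_of_mem hf), R1_of_cong_free hd.1 hf,
            if_pos (hs' ▸ hxs)]
        · rw [RARZ_uc_end hlc (hs' ▸ not_lt.1 hxs) (mem_Iio.1 hx).le, h2]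
  · have e : M.R2cLeft ul ur = M.R2 ul uh := if_neg hd
    rw [e]
    exact ⟨R2_profile hl hhΩ, (R2_momentum hl hhΩ).mono (subset_univ _),
      R2_left_trace hl hr hE hd hh⟩

theorem R2c_isWeakSolution_of_mem_N2 (hl : ul ∈ M.Ω) (hr : ur ∈ M.Ω) (h : (ul, ur) ∈ M.N2) :
    IsWeakSolution M {0} ul ur (selfSimilar (M.R2c ul ur)) := by
  have hE := exceeds_of_mem_N2 hl hr h
  obtain ⟨hh, hk, ⟨h1, h2, h3, -⟩, -⟩ := pair2_spec hl hr hE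
  obtain ⟨hp, hm, ht⟩ := R2cLeft_spec hl hr hE
  rw [R2c_of_mem_N2 h]
  refine (hp.glue (R2_profile hk hr) ht.tendsto h1 (h2.trans h3.symm)).isWeakSolution
    (O := {0}ᶜ) (fun t ht x hx hx0 => hx ?_) (hm.glue (R2_momentum hk hr))
  rw [mem_singleton_iff.1 hx0, mul_zero]; rfl

theorem R2c_fluxConstraint (hl : ul ∈ M.Ω) (hr : ur ∈ M.Ω) : M.FluxConstraint (M.R2c ul ur) := by
  by_cases h : (ul, ur) ∈ M.C2
  · rw [R2c_of_mem_C2 h]; exact h.2.2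
  · have hN : (ul, ur) ∈ M.N2 := ⟨⟨hl, hr⟩, h⟩
    have hE := exceeds_of_mem_N2 hl hr hN
    obtain ⟨hh, hk, ⟨h1, h2, h3, -⟩, -⟩ := pair2_spec hl hr hE
    rw [R2c_of_mem_N2 hN]
    exact ⟨_, _, glue_left (R2cLeft_spec hl hr hE).2.2.tendsto, glue_right h1,
      h2.le.trans flow2_le, h3.le.trans flow2_le⟩

end Model

theorem glue_hasFlowAtZero {M : Model} {ul ur uh uk : State} (h : M.R1Cond ul ur uh uk) {t : ℝ}
    (ht : 0 < t) : HasFlowAtZero (selfSimilar (glue (M.R1 ul uh) (M.R1 uk ur)) t) (Q uh) :=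
  ⟨uh, uk, selfSimilar_left ht (glue_left h.1), selfSimilar_right ht (glue_right h.2.1), rfl,
    h.2.2.1.symm⟩

end TwoPhase

theorem mainTheorem3 (M : TwoPhase.Model) (ul ur : TwoPhase.State)
    (hl : ul ∈ M.Ω) (hr : ur ∈ M.Ω) :
    -- the first constrained solver gives a weak solution satisfying the flux constraint
    (((ul, ur) ∈ M.C1 →
        TwoPhase.IsWeakSolution M ∅ ul ur (TwoPhase.selfSimilar (M.R1c ul ur))) ∧
      ((ul, ur) ∈ M.N1 →
        TwoPhase.IsWeakSolution M {0} ul ur (TwoPhase.selfSimilar (M.R1c ul ur))) ∧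
      ∀ t : ℝ, 0 < t → M.FluxConstraint (TwoPhase.selfSimilar (M.R1c ul ur) t)) ∧
    -- so does the second one
    (((ul, ur) ∈ M.C2 →
        TwoPhase.IsWeakSolution M ∅ ul ur (TwoPhase.selfSimilar (M.R2c ul ur))) ∧
      ((ul, ur) ∈ M.N2 →
        TwoPhase.IsWeakSolution M {0} ul ur (TwoPhase.selfSimilar (M.R2c ul ur))) ∧
      ∀ t : ℝ, 0 < t → M.FluxConstraint (TwoPhase.selfSimilar (M.R2c ul ur) t)) ∧
    -- when the constraint is active, the first one is the unique maximizer of the flow at zero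
    ((ul, ur) ∈ M.N1 →
      (∃ uh ∈ M.Ωc, ∃ uk ∈ M.Ω, M.R1Cond ul ur uh uk ∧
        M.R1c ul ur =ᵐ[volume] TwoPhase.glue (M.R1 ul uh) (M.R1 uk ur)) ∧
      ∃ q : ℝ, (∀ t : ℝ, 0 < t →
          TwoPhase.HasFlowAtZero (TwoPhase.selfSimilar (M.R1c ul ur) t) q) ∧
        ∀ uh ∈ M.Ω, ∀ uk ∈ M.Ω, M.R1Cond ul ur uh uk →
          TwoPhase.IsWeakSolution M {0} ul ur
            (TwoPhase.selfSimilar (TwoPhase.glue (M.R1 ul uh) (M.R1 uk ur))) →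
          ∃ q' : ℝ, (∀ t : ℝ, 0 < t → TwoPhase.HasFlowAtZero
              (TwoPhase.selfSimilar (TwoPhase.glue (M.R1 ul uh) (M.R1 uk ur)) t) q') ∧
            q' ≤ q ∧
            (q' = q ↔
              TwoPhase.glue (M.R1 ul uh) (M.R1 uk ur) =ᵐ[volume] M.R1c ul ur)) := by
  open TwoPhase Model in
  refine ⟨⟨fun h => ?_, R1c_isWeakSolution_of_mem_N1 hl hr,
      fun t ht => fluxConstraint_selfSimilar ht (R1c_fluxConstraint hl hr)⟩,
    ⟨fun h => ?_, R2c_isWeakSolution_of_mem_N2 hl hr,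
      fun t ht => fluxConstraint_selfSimilar ht (R2c_fluxConstraint hl hr)⟩, fun h => ?_⟩
  · rw [R1c_of_mem_C1 h]
    exact (R1_profile hl hr).isWeakSolution (fun _ _ _ _ => trivial) (R1_momentum hl hr)
  · rw [R2c_of_mem_C2 h]
    exact (R2_profile hl hr).isWeakSolution (fun _ _ _ _ => trivial) (R2_momentum hl hr)
  · obtain ⟨hh, hk, hcond, hmax⟩ := pair1_spec hl hr h
    have e := R1c_of_mem_N1 h
    refine ⟨⟨_, hh, _, hk, hcond, by rw [e]⟩, Q (M.pair1 ul ur).1,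
      fun t ht => by rw [e]; exact glue_hasFlowAtZero hcond ht, fun uh huh uk huk hc _ => ?_⟩
    refine ⟨Q uh, fun t ht => glue_hasFlowAtZero hc ht, ?_, ?_⟩
    · by_cases hne : (uh, uk) = M.pair1 ul ur
      · rw [← hne]
      · exact (hmax (uh, uk) huh huk hne hc).le
    · rw [e]
      constructor
      · intro hq
        have hpair : (uh, uk) = M.pair1 ul ur :=
          by_contra fun hne => (hmax (uh, uk) huh huk hne hc).ne hq
        rw [← hpair]
      · intro hae
        rw [left_trace_eq_of_ae hae (glue_left hc.1) (glue_left hcond.1)]
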